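/- **Setting.** Let $R:(0,\infty)\to[0,\infty)$ be locally integrable. For $z>0$ put $S_z(t)=\exp\bigl(-\int_z^{ze^t}R(u)\,du\bigr)$, $t\ge 0$, with generalized inverse $S_z^{-1}(u)=\inf\{t\ge0: S_z(t)\le u\}\in[0,\infty]$. Let $(\Omega,\mathbb P)$ be a probability space with i.i.d. uniform random variables $U_1,U_2,\dots$ with values in $(0,1)$; put $J_k=\sqrt{U_{2k}}$ (so $J_k$ has density $2u$ on $(0,1)$), and assume, as one may, that $\prod_{k\ge1}J_k=0$ everywhere on $\Omega$. For $x>0$ set $\tau_0=0$, $Y_0=x$ and, for $k\ge1$, $\tau_k=\tau_{k-1}+S_{Y_{k-1}}^{-1}(U_{2k-1})$ (with $\tau_k=\infty$ if $\tau_{k-1}=\infty$) and $Y_k=xe^{\tau_k}\prod_{j\le k}J_j$. The *cell process* started at $x$ is $$X^x_t=xe^t\prod_{j\le k}J_j\ \text{ if }\tau_k\le t<\tau_{k+1}\ (k\ge0),\qquad X^x_t=0\ \text{ if } t\ge\lim_k\tau_k ,$$ and $X^0\equiv0$. Put $P_tf(x)=\mathbb E[f(X^x_t)]$ for $f:[0,\infty)\to\mathbb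 R$ bounded Borel. **Proposition.** (i) For every $x\ge0$ and every $\omega\in\Omega$ the path $t\mapsto X^x_t(\omega)$ is càdlàg on $[0,\infty)$; each $X^x_t$ is a random variable, the law of $X^x$ depends measurably on $x$, and $(P_t)_{t\ge0}$ is a semigroup of operators on bounded Borel functions, with $P_0f=f$. The cell process is a homogeneous strong Markov process with transition operators $(P_t)$: if $X$ is a process with càdlàg paths that under a probability measure $\mathbb P_x$ has the law of $X^x$, then for every stopping time $\tau$ (with values in $[0,\infty]$) of the natural filtration $\mathscr F$ of $X$, every $t\ge0$ and every bounded Borel $f$, $$\mathbb E_x\bigl[f(X_{\tau+t})\mathbf 1_{\tau<\infty}\,\big|\,\mathscr F_\tau\bigr]=P_tf(X_\tau)\,\mathbf 1_{\tau<\infty}\qquad \mathbb P_x\text{-a.s.}$$ Let moreover $\pi$ be a probability measure on $(0,\infty)$, absolutely continuous with respect to Lebesgue measure, whose distribution function $F$ is a stationary solution of the integrated growth-fragmentation equation, i.e. for all $t,x\ge0$ $$F(x)=F(e^{-t}x)+\int_0^t(e^{s-t}x)^2\int_{e^{s-t}x}^\infty\frac{R(z)}{z}\,dF(z)\,ds .$$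 (ii) $\pi$ is invariant: $\int P_tf\,d\pi=\int f\,d\pi$ for all $t\ge0$ and all bounded Borel $f$. (iii) For every $f\in C^1_c(0,\infty)$, extended by $0$ to $[0,\infty)$, the function $$\mathscr Lf(x)=xf'(x)+xR(x)\Bigl[\int_0^x\frac{2u}{x^2}f(u)\,du-f(x)\Bigr]$$ belongs to $L^1(\pi)$, and $t^{-1}(P_tf-f)\to\mathscr Lf$ in $L^1(\pi)$ as $t\downarrow0$. -/

import Mathlib

open MeasureTheory ProbabilityTheory Filter Topology Set
open scoped NNReal ENNReal

noncomputable section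

namespace CellProcess

/-- Right-continuous with left limits, as a function on `[0, ∞)`. -/
def IsCadlag (w : ℝ≥0 → ℝ≥0) : Prop :=
  ∀ t, ContinuousWithinAt w (Ici t) t ∧ ∃ l, Tendsto w (𝓝[<] t) (𝓝 l)

/-- An iid sequence of uniform random variables with values in `(0, 1)`, on a sample space on which
the product of the jump factors `√(U 1) * √(U 3) * √(U 5) * ⋯` vanishes identically.  (This product
vanishes almost surely in any case.) -/
structure IsUniformSequence {Ω : Type*} [MeasurableSpace Ω] (Pr : Measure Ω) (U : ℕ → Ω → ℝ) :
    Prop where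
  measurable : ∀ n, Measurable (U n)
  mem_Ioo : ∀ n ω, U n ω ∈ Ioo (0 : ℝ) 1
  map_eq : ∀ n, Pr.map (U n) = volume.restrict (Ioo (0 : ℝ) 1)
  indep : iIndepFun U Pr
  prod_eq_zero : ∀ ω, Tendsto (fun k => ∏ j ∈ Finset.range k, √(U (2 * j + 1) ω)) atTop (𝓝 0)

/-- The survivor function `S_z(t)` of the first jump time, for the process started at `z`. -/
def survivor (R : ℝ → ℝ) (z t : ℝ) : ℝ :=
  Real.exp (-∫ u in z..z * Real.exp t, R u)

/-- The generalized inverse `inf {t ≥ 0 : S_z(t) ≤ u}` of the survivor function; it is `∞` if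
there is no such `t`. -/
def survivorInv (R : ℝ → ℝ) (z u : ℝ) : ℝ≥0∞ :=
  ⨅ (t : ℝ≥0) (_ : survivor R z t ≤ u), (t : ℝ≥0∞)

/-- The product `J_1 ⋯ J_k` of the first `k` jump factors; the `j`-th factor is the square root of
a uniform variable, and so has density `2u` on `(0, 1)`. The entries of `u` with even index are
used for the jump times, those with odd index for the jump factors. -/
def factorProd (u : ℕ → ℝ) (k : ℕ) : ℝ :=
  ∏ j ∈ Finset.range k, √(u (2 * j + 1))

/-- The time `τ_k` of the `k`-th jump of the process started at `x`, with `τ_0 = 0`. Once it is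
`∞`, it remains so. The position right after the `k`-th jump is `x * exp τ_k * (J_1 ⋯ J_k)`. -/
def jumpTime (R : ℝ → ℝ) (x : ℝ≥0) (u : ℕ → ℝ) : ℕ → ℝ≥0∞
  | 0 => 0
  | k + 1 =>
    if jumpTime R x u k = ∞ then ∞
    else jumpTime R x u k +
      survivorInv R (x * Real.exp (jumpTime R x u k).toReal * factorProd u k) (u (2 * k))

open Classical in
/-- The cell process started at `x`, driven by the sequence `u` of numbers in `(0, 1)`:
it is `x * exp t * (J_1 ⋯ J_k)` for `τ_k ≤ t < τ_{k+1}`, and `0` from the time `lim τ_k` on.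
It is identically `0` for `x = 0`. -/
def cellProcess (R : ℝ → ℝ) (x : ℝ≥0) (u : ℕ → ℝ) (t : ℝ≥0) : ℝ≥0 :=
  if h : ∃ k, jumpTime R x u k ≤ t ∧ (t : ℝ≥0∞) < jumpTime R x u (k + 1) then
    x * (Real.exp t * factorProd u (Nat.find h)).toNNReal
  else 0

/-- The transition operators `P_t f (x) = 𝔼_x [f (X_t)]`. -/
def transitionOp {Ω : Type*} [MeasurableSpace Ω] (Pr : Measure Ω) (U : ℕ → Ω → ℝ) (R : ℝ → ℝ)
    (t : ℝ≥0) (f : ℝ≥0 → ℝ) (x : ℝ≥0) : ℝ :=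
  ∫ ω, f (cellProcess R x (fun n => U n ω) t) ∂Pr

/-- A bounded Borel function on `[0, ∞)`. -/
def IsBoundedBorel (f : ℝ≥0 → ℝ) : Prop :=
  Measurable f ∧ ∃ C : ℝ, ∀ x, |f x| ≤ C

/-- A process `X` on a probability space `(Ω, P)` that has càdlàg paths and the law (on the product
`σ`-algebra of the space of paths) of the cell process started at `x`. -/
structure IsRealization {Ω : Type*} [MeasurableSpace Ω] (Pr : Measure Ω) (U : ℕ → Ω → ℝ)
    (R : ℝ → ℝ) (x : ℝ≥0) {Ω' : Type*} [MeasurableSpace Ω'] (P : Measure Ω')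
    (X : ℝ≥0 → Ω' → ℝ≥0) : Prop where
  stronglyMeasurable : ∀ t, StronglyMeasurable (X t)
  cadlag : ∀ ω, IsCadlag (fun t => X t ω)
  law : P.map (fun ω t => X t ω) = Pr.map (fun ω t => cellProcess R x (fun n => U n ω) t)

/-- The right-hand side
`F_0(e^{-t} x) + ∫_0^t (e^{s-t} x)^2 (∫_{z > e^{s-t} x} R(z)/z dF_s(z)) ds` of the integrated
growth-fragmentation equation, for the distribution functions `F_s(x) = μ_s [0, x]`. All integrands
are nonnegative. -/
def growthFragOp (R : ℝ → ℝ) (μ : ℝ≥0 → Measure ℝ≥0) (t x : ℝ≥0) : ℝ≥0∞ :=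
  μ 0 (Iic ((Real.exp (-t)).toNNReal * x)) +
    ∫⁻ s in Icc (0 : ℝ) t, ENNReal.ofReal ((Real.exp (s - t) * x) ^ 2) *
      ∫⁻ z in Ioi ((Real.exp (s - t)).toNNReal * x), ENNReal.ofReal (R z / z) ∂(μ s.toNNReal)

/-- `π` is a stationary solution of the integrated growth-fragmentation equation: a probability
measure on `(0, ∞)`, absolutely continuous with respect to Lebesgue measure, such that the constant
family `μ_t = π` solves the equation. -/
structure IsStationary (R : ℝ → ℝ) (π : Measure ℝ≥0) : Prop where
  isProbabilityMeasure : IsProbabilityMeasure π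
  absolutelyContinuous : π.map ((↑) : ℝ≥0 → ℝ) ≪ (volume : Measure ℝ)
  zero : π {0} = 0
  stationary : ∀ t x : ℝ≥0, π (Iic x) = growthFragOp R (fun _ => π) t x

/-- The generator `ℒ f (x) = x f'(x) + x R(x) (∫_0^x (2u/x²) f(u) du - f(x))`. -/
def generator (R f : ℝ → ℝ) (x : ℝ) : ℝ :=
  x * deriv f x + x * R x * ((∫ u in (0 : ℝ)..x, 2 * u / x ^ 2 * f u) - f x)

end CellProcess

end

/-! Everything is read off the driving sequence, whose law `seqLaw` is a product of uniform laws.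
Write `S` for `survivor`. Between jumps the path follows the flow `x * exp t`. If jumps accumulate,
the path lies below `x * exp t * factorProd u k` for every `k`, so it tends to `0`, which is where
it stays; this gives càdlàg paths.

Markov property. Fix the number `k` of jumps up to time `s` and the first `2k` entries. That no
further jump occurs before `s` means that the next entry is below a constant `c`, a value of `S`.
Conditioned on this, the entry divided by `c` is again uniform (`map_rescaleSeq_seqLaw`), and by the
cocycle identity `survivor_add` the path after `s` is a cell process started at the present position
and driven by the rescaled sequence (`cellProcess_add`). Integration over the remaining entries
gives `markov`.

Strong Markov property. The semigroup preserves bounded continuous functions: moving the starting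
point along the flow amounts to shifting time, up to an error governed by `1 - S`
(`abs_cellOp_flow_le`), and time can be shifted continuously because jump times have no atoms. A
stopping time is approached from the right by grid times, where the fixed-time property applies.
Continuous functions then determine the laws involved, which gives all bounded Borel functions.

Invariance. Let `k y = ∫_{z > y} R(z)/z dπ(z)` (`tailRate`). The stationary equation says that `π`
has density `y * k y`; inserted in the definition of `k`, this gives `k y = ∫_y^∞ R k`, whose
solutions satisfy `k (x * exp s) = k x * S_x(s)`. So `k` absorbs the survival probability, and a
change of variables shows that under `π` the first jump time is exponential with rate `2`, the
position after the jump is independent of it and has law `π` again, and the part of the law without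
a jump by time `t` is `exp (-2t) π` (`lintegral_first_jump`, `lintegral_not_jumped`). Iterating this
renewal structure gives `π P_t ≥ (1 - qⁿ) π` with `q < 1`, hence `π P_t ≥ π`; two comparable
probability measures coincide.

Generator. Split the increment of `P_t f` at the first jump. The flow part is differentiation under
a bounded dominating function. What happens between the first jump and `t` is `o(t)` in the mean,
since the restart is from `π` and a jump by time `t` has probability of order `t`. The first jump
itself contributes, after multiplication by `k x`, the integral over `s ≤ t` of `jumpFlux` at `x *
exp s`; since `∫ x R dπ = 2`, the flux is in `L¹(x dx)`, where dilations are continuous, so the time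
average converges. -/

noncomputable section

namespace CellProcess

/-! ### The survivor function and its generalized inverse -/

section

/-- A nonnegative locally integrable function on `(0, ∞)`. -/
structure IsRate (R : ℝ → ℝ) : Prop where
  nonneg : ∀ x, 0 < x → 0 ≤ R x
  locallyIntegrableOn : LocallyIntegrableOn R (Ioi 0) volume

/-- The primitive `∫_1^z R`. -/
def cumRate (R : ℝ → ℝ) (z : ℝ) : ℝ := ∫ u in (1 : ℝ)..z, R u

variable {R : ℝ → ℝ}

theorem IsRate.integrableOn_Icc (hR : IsRate R) {a b : ℝ} (ha : 0 < a) :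
    IntegrableOn R (Icc a b) volume :=
  hR.locallyIntegrableOn.integrableOn_compact_subset
    (fun _ hx => lt_of_lt_of_le ha hx.1) isCompact_Icc

theorem IsRate.intervalIntegrable (hR : IsRate R) {a b : ℝ} (ha : 0 < a) (hb : 0 < b) :
    IntervalIntegrable R volume a b := by
  rw [intervalIntegrable_iff, uIoc]
  exact (hR.integrableOn_Icc (b := max a b) (lt_min ha hb)).mono_set Ioc_subset_Icc_self

theorem IsRate.integral_eq (hR : IsRate R) {a b : ℝ} (ha : 0 < a) (hb : 0 < b) :
    ∫ u in a..b, R u = cumRate R b - cumRate R a := by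
  rw [cumRate, cumRate, intervalIntegral.integral_interval_sub_left
    (hR.intervalIntegrable one_pos hb) (hR.intervalIntegrable one_pos ha)]

theorem IsRate.cumRate_mono (hR : IsRate R) {a b : ℝ} (ha : 0 < a) (hab : a ≤ b) :
    cumRate R a ≤ cumRate R b := by
  have h := hR.integral_eq ha (ha.trans_le hab)
  have : 0 ≤ ∫ u in a..b, R u :=
    intervalIntegral.integral_nonneg hab fun u hu => hR.nonneg u (ha.trans_le hu.1)
  linarith

theorem IsRate.continuousAt_cumRate (hR : IsRate R) {a : ℝ} (ha : 0 < a) :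
    ContinuousAt (cumRate R) a := by
  have hc : ContinuousOn (fun x => ∫ u in (a/2)..x, R u) (uIcc (a/2) (2*a)) := by
    apply intervalIntegral.continuousOn_primitive_interval
    rw [uIcc_of_le (by linarith)]
    exact hR.integrableOn_Icc (by linarith)
  have hn : uIcc (a/2) (2*a) ∈ 𝓝 a := by
    rw [uIcc_of_le (by linarith)]
    exact Icc_mem_nhds (by linarith) (by linarith)
  have h2 := (hc.continuousAt hn).add (continuousAt_const (y := cumRate R (a/2)))
  refine h2.congr ?_
  filter_upwards [lt_mem_nhds ha] with x hx
  simp only [Pi.add_apply]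
  rw [hR.integral_eq (by linarith) hx]; ring

theorem IsRate.continuousOn_cumRate (hR : IsRate R) : ContinuousOn (cumRate R) (Ioi 0) :=
  fun _ hx => (hR.continuousAt_cumRate hx).continuousWithinAt

@[simp] theorem survivor_zero_left (R : ℝ → ℝ) (t : ℝ) : survivor R 0 t = 1 := by
  simp [survivor]

@[simp] theorem survivor_zero_right (R : ℝ → ℝ) (z : ℝ) : survivor R z 0 = 1 := by
  simp [survivor]

theorem survivor_pos (R : ℝ → ℝ) (z t : ℝ) : 0 < survivor R z t := Real.exp_pos _

theorem IsRate.survivor_eq (hR : IsRate R) {z : ℝ} (hz : 0 < z) (t : ℝ) :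
    survivor R z t = Real.exp (cumRate R z - cumRate R (z * Real.exp t)) := by
  rw [survivor, hR.integral_eq hz (by positivity)]; ring_nf

theorem IsRate.survivor_antitone (hR : IsRate R) {z : ℝ} (hz : 0 ≤ z) :
    Antitone (survivor R z) := by
  rcases hz.eq_or_lt with rfl | hz
  · intro s t _; simp
  intro s t hst
  rw [hR.survivor_eq hz, hR.survivor_eq hz]
  have := hR.cumRate_mono (a := z * Real.exp s) (b := z * Real.exp t) (by positivity) (by gcongr)
  gcongr

theorem IsRate.continuous_survivor (hR : IsRate R) {z : ℝ} (hz : 0 ≤ z) :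
    Continuous (survivor R z) := by
  rcases hz.eq_or_lt with rfl | hz
  · have : survivor R 0 = fun _ => 1 := by ext; simp
    rw [this]; fun_prop
  rw [show survivor R z = _ from funext (hR.survivor_eq hz)]
  refine Real.continuous_exp.comp (continuous_const.sub ?_)
  exact hR.continuousOn_cumRate.comp_continuous (by fun_prop) fun t => by
    simp only [mem_Ioi]; positivity

theorem IsRate.survivor_le_one (hR : IsRate R) {z t : ℝ} (hz : 0 ≤ z) (ht : 0 ≤ t) :
    survivor R z t ≤ 1 := by
  simpa using hR.survivor_antitone hz ht

/-- The multiplicative cocycle along the flow: surviving `s + t` means surviving `s` and then `t`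
from the position reached. The Markov property rests on it. -/
theorem IsRate.survivor_add (hR : IsRate R) {z : ℝ} (hz : 0 ≤ z) (s t : ℝ) :
    survivor R z (s + t) = survivor R z s * survivor R (z * Real.exp s) t := by
  rcases hz.eq_or_lt with rfl | hz
  · simp
  rw [hR.survivor_eq hz, hR.survivor_eq hz, hR.survivor_eq (by positivity), ← Real.exp_add,
    Real.exp_add s, mul_assoc]
  ring_nf

theorem IsRate.measurable_survivor (hR : IsRate R) :
    Measurable fun p : ℝ≥0 × ℝ => survivor R p.1 p.2 := by
  -- `cumRate` is under control only on the positive half-line. Cut off there it is continuous away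
  -- from `0`, and the formula for `survivor` remains right at `z = 0`, where both terms vanish.
  have hΦ : Measurable ((Ioi (0 : ℝ)).indicator (cumRate R)) := by
    refine measurable_of_continuousOn_compl_singleton 0 fun x hx => ?_
    rcases lt_or_gt_of_ne (show x ≠ 0 from hx) with h | h
    · have : ContinuousAt ((Ioi (0 : ℝ)).indicator (cumRate R)) x := by
        refine (continuousAt_const (y := (0 : ℝ))).congr ?_
        filter_upwards [gt_mem_nhds h] with y hy
        rw [indicator_of_notMem (by simpa using hy.le)]
      exact this.continuousWithinAt
    · have : ContinuousAt ((Ioi (0 : ℝ)).indicator (cumRate R)) x := by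
        refine (hR.continuousAt_cumRate h).congr ?_
        filter_upwards [lt_mem_nhds h] with y hy
        rw [indicator_of_mem (by simpa using hy)]
      exact this.continuousWithinAt
  have h : (fun p : ℝ≥0 × ℝ => survivor R p.1 p.2) = fun p : ℝ≥0 × ℝ =>
      Real.exp ((Ioi (0 : ℝ)).indicator (cumRate R) p.1
        - (Ioi (0 : ℝ)).indicator (cumRate R) (p.1 * Real.exp p.2)) := by
    ext ⟨z, t⟩
    rcases eq_or_lt_of_le z.2 with hz | hz
    · have : (z : ℝ) = 0 := hz.symm
      simp [this]
    · have hz' : (0:ℝ) < z := hz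
      simp only
      rw [hR.survivor_eq hz', indicator_of_mem (by simpa using hz'),
        indicator_of_mem (by simp only [mem_Ioi]; positivity)]
  rw [h]
  have := hΦ.comp (g := (Ioi (0 : ℝ)).indicator (cumRate R))
    (f := fun p : ℝ≥0 × ℝ => (p.1 : ℝ) * Real.exp p.2) (by fun_prop)
  have h3 := hΦ.comp (g := (Ioi (0 : ℝ)).indicator (cumRate R))
    (f := fun p : ℝ≥0 × ℝ => (p.1 : ℝ)) (by fun_prop)
  exact Real.measurable_exp.comp (h3.sub this)

/-- `survivor R z` is antitone and right-continuous, so the infimum is attained when finite. This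
Galois connection replaces the definition of `survivorInv` from here on. -/
theorem IsRate.survivorInv_le_iff (hR : IsRate R) {z : ℝ} (hz : 0 ≤ z) (u : ℝ) (t : ℝ≥0) :
    survivorInv R z u ≤ t ↔ survivor R z t ≤ u := by
  constructor
  · intro h
    have key : ∀ s : ℝ≥0, t < s → survivor R z s ≤ u := by
      intro s hs
      have : survivorInv R z u < s := h.trans_lt (by exact_mod_cast hs)
      simp only [survivorInv, iInf_lt_iff] at this
      obtain ⟨r, hr, hrs⟩ := this
      exact (hR.survivor_antitone hz (by exact_mod_cast hrs.le)).trans hr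
    have hc : Tendsto (fun s : ℝ≥0 => survivor R z s) (𝓝[>] t) (𝓝 (survivor R z t)) :=
      (((hR.continuous_survivor hz).comp NNReal.continuous_coe).tendsto t).mono_left
        nhdsWithin_le_nhds
    exact le_of_tendsto hc (eventually_nhdsWithin_of_forall fun s hs => key s hs)
  · intro h
    exact iInf₂_le t h

theorem IsRate.lt_survivorInv_iff (hR : IsRate R) {z : ℝ} (hz : 0 ≤ z) (u : ℝ) (t : ℝ≥0) :
    (t : ℝ≥0∞) < survivorInv R z u ↔ u < survivor R z t := by
  rw [← not_le, hR.survivorInv_le_iff hz, not_le]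

theorem IsRate.survivorInv_pos (hR : IsRate R) {z u : ℝ} (hz : 0 ≤ z) (hu : u < 1) :
    0 < survivorInv R z u := by
  have := (hR.lt_survivorInv_iff hz u 0).2 (by simpa using hu)
  simpa using this

/-- One inequality is the Galois connection; the other is left-continuity of `survivor`, applicable
because `u < 1` makes the waiting time positive. It is what excludes atoms of the jump times. -/
theorem IsRate.survivor_eq_of_survivorInv_eq (hR : IsRate R) {z u : ℝ} (hz : 0 ≤ z) (hu : u < 1)
    {t : ℝ≥0} (h : survivorInv R z u = t) : survivor R z t = u := by
  refine le_antisymm ((hR.survivorInv_le_iff hz u t).1 h.le) ?_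
  have ht : 0 < t := by
    have := hR.survivorInv_pos hz hu
    rw [h] at this; exact_mod_cast this
  have hc : Tendsto (fun s : ℝ≥0 => survivor R z s) (𝓝[<] t) (𝓝 (survivor R z t)) :=
    (((hR.continuous_survivor hz).comp NNReal.continuous_coe).tendsto t).mono_left
      nhdsWithin_le_nhds
  have : (𝓝[<] t).NeBot := nhdsLT_neBot_of_exists_lt ⟨0, ht⟩
  refine ge_of_tendsto hc (eventually_nhdsWithin_of_forall fun s hs => ?_)
  exact ((hR.lt_survivorInv_iff hz u s).1 (by rw [h]; exact_mod_cast hs)).le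

/-- Loss of memory for a single waiting time: given survival up to `s`, the residual time is a fresh
waiting time from the position at `s`, with the rescaled level. -/
theorem IsRate.survivorInv_rescale (hR : IsRate R) {z v : ℝ} (hz : 0 ≤ z) (s : ℝ≥0)
    (hv : v < survivor R z s) :
    survivorInv R z v = s + survivorInv R (z * Real.exp s) (v / survivor R z s) := by
  refine ENNReal.eq_of_forall_le_nnreal_iff fun t => ?_
  rw [hR.survivorInv_le_iff hz]
  rcases lt_or_ge t s with hts | hst
  · refine iff_of_false ?_ ?_
    · exact not_le.2 (hv.trans_le (hR.survivor_antitone hz (by exact_mod_cast hts.le)))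
    · refine not_le.2 (lt_of_lt_of_le ?_ le_self_add)
      exact_mod_cast hts
  · obtain ⟨t, rfl⟩ := exists_add_of_le hst
    rw [ENNReal.coe_add, ENNReal.add_le_add_iff_left ENNReal.coe_ne_top,
      hR.survivorInv_le_iff (by positivity), NNReal.coe_add, hR.survivor_add hz,
      le_div_iff₀ (survivor_pos _ _ _), mul_comm]

theorem IsRate.measurable_survivorInv (hR : IsRate R) :
    Measurable fun p : ℝ≥0 × ℝ => survivorInv R p.1 p.2 := by
  refine measurable_of_Iio fun c => ?_
  have : (fun p : ℝ≥0 × ℝ => survivorInv R p.1 p.2) ⁻¹' Iio c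
      = ⋃ (q : ℚ) (_ : 0 ≤ q ∧ ENNReal.ofReal q < c),
          {p : ℝ≥0 × ℝ | survivor R p.1 q ≤ p.2} := by
    ext ⟨z, u⟩
    simp only [mem_preimage, mem_Iio, mem_iUnion, mem_ofPred_eq, exists_prop]
    constructor
    · intro h
      obtain ⟨q, hq0, hq1, hq2⟩ := ENNReal.lt_iff_exists_rat_btwn.1 h
      refine ⟨q, ⟨hq0, hq2⟩, ?_⟩
      have := (hR.survivorInv_le_iff z.2 u _).1 hq1.le
      rwa [Real.coe_toNNReal _ (by exact_mod_cast hq0)] at this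
    · rintro ⟨q, ⟨hq0, hq1⟩, h⟩
      refine lt_of_le_of_lt ?_ hq1
      refine (hR.survivorInv_le_iff z.2 u _).2 ?_
      rwa [Real.coe_toNNReal _ (by exact_mod_cast hq0)]
  rw [this]
  refine MeasurableSet.iUnion fun q => MeasurableSet.iUnion fun _ => ?_
  exact measurableSet_le (hR.measurable_survivor.comp (by fun_prop : Measurable
    fun p : ℝ≥0 × ℝ => (p.1, (q : ℝ)))) measurable_snd

end

/-! ### Driving sequences and pathwise restarts -/

section

variable {R : ℝ → ℝ}

/-- The sequence with its first `n` entries removed. -/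
def shiftSeq (n : ℕ) (u : ℕ → ℝ) : ℕ → ℝ := fun i => u (n + i)

/-- The first `n` entries of `u`, followed by the sequence `v`. -/
def catSeq (n : ℕ) (u v : ℕ → ℝ) : ℕ → ℝ := fun i => if i < n then u i else v (i - n)

/-- The sequence with its first entry divided by `c`. -/
def rescaleSeq (c : ℝ) (v : ℕ → ℝ) : ℕ → ℝ := Function.update v 0 (v 0 / c)

/-- The position right after the `k`-th jump. -/
def posAfter (R : ℝ → ℝ) (x : ℝ≥0) (u : ℕ → ℝ) (k : ℕ) : ℝ≥0 :=
  x * (Real.exp (jumpTime R x u k).toReal * factorProd u k).toNNReal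

theorem factorProd_nonneg (u : ℕ → ℝ) (k : ℕ) : 0 ≤ factorProd u k :=
  Finset.prod_nonneg fun _ _ => Real.sqrt_nonneg _

@[simp] theorem factorProd_zero (u : ℕ → ℝ) : factorProd u 0 = 1 := by simp [factorProd]

theorem factorProd_succ (u : ℕ → ℝ) (k : ℕ) :
    factorProd u (k + 1) = factorProd u k * √(u (2 * k + 1)) := by
  simp [factorProd, Finset.prod_range_succ]

theorem factorProd_add (u : ℕ → ℝ) (k j : ℕ) :
    factorProd u (k + j) = factorProd u k * factorProd (shiftSeq (2 * k) u) j := by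
  simp only [factorProd, Finset.prod_range_add, shiftSeq]
  congr 1
  refine Finset.prod_congr rfl fun i _ => ?_
  congr 2; ring

theorem factorProd_rescaleSeq (c : ℝ) (v : ℕ → ℝ) (k : ℕ) :
    factorProd (rescaleSeq c v) k = factorProd v k := by
  simp [factorProd, rescaleSeq]

theorem factorProd_antitone {u : ℕ → ℝ} (hu : ∀ n, u n ∈ Ioo (0 : ℝ) 1) :
    Antitone (factorProd u) := by
  refine antitone_nat_of_succ_le fun k => ?_
  rw [factorProd_succ]
  exact mul_le_of_le_one_right (factorProd_nonneg u k) (Real.sqrt_le_one.2 (hu _).2.le)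

theorem coe_posAfter (R : ℝ → ℝ) (x : ℝ≥0) (u : ℕ → ℝ) (k : ℕ) :
    (posAfter R x u k : ℝ) = x * Real.exp (jumpTime R x u k).toReal * factorProd u k := by
  rw [posAfter, NNReal.coe_mul, Real.coe_toNNReal _
    (mul_nonneg (Real.exp_pos _).le (factorProd_nonneg _ _)), mul_assoc]

@[simp] theorem jumpTime_zero (R : ℝ → ℝ) (x : ℝ≥0) (u : ℕ → ℝ) : jumpTime R x u 0 = 0 := rfl

/-- The case distinction in the definition of the jump times is redundant. -/
theorem jumpTime_succ (R : ℝ → ℝ) (x : ℝ≥0) (u : ℕ → ℝ) (k : ℕ) :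
    jumpTime R x u (k + 1)
      = jumpTime R x u k + survivorInv R (posAfter R x u k) (u (2 * k)) := by
  rw [jumpTime, coe_posAfter]
  split_ifs with h
  · rw [h, top_add]
  · rfl

theorem jumpTime_mono (R : ℝ → ℝ) (x : ℝ≥0) (u : ℕ → ℝ) : Monotone (jumpTime R x u) :=
  monotone_nat_of_le_succ fun k => by rw [jumpTime_succ]; exact le_self_add

theorem jumpTime_congr {x : ℝ≥0} {u v : ℕ → ℝ} {n : ℕ} (h : ∀ i < n, u i = v i) :
    ∀ k, 2 * k ≤ n → jumpTime R x u k = jumpTime R x v k ∧ factorProd u k = factorProd v k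
  | 0, _ => by simp
  | k + 1, hk => by
    obtain ⟨h1, h2⟩ := jumpTime_congr h k (by omega)
    refine ⟨?_, ?_⟩
    · rw [jumpTime_succ, jumpTime_succ, posAfter, posAfter, h1, h2, h _ (by omega)]
    · rw [factorProd_succ, factorProd_succ, h2, h _ (by omega)]

theorem jumpTime_catSeq (x : ℝ≥0) (u v : ℕ → ℝ) (k : ℕ) :
    jumpTime R x (catSeq (2 * k) u v) k = jumpTime R x u k ∧
      factorProd (catSeq (2 * k) u v) k = factorProd u k :=
  jumpTime_congr (n := 2 * k) (fun i hi => by simp [catSeq, hi]) k le_rfl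

theorem posAfter_catSeq (x : ℝ≥0) (u v : ℕ → ℝ) (k : ℕ) :
    posAfter R x (catSeq (2 * k) u v) k = posAfter R x u k := by
  rw [posAfter, posAfter, (jumpTime_catSeq (R := R) x u v k).1,
    (jumpTime_catSeq (R := R) x u v k).2]

@[simp] theorem shiftSeq_catSeq (n : ℕ) (u v : ℕ → ℝ) : shiftSeq n (catSeq n u v) = v := by
  ext i; simp [shiftSeq, catSeq]

/-- The jump times restart afresh at each jump. -/
theorem jumpTime_add (R : ℝ → ℝ) (x : ℝ≥0) (u : ℕ → ℝ) (k : ℕ) :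
    ∀ j, jumpTime R x u (k + j)
      = jumpTime R x u k + jumpTime R (posAfter R x u k) (shiftSeq (2 * k) u) j
  | 0 => by simp
  | j + 1 => by
    have ih := jumpTime_add R x u k j
    rw [← add_assoc, jumpTime_succ, jumpTime_succ, ih, ← add_assoc]
    by_cases h : jumpTime R x u k = ∞
    · simp [h]
    by_cases h' : jumpTime R (posAfter R x u k) (shiftSeq (2 * k) u) j = ∞
    · simp [h']
    congr 2
    · rw [coe_posAfter, coe_posAfter, coe_posAfter, ih, ENNReal.toReal_add h h', Real.exp_add,
        factorProd_add]
      ring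
    · simp only [shiftSeq]; congr 1; ring

/-- Monotone jump times leave at most one such `k`, so the choice made by `Nat.find` is immaterial.
-/
theorem cellProcess_eq {x : ℝ≥0} {u : ℕ → ℝ} {t : ℝ≥0} {k : ℕ} (h1 : jumpTime R x u k ≤ t)
    (h2 : (t : ℝ≥0∞) < jumpTime R x u (k + 1)) :
    cellProcess R x u t = x * (Real.exp t * factorProd u k).toNNReal := by
  have h : ∃ k, jumpTime R x u k ≤ t ∧ (t : ℝ≥0∞) < jumpTime R x u (k + 1) := ⟨k, h1, h2⟩
  rw [cellProcess, dif_pos h]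
  congr 4
  refine (Nat.find_eq_iff _).2 ⟨⟨h1, h2⟩, fun j hj hj' => ?_⟩
  exact absurd (hj'.2.trans_le (jumpTime_mono R x u (Nat.succ_le_of_lt hj))) (not_lt.2 h1)

theorem cellProcess_eq_zero {x : ℝ≥0} {u : ℕ → ℝ} {t : ℝ≥0} (h : ∀ k, jumpTime R x u k ≤ t) :
    cellProcess R x u t = 0 := by
  rw [cellProcess, dif_neg]
  rintro ⟨k, -, hk⟩
  exact absurd hk (not_lt.2 (h _))

theorem exists_jumpTime_le_lt_or (R : ℝ → ℝ) (x : ℝ≥0) (u : ℕ → ℝ) (t : ℝ≥0) :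
    (∃ k, jumpTime R x u k ≤ t ∧ (t : ℝ≥0∞) < jumpTime R x u (k + 1)) ∨
      ∀ k, jumpTime R x u k ≤ t := by
  rw [or_iff_not_imp_left]
  intro h k
  push Not at h
  induction k with
  | zero => simp
  | succ k ih => exact h k ih

theorem coe_mul_toNNReal_exp_mul (x : ℝ≥0) (u : ℕ → ℝ) (k : ℕ) (t : ℝ) :
    ((x * (Real.exp t * factorProd u k).toNNReal : ℝ≥0) : ℝ)
      = x * (Real.exp t * factorProd u k) := by
  rw [NNReal.coe_mul, Real.coe_toNNReal _ (mul_nonneg (Real.exp_pos _).le (factorProd_nonneg _ _))]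

@[simp] theorem cellProcess_zero_left (R : ℝ → ℝ) (u : ℕ → ℝ) (t : ℝ≥0) :
    cellProcess R 0 u t = 0 := by
  rw [cellProcess]; split_ifs <;> simp

/-- The path after the `k`-th jump is the path started afresh from the position after the jump. -/
theorem cellProcess_restart {x : ℝ≥0} {u : ℕ → ℝ} {k : ℕ} {a : ℝ≥0}
    (ha : jumpTime R x u k = a) (t : ℝ≥0) :
    cellProcess R x u (a + t) = cellProcess R (posAfter R x u k) (shiftSeq (2 * k) u) t := by
  rcases exists_jumpTime_le_lt_or R (posAfter R x u k) (shiftSeq (2 * k) u) t with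
    ⟨j, h1, h2⟩ | h
  · rw [cellProcess_eq h1 h2, cellProcess_eq (k := k + j)]
    · ext
      rw [coe_mul_toNNReal_exp_mul, coe_mul_toNNReal_exp_mul, coe_posAfter, ha, factorProd_add,
        NNReal.coe_add, Real.exp_add, ENNReal.coe_toReal]
      ring
    · rw [jumpTime_add, ha, ENNReal.coe_add]; gcongr
    · rw [add_assoc, jumpTime_add, ha, ENNReal.coe_add]
      exact (ENNReal.add_lt_add_iff_left ENNReal.coe_ne_top).2 h2
  · rw [cellProcess_eq_zero h, cellProcess_eq_zero]
    intro i
    refine (jumpTime_mono R x u (Nat.le_add_left i k)).trans ?_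
    rw [jumpTime_add, ha, ENNReal.coe_add]; gcongr; exact h i

/-- The jump times of the path observed from a time `s` before its first jump. -/
theorem IsRate.jumpTime_rescale (hR : IsRate R) {x : ℝ≥0} {v : ℕ → ℝ} {s : ℝ≥0}
    (hv : v 0 < survivor R x s) : ∀ j, jumpTime R x v (j + 1)
      = s + jumpTime R (x * (Real.exp s).toNNReal) (rescaleSeq (survivor R x s) v) (j + 1)
  -- The zeroth jump time is `0` on both sides and is not delayed by `s`; the recursion therefore
  -- starts at the first jump, the only one that reads the rescaled entry.
  | 0 => by
    rw [jumpTime_succ, jumpTime_succ]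
    simp only [jumpTime_zero, zero_add, coe_posAfter, factorProd_zero, mul_zero,
      ENNReal.toReal_zero, Real.exp_zero, mul_one, rescaleSeq, Function.update_self, NNReal.coe_mul,
      Real.coe_toNNReal _ (Real.exp_pos _).le]
    exact hR.survivorInv_rescale x.2 s hv
  | j + 1 => by
    have ih := hR.jumpTime_rescale hv j
    rw [jumpTime_succ _ _ _ (j + 1), jumpTime_succ _ _ _ (j + 1), ih, add_assoc]
    by_cases h : jumpTime R (x * (Real.exp s).toNNReal) (rescaleSeq (survivor R x s) v) (j + 1) = ∞
    · simp [h]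
    congr 3
    · rw [coe_posAfter, coe_posAfter, ih, ENNReal.toReal_add ENNReal.coe_ne_top h, Real.exp_add,
        factorProd_rescaleSeq, NNReal.coe_mul, Real.coe_toNNReal _ (Real.exp_pos _).le,
        ENNReal.coe_toReal]
      ring

/-- The path after a time `s` before the first jump is a path started from the position at `s`. -/
theorem IsRate.cellProcess_rescale (hR : IsRate R) {x : ℝ≥0} {v : ℕ → ℝ} {s : ℝ≥0}
    (hv : v 0 < survivor R x s) (t : ℝ≥0) :
    cellProcess R x v (s + t)
      = cellProcess R (x * (Real.exp s).toNNReal) (rescaleSeq (survivor R x s) v) t := by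
  have hJ := hR.jumpTime_rescale hv
  rcases exists_jumpTime_le_lt_or R (x * (Real.exp s).toNNReal)
    (rescaleSeq (survivor R x s) v) t with ⟨j, h1, h2⟩ | h
  · rw [cellProcess_eq h1 h2, cellProcess_eq (k := j)]
    · ext
      rw [coe_mul_toNNReal_exp_mul, coe_mul_toNNReal_exp_mul, factorProd_rescaleSeq,
        NNReal.coe_mul, Real.coe_toNNReal _ (Real.exp_pos _).le, NNReal.coe_add, Real.exp_add]
      ring
    · cases j with
      | zero => simp
      | succ j => rw [hJ, ENNReal.coe_add]; gcongr
    · rw [hJ, ENNReal.coe_add]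
      exact (ENNReal.add_lt_add_iff_left ENNReal.coe_ne_top).2 h2
  · rw [cellProcess_eq_zero h, cellProcess_eq_zero]
    intro i
    refine (jumpTime_mono R x v (Nat.le_succ i)).trans ?_
    rw [hJ, ENNReal.coe_add]; gcongr; exact h _

theorem IsRate.lt_jumpTime_one_iff (hR : IsRate R) (x : ℝ≥0) (u : ℕ → ℝ) (s : ℝ≥0) :
    (s : ℝ≥0∞) < jumpTime R x u 1 ↔ u 0 < survivor R x s := by
  rw [← hR.lt_survivorInv_iff (NNReal.coe_nonneg x), ← zero_add 1, jumpTime_succ]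
  simp [coe_posAfter]

theorem IsRate.jumpTime_one (x : ℝ≥0) (u : ℕ → ℝ) :
    jumpTime R x u 1 = survivorInv R x (u 0) := by
  rw [← zero_add 1, jumpTime_succ]
  simp [coe_posAfter]

/-- The path after a time `s` between the `k`-th and the next jump is a path started from the
position at `s`, driven by the rescaled remainder of the driving sequence. -/
theorem IsRate.cellProcess_add (hR : IsRate R) {x : ℝ≥0} {u : ℕ → ℝ} {k : ℕ} {a r : ℝ≥0}
    (ha : jumpTime R x u k = a) (hr : u (2 * k) < survivor R (posAfter R x u k) r) (t : ℝ≥0) :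
    cellProcess R x u (a + r + t) = cellProcess R (posAfter R x u k * (Real.exp r).toNNReal)
      (rescaleSeq (survivor R (posAfter R x u k) r) (shiftSeq (2 * k) u)) t := by
  rw [add_assoc, cellProcess_restart ha, hR.cellProcess_rescale]
  simpa [shiftSeq] using hr

theorem IsRate.lt_jumpTime_succ_iff (hR : IsRate R) {x : ℝ≥0} {u : ℕ → ℝ} {k : ℕ} {a r : ℝ≥0}
    (ha : jumpTime R x u k = a) : ((a + r : ℝ≥0) : ℝ≥0∞) < jumpTime R x u (k + 1) ↔
      u (2 * k) < survivor R (posAfter R x u k) r := by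
  rw [jumpTime_succ, ha, ENNReal.coe_add, ENNReal.add_lt_add_iff_left ENNReal.coe_ne_top,
    hR.lt_survivorInv_iff (NNReal.coe_nonneg _)]

theorem IsRate.cellProcess_of_lt (hR : IsRate R) {x : ℝ≥0} {u : ℕ → ℝ} {k : ℕ} {a r : ℝ≥0}
    (ha : jumpTime R x u k = a) (hr : u (2 * k) < survivor R (posAfter R x u k) r) :
    cellProcess R x u (a + r) = posAfter R x u k * (Real.exp r).toNNReal := by
  rw [cellProcess_eq (k := k) (by rw [ha]; exact_mod_cast le_self_add)
    ((hR.lt_jumpTime_succ_iff ha).2 hr)]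
  ext
  rw [coe_mul_toNNReal_exp_mul, NNReal.coe_mul, coe_posAfter, ha,
    Real.coe_toNNReal _ (Real.exp_pos _).le, NNReal.coe_add, Real.exp_add, ENNReal.coe_toReal]
  ring

theorem IsRate.jumpTime_one_pos (hR : IsRate R) (x : ℝ≥0) {u : ℕ → ℝ} (hu : u 0 < 1) :
    0 < jumpTime R x u 1 := by
  have := (hR.lt_jumpTime_one_iff x u 0).2 (by simpa using hu)
  simpa using this

theorem IsRate.cellProcess_zero (hR : IsRate R) (x : ℝ≥0) {u : ℕ → ℝ} (hu : u 0 < 1) :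
    cellProcess R x u 0 = x := by
  rw [cellProcess_eq (k := 0) (by simp) (by simpa using hR.jumpTime_one_pos x hu)]
  simp

/-- Later factors only lower the path, and absorption puts it at `0`. The bound forces the path to
`0` at an accumulation point of jumps and controls it for small `x`. -/
theorem cellProcess_le {x : ℝ≥0} {u : ℕ → ℝ} (hu : ∀ n, u n ∈ Ioo (0 : ℝ) 1) {t : ℝ≥0} {k : ℕ}
    (hk : jumpTime R x u k ≤ t) :
    (cellProcess R x u t : ℝ) ≤ x * (Real.exp t * factorProd u k) := by
  have := factorProd_nonneg u k
  rcases exists_jumpTime_le_lt_or R x u t with ⟨j, h1, h2⟩ | h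
  · rw [cellProcess_eq h1 h2, coe_mul_toNNReal_exp_mul]
    have hkj : k ≤ j := by
      by_contra! hlt
      exact absurd (h2.trans_le (jumpTime_mono R x u (Nat.succ_le_of_lt hlt))) (not_lt.2 hk)
    have := factorProd_antitone hu hkj
    gcongr
  · rw [cellProcess_eq_zero h]
    simp only [NNReal.coe_zero]; positivity

theorem cellProcess_le_exp {u : ℕ → ℝ} (hu : ∀ n, u n ∈ Ioo (0 : ℝ) 1) (x t : ℝ≥0) :
    (cellProcess R x u t : ℝ) ≤ x * Real.exp t := by
  simpa using cellProcess_le (R := R) (x := x) hu (t := t) (k := 0) (by simp)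

/-! ### Regularity of the paths -/

theorem continuous_flow (x : ℝ≥0) (u : ℕ → ℝ) (k : ℕ) :
    Continuous fun t : ℝ≥0 => x * (Real.exp t * factorProd u k).toNNReal := by
  fun_prop

theorem continuousWithinAt_cellProcess (R : ℝ → ℝ) (x : ℝ≥0) (u : ℕ → ℝ) (t : ℝ≥0) :
    ContinuousWithinAt (cellProcess R x u) (Ici t) t := by
  rcases exists_jumpTime_le_lt_or R x u t with ⟨k, h1, h2⟩ | h
  · refine ((continuous_flow x u k).continuousWithinAt).congr_of_eventuallyEq ?_
      (cellProcess_eq h1 h2)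
    have : ∀ᶠ s : ℝ≥0 in 𝓝 t, (s : ℝ≥0∞) < jumpTime R x u (k + 1) :=
      ENNReal.continuous_coe.continuousAt.eventually_lt continuousAt_const h2
    filter_upwards [self_mem_nhdsWithin, mem_nhdsWithin_of_mem_nhds this] with s hs1 hs2
    exact cellProcess_eq (h1.trans (by exact_mod_cast hs1)) hs2
  · refine (continuousWithinAt_const (b := (0 : ℝ≥0))).congr_of_eventuallyEq ?_
      (cellProcess_eq_zero h)
    filter_upwards [self_mem_nhdsWithin] with s hs
    exact cellProcess_eq_zero fun k => (h k).trans (by exact_mod_cast hs)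

/-- The limit of the path from the left, at a time that is not the beginning. -/
theorem tendsto_cellProcess_left {x : ℝ≥0} {u : ℕ → ℝ} (hu : ∀ n, u n ∈ Ioo (0 : ℝ) 1)
    (h0 : Tendsto (factorProd u) atTop (𝓝 0)) {t : ℝ≥0} (ht : 0 < t) :
    (∃ k, jumpTime R x u k < t ∧ (t : ℝ≥0∞) ≤ jumpTime R x u (k + 1) ∧
      Tendsto (cellProcess R x u) (𝓝[<] t) (𝓝 (x * (Real.exp t * factorProd u k).toNNReal))) ∨
    ((∀ k, jumpTime R x u k < t) ∧ Tendsto (cellProcess R x u) (𝓝[<] t) (𝓝 0)) := by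
  have ev : ∀ k, jumpTime R x u k < t → ∀ᶠ s : ℝ≥0 in 𝓝[<] t, jumpTime R x u k < s :=
    fun k hk => mem_nhdsWithin_of_mem_nhds
      (continuousAt_const.eventually_lt ENNReal.continuous_coe.continuousAt hk)
  -- Either some jump is the last one strictly before `t`, or infinitely many jumps precede `t`.
  by_cases h : ∃ k, jumpTime R x u k < t ∧ (t : ℝ≥0∞) ≤ jumpTime R x u (k + 1)
  · obtain ⟨k, h1, h2⟩ := h
    refine Or.inl ⟨k, h1, h2, ?_⟩
    refine (((continuous_flow x u k).tendsto t).mono_left nhdsWithin_le_nhds).congr' ?_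
    filter_upwards [self_mem_nhdsWithin, ev k h1] with s hs1 hs2
    exact (cellProcess_eq hs2.le (lt_of_lt_of_le (by exact_mod_cast hs1) h2)).symm
  · push Not at h
    have hall : ∀ k, jumpTime R x u k < t := by
      intro k
      induction k with
      | zero => simpa using ht
      | succ k ih => exact h k ih
    refine Or.inr ⟨hall, ?_⟩
    rw [← NNReal.tendsto_coe, NNReal.coe_zero]
    rw [tendsto_order]
    refine ⟨fun a ha => Eventually.of_forall fun s => ha.trans_le (NNReal.coe_nonneg _),
      fun a ha => ?_⟩
    -- With all jumps before `t`, the bound of `cellProcess_le` holds near `t` for each fixed `k`,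
    -- and its damping factor can be made small by the choice of `k`.
    have : Tendsto (fun k => (x : ℝ) * (Real.exp t * factorProd u k)) atTop (𝓝 0) := by
      simpa using (h0.const_mul (Real.exp t)).const_mul (x : ℝ)
    obtain ⟨k, hk⟩ := (this.eventually (gt_mem_nhds ha)).exists
    filter_upwards [self_mem_nhdsWithin, ev k (hall k)] with s hs1 hs2
    refine lt_of_le_of_lt ((cellProcess_le hu hs2.le).trans ?_) hk
    have := factorProd_nonneg u k
    have h3 : (s : ℝ) ≤ t := by exact_mod_cast (le_of_lt hs1)
    gcongr

theorem isCadlag_cellProcess {u : ℕ → ℝ} (hu : ∀ n, u n ∈ Ioo (0 : ℝ) 1)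
    (h0 : Tendsto (factorProd u) atTop (𝓝 0)) (R : ℝ → ℝ) (x : ℝ≥0) :
    IsCadlag (cellProcess R x u) := by
  intro t
  refine ⟨continuousWithinAt_cellProcess R x u t, ?_⟩
  rcases eq_or_lt_of_le (zero_le (a := t)) with rfl | ht
  -- There is nothing to the left of `0` in `ℝ≥0`, so any value serves as left limit.
  · exact ⟨0, by simp⟩
  · rcases tendsto_cellProcess_left (R := R) (x := x) hu h0 ht with ⟨k, -, -, h⟩ | ⟨-, h⟩
    exacts [⟨_, h⟩, ⟨_, h⟩]

/-- The path is continuous at all times that are not jump times. -/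
theorem continuousAt_cellProcess {u : ℕ → ℝ} (hu : ∀ n, u n ∈ Ioo (0 : ℝ) 1)
    (h0 : Tendsto (factorProd u) atTop (𝓝 0)) {x t : ℝ≥0} (ht : 0 < t)
    (hj : ∀ k, jumpTime R x u k ≠ t) : ContinuousAt (cellProcess R x u) t := by
  rw [continuousAt_iff_continuous_left'_right']
  refine ⟨?_, (continuousWithinAt_cellProcess R x u t).mono Ioi_subset_Ici_self⟩
  rcases tendsto_cellProcess_left (R := R) (x := x) hu h0 ht with ⟨k, h1, h2, h⟩ | ⟨h1, h⟩
  · rw [ContinuousWithinAt, cellProcess_eq h1.le (lt_of_le_of_ne h2 (hj _).symm)]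
    exact h
  · rw [ContinuousWithinAt, cellProcess_eq_zero fun k => (h1 k).le]
    exact h

/-! ### Measurability in the starting point, the sequence and the time -/

theorem measurable_factorProd (k : ℕ) : Measurable fun u : ℕ → ℝ => factorProd u k := by
  unfold factorProd
  exact Finset.measurable_prod _ fun j _ =>
    Real.continuous_sqrt.measurable.comp (measurable_pi_apply _)

theorem IsRate.measurable_jumpTime (hR : IsRate R) :
    ∀ k, Measurable fun p : ℝ≥0 × (ℕ → ℝ) => jumpTime R p.1 p.2 k
  | 0 => by simp only [jumpTime_zero]; exact measurable_const
  | k + 1 => by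
    have ih := hR.measurable_jumpTime k
    have hp : Measurable fun p : ℝ≥0 × (ℕ → ℝ) => posAfter R p.1 p.2 k := by
      unfold posAfter
      have : Measurable fun p : ℝ≥0 × (ℕ → ℝ) => factorProd p.2 k :=
        (measurable_factorProd k).comp measurable_snd
      exact measurable_fst.mul (((Real.measurable_exp.comp ih.ennreal_toReal).mul this).real_toNNReal)
    simp only [jumpTime_succ]
    refine ih.add (hR.measurable_survivorInv.comp (f := fun p : ℝ≥0 × (ℕ → ℝ) =>
      (posAfter R p.1 p.2 k, p.2 (2 * k))) ?_)
    exact hp.prodMk (by fun_prop)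

theorem IsRate.measurable_cellProcess_uncurry (hR : IsRate R) :
    Measurable fun p : ℝ≥0 × (ℕ → ℝ) × ℝ≥0 => cellProcess R p.1 p.2.1 p.2.2 := by
  have hJ : ∀ k, Measurable fun p : ℝ≥0 × (ℕ → ℝ) × ℝ≥0 => jumpTime R p.1 p.2.1 k := fun k =>
    (hR.measurable_jumpTime k).comp (f := fun p : ℝ≥0 × (ℕ → ℝ) × ℝ≥0 => (p.1, p.2.1))
      (by fun_prop)
  have ht : Measurable fun p : ℝ≥0 × (ℕ → ℝ) × ℝ≥0 => (p.2.2 : ℝ≥0∞) := by fun_prop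
  have hF : ∀ k, Measurable fun p : ℝ≥0 × (ℕ → ℝ) × ℝ≥0 =>
      p.1 * (Real.exp p.2.2 * factorProd p.2.1 k).toNNReal := fun k => by
    have := (measurable_factorProd k).comp (f := fun p : ℝ≥0 × (ℕ → ℝ) × ℝ≥0 => p.2.1)
      (by fun_prop)
    have h2 : Measurable fun p : ℝ≥0 × (ℕ → ℝ) × ℝ≥0 => Real.exp p.2.2 := by fun_prop
    exact measurable_fst.mul (h2.mul this).real_toNNReal
  intro A hA
  have : (fun p : ℝ≥0 × (ℕ → ℝ) × ℝ≥0 => cellProcess R p.1 p.2.1 p.2.2) ⁻¹' A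
      = (⋃ k, {p : ℝ≥0 × (ℕ → ℝ) × ℝ≥0 | (jumpTime R p.1 p.2.1 k ≤ p.2.2 ∧
          (p.2.2 : ℝ≥0∞) < jumpTime R p.1 p.2.1 (k + 1)) ∧
          p.1 * (Real.exp p.2.2 * factorProd p.2.1 k).toNNReal ∈ A}) ∪
        {p | (∀ k, jumpTime R p.1 p.2.1 k ≤ p.2.2) ∧ (0 : ℝ≥0) ∈ A} := by
    ext p
    simp only [mem_preimage, mem_union, mem_iUnion, mem_ofPred_eq]
    constructor
    · intro h
      rcases exists_jumpTime_le_lt_or R p.1 p.2.1 p.2.2 with ⟨k, h1, h2⟩ | h0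
      · rw [cellProcess_eq h1 h2] at h
        exact Or.inl ⟨k, ⟨h1, h2⟩, h⟩
      · rw [cellProcess_eq_zero h0] at h
        exact Or.inr ⟨h0, h⟩
    · rintro (⟨k, ⟨h1, h2⟩, h⟩ | ⟨h0, h⟩)
      · rwa [cellProcess_eq h1 h2]
      · rwa [cellProcess_eq_zero h0]
  rw [this]
  refine (MeasurableSet.iUnion fun k => ?_).union ?_
  · exact ((measurableSet_le (hJ k) ht).inter (measurableSet_lt ht (hJ _))).inter (hF k hA)
  · have h0 : MeasurableSet (⋂ k, {p : ℝ≥0 × (ℕ → ℝ) × ℝ≥0 | jumpTime R p.1 p.2.1 k ≤ p.2.2}) :=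
      MeasurableSet.iInter fun k => measurableSet_le (hJ k) ht
    convert! h0.inter (MeasurableSet.const ((0 : ℝ≥0) ∈ A)) using 1
    ext p
    simp

theorem IsRate.measurable_cellProcess_prod (hR : IsRate R) (t : ℝ≥0) :
    Measurable fun p : ℝ≥0 × (ℕ → ℝ) => cellProcess R p.1 p.2 t :=
  hR.measurable_cellProcess_uncurry.comp (f := fun p : ℝ≥0 × (ℕ → ℝ) => (p.1, p.2, t))
    (by fun_prop)

theorem IsRate.measurable_cellProcess (hR : IsRate R) (x t : ℝ≥0) :
    Measurable fun u : ℕ → ℝ => cellProcess R x u t :=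
  (hR.measurable_cellProcess_prod t).comp (f := fun u : ℕ → ℝ => (x, u)) (by fun_prop)

theorem IsRate.measurable_path (hR : IsRate R) (x : ℝ≥0) :
    Measurable fun u : ℕ → ℝ => cellProcess R x u :=
  measurable_pi_iff.2 fun t => hR.measurable_cellProcess x t

/-! ### The law of the driving sequence -/

/-- The uniform distribution on `(0, 1)`. -/
def unif : Measure ℝ := volume.restrict (Ioo (0 : ℝ) 1)

instance : IsProbabilityMeasure unif := ⟨by simp [unif]⟩

/-- The law of a sequence of independent uniform variables. -/
def seqLaw : Measure (ℕ → ℝ) := Measure.infinitePi fun _ => unif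

instance : IsProbabilityMeasure seqLaw := by unfold seqLaw; infer_instance

/-- The sequences of numbers in `(0, 1)` for which the product of the jump factors vanishes. -/
def GoodSeq (u : ℕ → ℝ) : Prop :=
  (∀ n, u n ∈ Ioo (0 : ℝ) 1) ∧ Tendsto (factorProd u) atTop (𝓝 0)

theorem measurableSet_goodSeq : MeasurableSet {u | GoodSeq u} := by
  have h1 : MeasurableSet (⋂ n, (fun u : ℕ → ℝ => u n) ⁻¹' Ioo 0 1) :=
    MeasurableSet.iInter fun n => measurable_pi_apply n measurableSet_Ioo
  convert! h1.inter (measurableSet_tendsto (l := atTop) (𝓝 0)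
    fun k => measurable_factorProd k) using 1
  ext u
  simp only [GoodSeq, mem_ofPred_eq, mem_inter_iff, mem_iInter, mem_preimage]

section Transfer
variable {Ω : Type*} [MeasurableSpace Ω] {Pr : Measure Ω} {U : ℕ → Ω → ℝ}

theorem IsUniformSequence.measurable_seq (hU : IsUniformSequence Pr U) :
    Measurable fun ω n => U n ω := measurable_pi_iff.2 hU.measurable

theorem IsUniformSequence.map_seq [IsProbabilityMeasure Pr] (hU : IsUniformSequence Pr U) :
    Pr.map (fun ω n => U n ω) = seqLaw := by
  rw [hU.indep.map_fun_eq_infinitePi_map hU.measurable]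
  simp only [hU.map_eq]
  rfl

theorem IsUniformSequence.goodSeq (hU : IsUniformSequence Pr U) (ω : Ω) :
    GoodSeq fun n => U n ω := ⟨fun n => hU.mem_Ioo n ω, hU.prod_eq_zero ω⟩

/-- `seqLaw` is the law of `U`, and every sample of `U` is good; no separate proof is needed that
the product of the factors vanishes almost surely. -/
theorem IsUniformSequence.ae_goodSeq [IsProbabilityMeasure Pr] (hU : IsUniformSequence Pr U) :
    ∀ᵐ u ∂seqLaw, GoodSeq u := by
  rw [← hU.map_seq, ae_map_iff hU.measurable_seq.aemeasurable measurableSet_goodSeq]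
  exact Eventually.of_forall hU.goodSeq

end Transfer

theorem measurable_catSeq (n : ℕ) :
    Measurable fun p : (ℕ → ℝ) × (ℕ → ℝ) => catSeq n p.1 p.2 := by
  refine measurable_pi_iff.2 fun i => ?_
  unfold catSeq
  split_ifs <;> fun_prop

theorem measurable_rescaleSeq (c : ℝ) : Measurable (rescaleSeq c) := by
  refine measurable_pi_iff.2 fun i => ?_
  unfold rescaleSeq
  rcases eq_or_ne i 0 with rfl | hi
  · simp only [Function.update_self]; fun_prop
  · simp only [Function.update_of_ne hi]; fun_prop

/-- Independence in the form in which it is used: the entries from `n` on may be resampled.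
Integrating over the second sequence with the first one frozen replaces conditioning on the first
`n` entries. -/
theorem map_catSeq_seqLaw (n : ℕ) :
    (seqLaw.prod seqLaw).map (fun p => catSeq n p.1 p.2) = seqLaw := by
  refine Measure.eq_infinitePi _ fun s t ht => ?_
  rw [Measure.map_apply (measurable_catSeq n) (.pi s.countable_toSet fun i _ => ht i)]
  classical
  have hpre : (fun p : (ℕ → ℝ) × (ℕ → ℝ) => catSeq n p.1 p.2) ⁻¹' (s : Set ℕ).pi t
      = ((s.filter (· < n) : Finset ℕ) : Set ℕ).pi t ×ˢ
        (((s.filter fun i => ¬ i < n).image (· - n) : Finset ℕ) : Set ℕ).pi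
          (fun i => t (i + n)) := by
    ext ⟨u, v⟩
    simp only [mem_preimage, Set.mem_pi, Finset.mem_coe, mem_prod, Finset.mem_filter,
      Finset.mem_image, catSeq]
    constructor
    · refine fun h => ⟨fun i hi => by simpa [hi.2] using h i hi.1, ?_⟩
      rintro _ ⟨i, hi, rfl⟩
      have := h i hi.1
      rw [if_neg hi.2] at this
      rwa [Nat.sub_add_cancel (not_lt.1 hi.2)]
    · rintro ⟨h1, h2⟩ i hi
      split_ifs with hin
      · exact h1 i ⟨hi, hin⟩
      · have := h2 (i - n) ⟨i, ⟨hi, hin⟩, rfl⟩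
        rwa [Nat.sub_add_cancel (not_lt.1 hin)] at this
  rw [hpre, Measure.prod_prod, seqLaw, Measure.infinitePi_pi _ (fun i _ => ht i),
    Measure.infinitePi_pi _ (fun i _ => ht _), Finset.prod_image, ←
    Finset.prod_filter_mul_prod_filter_not s (· < n)]
  · congr 1
    refine Finset.prod_congr rfl fun i hi => ?_
    rw [Nat.sub_add_cancel (not_lt.1 (Finset.mem_filter.1 hi).2)]
  · intro i hi j hj hij
    have h1 := (Finset.mem_filter.1 hi).2
    have h2 := (Finset.mem_filter.1 hj).2
    simp only at hij
    omega

theorem unif_Iio_inter_div {c : ℝ} (hc : 0 < c) (hc1 : c ≤ 1) {T : Set ℝ} (hT : MeasurableSet T) :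
    unif (Iio c ∩ (fun y => y / c) ⁻¹' T) = ENNReal.ofReal c * unif T := by
  have hm : Measurable fun y : ℝ => y / c := by fun_prop
  rw [unif, Measure.restrict_apply (measurableSet_Iio.inter (hm hT)), Measure.restrict_apply hT]
  have : Iio c ∩ (fun y => y / c) ⁻¹' T ∩ Ioo 0 1 = (fun y => c⁻¹ * y) ⁻¹' (T ∩ Ioo 0 1) := by
    ext y
    simp only [mem_inter_iff, mem_Iio, mem_preimage, mem_Ioo, div_eq_inv_mul]
    have h1 : c⁻¹ * y < 1 ↔ y < c := by rw [inv_mul_lt_iff₀ hc, mul_one]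
    have h2 : 0 < c⁻¹ * y ↔ 0 < y := by simp [hc]
    rw [h1, h2]
    constructor
    · rintro ⟨⟨a, b⟩, d, e⟩; exact ⟨b, d, a⟩
    · rintro ⟨a, b, d⟩; exact ⟨⟨d, a⟩, b, d.trans_le hc1⟩
  rw [this, Real.volume_preimage_mul_left (by positivity)]
  simp [abs_of_pos hc]

/-- A uniform variable conditioned to lie below `c` and divided by `c` is uniform, and the other
entries are untouched; the factor `c` is the probability of the condition. -/
theorem map_rescaleSeq_seqLaw {c : ℝ} (hc : 0 < c) (hc1 : c ≤ 1) :
    (seqLaw.restrict {v | v 0 < c}).map (rescaleSeq c) = ENNReal.ofReal c • seqLaw := by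
  have hset : MeasurableSet {v : ℕ → ℝ | v 0 < c} :=
    measurableSet_lt (measurable_pi_apply 0) measurable_const
  have hc0 : ENNReal.ofReal c ≠ 0 := by simpa using hc
  have key : (ENNReal.ofReal c)⁻¹ • (seqLaw.restrict {v | v 0 < c}).map (rescaleSeq c)
      = seqLaw := by
    refine Measure.eq_infinitePi _ fun s t ht => ?_
    classical
    rw [Measure.smul_apply, Measure.map_apply (measurable_rescaleSeq c)
      (.pi s.countable_toSet fun i _ => ht i), Measure.restrict_apply
      (measurable_rescaleSeq c (.pi s.countable_toSet fun i _ => ht i))]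
    -- The restriction constrains entry `0` even if the box does not, so `0` is added to the index
    -- set, with `univ` as the box side in that case.
    have hpre : rescaleSeq c ⁻¹' (s : Set ℕ).pi t ∩ {v | v 0 < c}
        = ((insert 0 s : Finset ℕ) : Set ℕ).pi (fun i => if i = 0 then
            Iio c ∩ (fun y => y / c) ⁻¹' (if 0 ∈ s then t 0 else univ) else t i) := by
      ext v
      simp only [mem_inter_iff, mem_preimage, Set.mem_pi, Finset.mem_coe, rescaleSeq,
        Finset.mem_insert, mem_ofPred_eq]
      constructor
      · rintro ⟨h, h0⟩ i hi
        rcases eq_or_ne i 0 with rfl | hi0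
        · rw [if_pos rfl]
          refine ⟨h0, ?_⟩
          by_cases hs : 0 ∈ s
          · rw [if_pos hs]; simpa using h 0 hs
          · rw [if_neg hs]; trivial
        · simpa [hi0] using h i (hi.resolve_left hi0)
      · intro h
        have h0 := h 0 (Or.inl rfl)
        rw [if_pos rfl] at h0
        refine ⟨fun i hi => ?_, h0.1⟩
        rcases eq_or_ne i 0 with rfl | hi0
        · have := h0.2
          rw [if_pos hi] at this
          simpa using this
        · simpa [hi0] using h i (Or.inr hi)
    rw [hpre, seqLaw, Measure.infinitePi_pi]
    · have hprod : ∏ i ∈ s, unif (t i) = unif (if 0 ∈ s then t 0 else univ) *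
          ∏ i ∈ s.erase 0, unif (t i) := by
        split_ifs with hs
        · rw [Finset.mul_prod_erase s (fun i => unif (t i)) hs]
        · rw [measure_univ, one_mul, Finset.erase_eq_of_notMem hs]
      have hT : MeasurableSet (if 0 ∈ s then t 0 else univ) := by
        split_ifs
        exacts [ht 0, .univ]
      rw [show insert 0 s = insert 0 (s.erase 0) by grind,
        Finset.prod_insert (by simp), if_pos rfl, unif_Iio_inter_div hc hc1 hT, hprod, smul_eq_mul,
        ← mul_assoc, ← mul_assoc, ENNReal.inv_mul_cancel hc0 ENNReal.ofReal_ne_top, one_mul]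
      congr 1
      refine Finset.prod_congr rfl fun i hi => ?_
      rw [if_neg (Finset.ne_of_mem_erase hi)]
    · intro i _
      split_ifs
      · exact measurableSet_Iio.inter ((by fun_prop : Measurable fun y : ℝ => y / c) (ht 0))
      · exact measurableSet_Iio.inter ((by fun_prop : Measurable fun y : ℝ => y / c) .univ)
      · exact ht i
  conv_rhs => rw [← key]
  rw [smul_smul, ENNReal.mul_inv_cancel hc0 ENNReal.ofReal_ne_top, one_smul]

theorem seqLaw_lt {c : ℝ} (hc : 0 < c) (hc1 : c ≤ 1) :
    seqLaw {v | v 0 < c} = ENNReal.ofReal c := by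
  have := congrArg (fun m => m univ) (map_rescaleSeq_seqLaw hc hc1)
  simpa [Measure.map_apply (measurable_rescaleSeq c) .univ] using this

theorem setIntegral_rescaleSeq {c : ℝ} (hc : 0 < c) (hc1 : c ≤ 1) {G : (ℕ → ℝ) → ℝ}
    (hG : Measurable G) :
    ∫ v in {v | v 0 < c}, G (rescaleSeq c v) ∂seqLaw = c * ∫ v, G v ∂seqLaw := by
  rw [← integral_map (f := G) (measurable_rescaleSeq c).aemeasurable hG.aestronglyMeasurable,
    map_rescaleSeq_seqLaw hc hc1, integral_smul_measure, ENNReal.toReal_ofReal hc.le, smul_eq_mul]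

theorem integral_catSeq (n : ℕ) {G : (ℕ → ℝ) → ℝ} (hG : Integrable G seqLaw) :
    ∫ u, G u ∂seqLaw = ∫ u, ∫ v, G (catSeq n u v) ∂seqLaw ∂seqLaw := by
  conv_lhs => rw [← map_catSeq_seqLaw n]
  rw [← map_catSeq_seqLaw n] at hG
  rw [integral_map (measurable_catSeq n).aemeasurable hG.aestronglyMeasurable,
    integral_prod (fun p : (ℕ → ℝ) × (ℕ → ℝ) => G (catSeq n p.1 p.2))
      (hG.comp_measurable (measurable_catSeq n))]

theorem lintegral_catSeq (n : ℕ) {G : (ℕ → ℝ) → ℝ≥0∞} (hG : Measurable G) :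
    ∫⁻ u, G u ∂seqLaw = ∫⁻ u, ∫⁻ v, G (catSeq n u v) ∂seqLaw ∂seqLaw := by
  conv_lhs => rw [← map_catSeq_seqLaw n]
  rw [lintegral_map hG (measurable_catSeq n),
    lintegral_prod (fun p : (ℕ → ℝ) × (ℕ → ℝ) => G (catSeq n p.1 p.2))
      (hG.comp (measurable_catSeq n)).aemeasurable]

/-! ### Transition operators and kernels -/

/-- The transition operator, realized on the space of driving sequences. -/
def cellOp (R : ℝ → ℝ) (t : ℝ≥0) (f : ℝ≥0 → ℝ) (x : ℝ≥0) : ℝ :=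
  ∫ u, f (cellProcess R x u t) ∂seqLaw

/-- The transition kernel at time `t`. -/
def cellKernel (hR : IsRate R) (t : ℝ≥0) : Kernel ℝ≥0 ℝ≥0 where
  toFun x := seqLaw.map fun u => cellProcess R x u t
  measurable' := by
    refine Measure.measurable_of_measurable_coe _ fun A hA => ?_
    simp_rw [Measure.map_apply (hR.measurable_cellProcess _ t) hA]
    exact measurable_measure_prodMk_left (hR.measurable_cellProcess_prod t hA)

theorem cellKernel_apply (hR : IsRate R) (t x : ℝ≥0) :
    cellKernel hR t x = seqLaw.map fun u => cellProcess R x u t := rfl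

instance (hR : IsRate R) (t : ℝ≥0) : IsMarkovKernel (cellKernel hR t) :=
  ⟨fun x => Measure.isProbabilityMeasure_map (hR.measurable_cellProcess x t).aemeasurable⟩

theorem integral_cellKernel (hR : IsRate R) (t x : ℝ≥0) {f : ℝ≥0 → ℝ} (hf : Measurable f) :
    ∫ y, f y ∂cellKernel hR t x = cellOp R t f x := by
  rw [cellKernel_apply, integral_map (hR.measurable_cellProcess x t).aemeasurable
    hf.aestronglyMeasurable, cellOp]

theorem IsUniformSequence.transitionOp_eq {Ω : Type*} [MeasurableSpace Ω] {Pr : Measure Ω}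
    [IsProbabilityMeasure Pr] {U : ℕ → Ω → ℝ} (hU : IsUniformSequence Pr U) (hR : IsRate R)
    (t : ℝ≥0) {f : ℝ≥0 → ℝ} (hf : Measurable f) :
    transitionOp Pr U R t f = cellOp R t f := by
  ext x
  rw [transitionOp, cellOp, ← hU.map_seq, integral_map
    (f := fun u => f (cellProcess R x u t)) hU.measurable_seq.aemeasurable
    (hf.comp (hR.measurable_cellProcess x t)).aestronglyMeasurable]

theorem IsRate.integrable_comp_cellProcess (hR : IsRate R) (x t : ℝ≥0) {f : ℝ≥0 → ℝ}
    (hf : IsBoundedBorel f) : Integrable (fun u => f (cellProcess R x u t)) seqLaw := by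
  obtain ⟨hm, C, hC⟩ := hf
  exact Integrable.of_bound (hm.comp (hR.measurable_cellProcess x t)).aestronglyMeasurable C
    (Eventually.of_forall fun u => hC _)

theorem abs_cellOp_le (t : ℝ≥0) {f : ℝ≥0 → ℝ} {C : ℝ} (hC : ∀ x, |f x| ≤ C) (x : ℝ≥0) :
    |cellOp R t f x| ≤ C := by
  have := norm_integral_le_of_norm_le_const (μ := seqLaw)
    (f := fun u => f (cellProcess R x u t)) (Eventually.of_forall fun u => hC _)
  simpa [cellOp] using this

theorem IsRate.measurable_cellOp_uncurry (hR : IsRate R) {f : ℝ≥0 → ℝ} (hf : Measurable f) :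
    Measurable fun p : ℝ≥0 × ℝ≥0 => cellOp R p.1 f p.2 := by
  have h : StronglyMeasurable fun q : (ℝ≥0 × ℝ≥0) × (ℕ → ℝ) =>
      f (cellProcess R q.1.2 q.2 q.1.1) :=
    (hf.comp (hR.measurable_cellProcess_uncurry.comp
      (f := fun q : (ℝ≥0 × ℝ≥0) × (ℕ → ℝ) => (q.1.2, q.2, q.1.1))
      (by fun_prop))).stronglyMeasurable
  exact h.integral_prod_right.measurable

theorem IsRate.isBoundedBorel_cellOp (hR : IsRate R) (t : ℝ≥0) {f : ℝ≥0 → ℝ}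
    (hf : IsBoundedBorel f) : IsBoundedBorel (cellOp R t f) :=
  ⟨(hR.measurable_cellOp_uncurry hf.1).comp (f := fun x : ℝ≥0 => (t, x)) (by fun_prop),
    hf.2.imp fun _ hC => abs_cellOp_le t hC⟩

@[simp] theorem cellOp_apply_zero (t : ℝ≥0) (f : ℝ≥0 → ℝ) : cellOp R t f 0 = f 0 := by
  simp [cellOp]

theorem IsRate.cellOp_zero (hR : IsRate R) (hg : ∀ᵐ u ∂seqLaw, GoodSeq u) (f : ℝ≥0 → ℝ) :
    cellOp R 0 f = f := by
  ext x
  have : (fun u => f (cellProcess R x u 0)) =ᵐ[seqLaw] fun _ => f x := by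
    filter_upwards [hg] with u hu
    rw [hR.cellProcess_zero x (hu.1 0).2]
  rw [cellOp, integral_congr_ae this]; simp

/-! ### The Markov property at fixed times -/

/-- Up to a time between the `k`-th and the next jump, the path is determined by the first `2k`
entries of the driving sequence. -/
theorem cellProcess_congr {x s : ℝ≥0} {u v : ℕ → ℝ} {k : ℕ} (h : ∀ i < 2 * k, u i = v i)
    (hu : (s : ℝ≥0∞) < jumpTime R x u (k + 1)) (hv : (s : ℝ≥0∞) < jumpTime R x v (k + 1))
    {r : ℝ≥0} (hr : r ≤ s) : cellProcess R x u r = cellProcess R x v r := by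
  have hr' : (r : ℝ≥0∞) ≤ s := by exact_mod_cast hr
  rcases exists_jumpTime_le_lt_or R x u r with ⟨j, h1, h2⟩ | h0
  · have hjk : j ≤ k := by
      by_contra! hlt
      exact absurd ((hr'.trans_lt hu).trans_le (jumpTime_mono R x u (Nat.succ_le_of_lt hlt)))
        (not_lt.2 h1)
    have hj := jumpTime_congr (R := R) (x := x) h j (by omega)
    rw [cellProcess_eq h1 h2, hj.2]
    refine (cellProcess_eq (hj.1 ▸ h1) ?_).symm
    rcases hjk.lt_or_eq with hlt | rfl
    · rwa [← (jumpTime_congr (R := R) (x := x) h (j + 1) (by omega)).1]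
    · exact hr'.trans_lt hv
  · exact absurd ((h0 (k + 1)).trans hr') (not_le.2 hu)

theorem IsRate.survivor_mem_Ioc (hR : IsRate R) (z r : ℝ≥0) : survivor R z r ∈ Ioc (0 : ℝ) 1 :=
  ⟨survivor_pos _ _ _, hR.survivor_le_one z.2 r.2⟩

/-- The Markov property at a fixed time `s`. The event is determined by the path up to `s`. -/
theorem IsRate.markov (hR : IsRate R) (x s t : ℝ≥0) {f : ℝ≥0 → ℝ} (hf : IsBoundedBorel f)
    {B : Set (ℝ≥0 → ℝ≥0)} (hB : MeasurableSet B)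
    (hBs : ∀ w w' : ℝ≥0 → ℝ≥0, (∀ r ≤ s, w r = w' r) → w ∈ B → w' ∈ B) :
    ∫ u in {u | cellProcess R x u ∈ B}, f (cellProcess R x u (s + t)) ∂seqLaw
      = ∫ u in {u | cellProcess R x u ∈ B}, cellOp R t f (cellProcess R x u s) ∂seqLaw := by
  have hBm : MeasurableSet {u | cellProcess R x u ∈ B} := hR.measurable_path x hB
  have hPf := hR.isBoundedBorel_cellOp t hf
  have hI1 := hR.integrable_comp_cellProcess x (s + t) hf
  have hI2 := hR.integrable_comp_cellProcess x s hPf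
  have hJ : ∀ k, Measurable fun u => jumpTime R x u k := fun k =>
    (hR.measurable_jumpTime k).comp (f := fun u : ℕ → ℝ => (x, u)) (by fun_prop)
  -- The integral of the difference of the two sides is shown to vanish separately for each number
  -- of jumps up to time `s`.
  set D : (ℕ → ℝ) → ℝ := fun u =>
    f (cellProcess R x u (s + t)) - cellOp R t f (cellProcess R x u s) with hD
  have hDI : Integrable D seqLaw := hI1.sub hI2
  rw [← sub_eq_zero, ← integral_sub hI1.integrableOn hI2.integrableOn]
  change ∫ u in {u | cellProcess R x u ∈ B}, D u ∂seqLaw = 0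
  set A : ℕ → Set (ℕ → ℝ) := fun k => {u | cellProcess R x u ∈ B} ∩
    ({u | jumpTime R x u k ≤ s} ∩ {u | (s : ℝ≥0∞) < jumpTime R x u (k + 1)}) with hA
  have hAm : ∀ k, MeasurableSet (A k) := fun k => hBm.inter
    ((measurableSet_le (hJ k) measurable_const).inter (measurableSet_lt measurable_const (hJ _)))
  rw [setIntegral_eq_of_subset_of_forall_sdiff_eq_zero hBm (s := ⋃ k, A k)
    (iUnion_subset fun k => inter_subset_left), integral_iUnion hAm _ hDI.integrableOn]
  · refine (tsum_congr fun k => ?_).trans tsum_zero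
    -- The entries from `2k` on are resampled as `v`; with `u` frozen, the first `k` jumps are fixed
    -- and already the inner integral vanishes.
    rw [← integral_indicator (hAm k), integral_catSeq (2 * k) (hDI.indicator (hAm k))]
    refine integral_eq_zero_of_ae (Eventually.of_forall fun u => ?_)
    simp only [Pi.zero_apply]
    by_cases hk : jumpTime R x u k ≤ s
    · obtain ⟨a, ha⟩ : ∃ a : ℝ≥0, jumpTime R x u k = a :=
        ⟨_, (ENNReal.coe_toNNReal (ne_top_of_le_ne_top ENNReal.coe_ne_top hk)).symm⟩
      obtain ⟨r, rfl⟩ : ∃ r, s = a + r := by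
        rw [ha] at hk
        exact exists_add_of_le (by exact_mod_cast hk)
      obtain ⟨hc, hc1⟩ := hR.survivor_mem_Ioc (posAfter R x u k) r
      have hac : ∀ v, jumpTime R x (catSeq (2 * k) u v) k = a := fun v => by
        rw [(jumpTime_catSeq x u v k).1, ha]
      have hlt : ∀ v, ((a + r : ℝ≥0) : ℝ≥0∞) < jumpTime R x (catSeq (2 * k) u v) (k + 1) ↔
          v 0 < survivor R (posAfter R x u k) r := fun v => by
        rw [hR.lt_jumpTime_succ_iff (hac v), posAfter_catSeq]
        simp [catSeq]
      -- As long as the next jump comes after `s`, the path up to `s` does not depend on `v`. Hence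
      -- membership in `B` holds for all such `v` or for none.
      by_cases hb : ∃ v, v 0 < survivor R (posAfter R x u k) r ∧
          cellProcess R x (catSeq (2 * k) u v) ∈ B
      · obtain ⟨v₀, hv₀, hv₀B⟩ := hb
        set c := survivor R (posAfter R x u k) r
        set y := posAfter R x u k * (Real.exp r).toNNReal
        have hmem : ∀ v, catSeq (2 * k) u v ∈ A k ↔ v 0 < c := fun v => by
          refine ⟨fun h => (hlt v).1 h.2.2, fun h => ⟨?_, ?_, (hlt v).2 h⟩⟩
          · exact hBs _ _ (fun r' hr' => cellProcess_congr
              (fun i hi => by simp [catSeq, hi]) ((hlt v₀).2 hv₀) ((hlt v).2 h) hr') hv₀B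
          · simp only [mem_ofPred_eq, hac]; exact_mod_cast le_self_add
        -- On `v 0 < c` the position at time `s` is the constant `y`, and the future is driven by
        -- the rescaled sequence; the integrals of both terms are `c * cellOp R t f y`.
        have hint : (fun v => (A k).indicator D (catSeq (2 * k) u v)) =
            {v : ℕ → ℝ | v 0 < c}.indicator fun v =>
              f (cellProcess R y (rescaleSeq c v) t) - cellOp R t f y := by
          ext v
          by_cases hv : v 0 < c
          · have hv' : catSeq (2 * k) u v (2 * k)
                < survivor R (posAfter R x (catSeq (2 * k) u v) k) r := by
              rw [posAfter_catSeq]; simpa [catSeq] using hv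
            rw [indicator_of_mem ((hmem v).2 hv), indicator_of_mem (by exact hv), hD]
            simp only
            rw [hR.cellProcess_add (hac v) hv', hR.cellProcess_of_lt (hac v) hv', posAfter_catSeq,
              shiftSeq_catSeq]
          · rw [indicator_of_notMem (mt (hmem v).1 hv), indicator_of_notMem (by exact hv)]
        have hset : MeasurableSet {v : ℕ → ℝ | v 0 < c} :=
          measurableSet_lt (measurable_pi_apply 0) measurable_const
        have hm : Measurable fun v => f (cellProcess R y v t) :=
          hf.1.comp (hR.measurable_cellProcess y t)
        rw [hint, integral_indicator hset, integral_sub, setIntegral_rescaleSeq hc hc1 hm,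
          setIntegral_const, measureReal_def, seqLaw_lt hc hc1, ENNReal.toReal_ofReal hc.le,
          smul_eq_mul, cellOp, sub_self]
        · obtain ⟨C, hC⟩ := hf.2
          exact Integrable.of_bound (hm.comp (measurable_rescaleSeq c)).aestronglyMeasurable C
            (Eventually.of_forall fun u => hC _)
        · exact integrable_const _
      · push Not at hb
        refine integral_eq_zero_of_ae (Eventually.of_forall fun v => ?_)
        exact indicator_of_notMem (fun h => hb v ((hlt v).1 h.2.2) h.1) _
    · refine integral_eq_zero_of_ae (Eventually.of_forall fun v => ?_)
      refine indicator_of_notMem (fun h => hk ?_) _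
      have := h.2.1
      rwa [mem_ofPred_eq, (jumpTime_catSeq x u v k).1] at this
  · have : ∀ i j, i < j → Disjoint (A i) (A j) := fun i j hij => by
      refine Set.disjoint_left.2 fun u hi hj => ?_
      exact absurd (hi.2.2.trans_le (jumpTime_mono R x u (Nat.succ_le_of_lt hij)))
        (not_lt.2 hj.2.1)
    intro i j hij
    rcases hij.lt_or_gt with h | h
    exacts [this i j h, (this j i h).symm]
  · rintro u ⟨hu, hn⟩
    rcases exists_jumpTime_le_lt_or R x u s with ⟨k, h1, h2⟩ | h0
    · exact (hn (mem_iUnion.2 ⟨k, hu, h1, h2⟩)).elim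
    -- The remaining paths have made all their jumps by time `s`. They sit at the absorbing point
    -- `0`, where the difference is zero.
    · have h0' : ∀ k, jumpTime R x u k ≤ ((s + t : ℝ≥0) : ℝ≥0∞) := fun k =>
        (h0 k).trans (by exact_mod_cast le_self_add)
      simp only [hD, cellProcess_eq_zero h0, cellProcess_eq_zero h0', cellOp_apply_zero, sub_self]

theorem IsRate.cellOp_add (hR : IsRate R) (s t : ℝ≥0) {f : ℝ≥0 → ℝ} (hf : IsBoundedBorel f) :
    cellOp R (s + t) f = cellOp R s (cellOp R t f) := by
  ext x
  simpa [cellOp] using hR.markov x s t hf (B := univ) .univ (fun _ _ _ h => h)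

/-! ### Continuity of the semigroup in time and in space -/

theorem ae_of_ae_catSeq (n : ℕ) {p : (ℕ → ℝ) → Prop} (hp : MeasurableSet {u | p u})
    (h : ∀ u, ∀ᵐ v ∂seqLaw, p (catSeq n u v)) : ∀ᵐ u ∂seqLaw, p u := by
  rw [← map_catSeq_seqLaw n, ae_map_iff (measurable_catSeq n).aemeasurable hp]
  exact (Measure.ae_prod_iff_ae_ae (measurable_catSeq n hp)).2 (Eventually.of_forall h)

theorem map_eval_seqLaw (n : ℕ) : seqLaw.map (fun u => u n) = unif :=
  Measure.infinitePi_map_eval _ n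

theorem ae_seqLaw_eval_ne (n : ℕ) (c : ℝ) : ∀ᵐ u ∂seqLaw, u n ≠ c := by
  have h : ∀ᵐ y ∂unif, y ≠ c := ae_restrict_of_ae (Measure.ae_ne volume c)
  rw [← map_eval_seqLaw n] at h
  exact ae_of_ae_map (measurable_pi_apply n).aemeasurable h

/-- The jump times have no atoms. -/
theorem IsRate.ae_jumpTime_ne (hR : IsRate R) (hg : ∀ᵐ u ∂seqLaw, GoodSeq u) (x : ℝ≥0)
    {t : ℝ≥0} (ht : 0 < t) (k : ℕ) : ∀ᵐ u ∂seqLaw, jumpTime R x u k ≠ t := by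
  have hJ : ∀ k, Measurable fun u => jumpTime R x u k := fun k =>
    (hR.measurable_jumpTime k).comp (f := fun u : ℕ → ℝ => (x, u)) (by fun_prop)
  cases k with
  | zero =>
    refine Eventually.of_forall fun u => ?_
    rw [jumpTime_zero]
    exact_mod_cast ht.ne
  | succ k =>
    refine ae_of_ae_catSeq (2 * k) (hJ (k + 1) (measurableSet_singleton _).compl) fun u => ?_
    by_cases hk : jumpTime R x u k ≤ t
    · obtain ⟨a, ha⟩ : ∃ a : ℝ≥0, jumpTime R x u k = a :=
        ⟨_, (ENNReal.coe_toNNReal (ne_top_of_le_ne_top ENNReal.coe_ne_top hk)).symm⟩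
      obtain ⟨r, rfl⟩ : ∃ r, t = a + r := by
        rw [ha] at hk
        exact exists_add_of_le (by exact_mod_cast hk)
      -- Given the first `k` jumps, a jump exactly at `t` forces the next entry to equal one
      -- prescribed value of `survivor`, a null event.
      filter_upwards [hg, ae_seqLaw_eval_ne 0 (survivor R (posAfter R x u k) r)] with v hv hne h
      rw [jumpTime_succ, (jumpTime_catSeq x u v k).1, ha, posAfter_catSeq, ENNReal.coe_add,
        ENNReal.add_right_inj ENNReal.coe_ne_top] at h
      have h1 : catSeq (2 * k) u v (2 * k) = v 0 := by simp [catSeq]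
      rw [h1] at h
      exact hne (hR.survivor_eq_of_survivorInv_eq (NNReal.coe_nonneg _) (hv.1 0).2 h).symm
    · refine Eventually.of_forall fun v h => hk ?_
      rw [← (jumpTime_catSeq x u v k).1, ← h]
      exact jumpTime_mono _ _ _ (Nat.le_succ k)

/-- Almost surely `t` is not a jump time, so almost every path is continuous at `t`; the rest is
dominated convergence. -/
theorem IsRate.continuousAt_cellOp_time (hR : IsRate R) (hg : ∀ᵐ u ∂seqLaw, GoodSeq u)
    {f : ℝ≥0 → ℝ} (hf : Continuous f) {C : ℝ} (hC : ∀ x, |f x| ≤ C) (x : ℝ≥0) {t : ℝ≥0}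
    (ht : 0 < t) : ContinuousAt (fun s => cellOp R s f x) t := by
  refine continuousAt_of_dominated (bound := fun _ => C)
    (Eventually.of_forall fun s =>
      (hf.measurable.comp (hR.measurable_cellProcess x s)).aestronglyMeasurable)
    (Eventually.of_forall fun s => Eventually.of_forall fun u => hC _) (integrable_const C) ?_
  filter_upwards [hg, ae_all_iff.2 fun k => hR.ae_jumpTime_ne hg x ht k] with u hu hne
  exact hf.continuousAt.comp (f := fun s => cellProcess R x u s)
    (continuousAt_cellProcess hu.1 hu.2 ht hne)

/-- Before the first jump the process follows the deterministic flow. -/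
theorem IsRate.abs_cellOp_sub_le (hR : IsRate R) {f : ℝ≥0 → ℝ} (hf : IsBoundedBorel f) {C : ℝ}
    (hC : ∀ x, |f x| ≤ C) (x r : ℝ≥0) :
    |cellOp R r f x - f (x * (Real.exp r).toNNReal)| ≤ 2 * C * (1 - survivor R x r) := by
  obtain ⟨hc, hc1⟩ := hR.survivor_mem_Ioc x r
  set S : Set (ℕ → ℝ) := {v | v 0 < survivor R x r} with hS
  have hSm : MeasurableSet S := measurableSet_lt (measurable_pi_apply 0) measurable_const
  have hI : Integrable (fun u => f (cellProcess R x u r) - f (x * (Real.exp r).toNNReal)) seqLaw :=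
    (hR.integrable_comp_cellProcess x r hf).sub (integrable_const _)
  have h1 : cellOp R r f x - f (x * (Real.exp r).toNNReal)
      = ∫ u in Sᶜ, (f (cellProcess R x u r) - f (x * (Real.exp r).toNNReal)) ∂seqLaw := by
    rw [cellOp, ← sub_zero (∫ u in Sᶜ, _ ∂_), ← integral_add_compl hSm
      (hR.integrable_comp_cellProcess x r hf), integral_sub
      (hR.integrable_comp_cellProcess x r hf).integrableOn (integrable_const _).integrableOn,
      setIntegral_congr_fun hSm (g := fun _ => f (x * (Real.exp r).toNNReal))]
    · rw [setIntegral_const, setIntegral_const, probReal_compl_eq_one_sub hSm]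
      simp only [smul_eq_mul]; ring
    · intro u hu
      have h0 : jumpTime R x u 0 = (0 : ℝ≥0) := by simp
      have hp : posAfter R x u 0 = x := by simp [posAfter]
      have := hR.cellProcess_of_lt (r := r) h0 (by rw [hp]; exact hu)
      simp only
      rw [zero_add, hp] at this
      rw [this]
  rw [h1]
  have h2 := norm_setIntegral_le_of_norm_le_const (μ := seqLaw) (s := Sᶜ)
    (f := fun u => f (cellProcess R x u r) - f (x * (Real.exp r).toNNReal)) (C := 2 * C)
    (measure_lt_top _ _) (fun u _ => by
      rw [Real.norm_eq_abs]
      have := abs_sub (f (cellProcess R x u r)) (f (x * (Real.exp r).toNNReal))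
      linarith [hC (cellProcess R x u r), hC (x * (Real.exp r).toNNReal)])
  rwa [probReal_compl_eq_one_sub hSm, measureReal_def, seqLaw_lt hc hc1,
    ENNReal.toReal_ofReal hc.le] at h2

/-- By the semigroup property this is `abs_cellOp_sub_le` for the bounded function `cellOp R t f`,
of which no continuity is required. The absolute value makes the bound symmetric in `x` and `y`, so
that it serves for displacements in both directions. -/
theorem IsRate.abs_cellOp_flow_le (hR : IsRate R) {f : ℝ≥0 → ℝ} (hf : IsBoundedBorel f) {C : ℝ}
    (hC : ∀ x, |f x| ≤ C) (t : ℝ≥0) {x y : ℝ≥0} {r : ℝ≥0} (hx : 0 < x)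
    (hy : y = x * (Real.exp r).toNNReal) :
    |cellOp R (r + t) f x - cellOp R t f y|
      ≤ 2 * C * (1 - Real.exp (-|cumRate R y - cumRate R x|)) := by
  subst hy
  have hx' : (0 : ℝ) < x := hx
  have h := hR.abs_cellOp_sub_le (hR.isBoundedBorel_cellOp t hf) (abs_cellOp_le t hC) x r
  rw [hR.cellOp_add r t hf]
  rw [hR.survivor_eq hx'] at h
  have hm := hR.cumRate_mono hx' (b := x * Real.exp r)
    (le_mul_of_one_le_right hx'.le (Real.one_le_exp r.2))
  rw [NNReal.coe_mul, Real.coe_toNNReal _ (Real.exp_pos _).le, abs_of_nonneg (sub_nonneg.2 hm),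
    neg_sub]
  exact h

/-- The transition operators preserve bounded continuous functions. -/
theorem IsRate.continuous_cellOp (hR : IsRate R) (hg : ∀ᵐ u ∂seqLaw, GoodSeq u)
    {f : ℝ≥0 → ℝ} (hf : Continuous f) {C : ℝ} (hC : ∀ x, |f x| ≤ C) (t : ℝ≥0) :
    Continuous (cellOp R t f) := by
  rcases eq_or_lt_of_le (zero_le (a := t)) with rfl | ht
  · rwa [hR.cellOp_zero hg]
  rw [continuous_iff_continuousAt]
  intro x
  -- At the absorbing point the flow moves nothing; there the bound by `y * exp t` gives continuity
  -- directly.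
  rcases eq_or_lt_of_le (zero_le (a := x)) with rfl | hx
  · refine tendsto_integral_filter_of_dominated_convergence (fun _ => C)
      (Eventually.of_forall fun y =>
        (hf.measurable.comp (hR.measurable_cellProcess y t)).aestronglyMeasurable)
      (Eventually.of_forall fun y => Eventually.of_forall fun u => hC _) (integrable_const C) ?_
    filter_upwards [hg] with u hu
    rw [cellProcess_zero_left]
    refine (hf.tendsto 0).comp ?_
    rw [← NNReal.tendsto_coe, NNReal.coe_zero]
    refine tendsto_of_tendsto_of_tendsto_of_le_of_le tendsto_const_nhds (h := fun y : ℝ≥0 =>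
      (y : ℝ) * Real.exp t) ?_ (fun y => NNReal.coe_nonneg _) fun y => cellProcess_le_exp hu.1 y t
    have : Continuous fun y : ℝ≥0 => (y : ℝ) * Real.exp t := by fun_prop
    simpa using this.tendsto 0
  have hfb : IsBoundedBorel f := ⟨hf.measurable, C, hC⟩
  have hx' : (0 : ℝ) < x := hx
  -- Starting at `y` with time `t` to go compares with starting at `x` with time `ρ y` to go: the
  -- smaller of the two points reaches the other along the flow, in time `|log (y / x)|`. Continuity
  -- in space is thus reduced to continuity in time at `x`.
  set ρ : ℝ≥0 → ℝ := fun y => t + Real.log (y / x) with hρ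
  have hρc : ContinuousAt ρ x := by
    have h1 : ContinuousAt (fun y : ℝ≥0 => (y : ℝ) / x) x := by fun_prop
    exact continuousAt_const.add (h1.log (by simp [hx'.ne']))
  have hρx : ρ x = t := by simp [hρ, hx'.ne']
  have hlim : Tendsto (fun y => cellOp R (ρ y).toNNReal f x) (𝓝 x) (𝓝 (cellOp R t f x)) := by
    have h2 : ContinuousAt (fun y => (ρ y).toNNReal) x := 
      continuous_real_toNNReal.continuousAt.comp (f := ρ) hρc
    have h3 : ContinuousAt (fun s => cellOp R s f x) (ρ x).toNNReal := by
      rw [hρx, Real.toNNReal_coe]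
      exact hR.continuousAt_cellOp_time hg hf hC x ht
    have := ContinuousAt.comp (g := fun s => cellOp R s f x)
      (f := fun y => (ρ y).toNNReal) h3 h2
    simpa [ContinuousAt, hρx, Function.comp_def] using this
  have hev : ∀ᶠ y in 𝓝 x, |cellOp R t f y - cellOp R (ρ y).toNNReal f x|
      ≤ 2 * C * (1 - Real.exp (-|cumRate R y - cumRate R x|)) := by
    have h4 : ∀ᶠ y in 𝓝 x, 0 < ρ y := by
      have : (0 : ℝ) < ρ x := by rw [hρx]; exact ht
      exact hρc.eventually (lt_mem_nhds this)
    filter_upwards [h4, lt_mem_nhds hx] with y hy hy0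
    have hy0' : (0 : ℝ) < y := hy0
    rcases le_total x y with hxy | hyx
    · have hl : 0 ≤ Real.log ((y : ℝ) / x) := Real.log_nonneg ((one_le_div hx').2 hxy)
      have := hR.abs_cellOp_flow_le hfb hC t (x := x) (y := y) (r := (Real.log ((y : ℝ) / x)).toNNReal)
        hx (by
          ext
          rw [NNReal.coe_mul, Real.coe_toNNReal _ hl, Real.exp_log (by positivity),
            Real.coe_toNNReal _ (by positivity)]
          field_simp)
      rw [abs_sub_comm]
      convert! this using 4
      ext
      rw [NNReal.coe_add, Real.coe_toNNReal _ hl, Real.coe_toNNReal _ hy.le, add_comm]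
    · have hl : 0 ≤ Real.log ((x : ℝ) / y) := Real.log_nonneg ((one_le_div hy0').2 hyx)
      have := hR.abs_cellOp_flow_le hfb hC (ρ y).toNNReal (x := y) (y := x)
        (r := (Real.log ((x : ℝ) / y)).toNNReal) hy0 (by
          ext
          rw [NNReal.coe_mul, Real.coe_toNNReal _ hl, Real.exp_log (by positivity),
            Real.coe_toNNReal _ (by positivity)]
          field_simp)
      rw [abs_sub_comm (cumRate R y)]
      convert! this using 4
      ext
      rw [NNReal.coe_add, Real.coe_toNNReal _ hl, Real.coe_toNNReal _ hy.le, hρ,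
        Real.log_div hx'.ne' hy0'.ne']
      simp only
      rw [Real.log_div hy0'.ne' hx'.ne']
      ring
  have hzero : Tendsto (fun y : ℝ≥0 => 2 * C * (1 - Real.exp (-|cumRate R y - cumRate R x|)))
      (𝓝 x) (𝓝 0) := by
    have h5 : ContinuousAt (fun y : ℝ≥0 => cumRate R y) x :=
      (hR.continuousAt_cumRate hx').comp (f := fun y : ℝ≥0 => (y : ℝ))
        NNReal.continuous_coe.continuousAt
    have h6 : ContinuousAt (fun y : ℝ≥0 => 2 * C * (1 - Real.exp (-|cumRate R y - cumRate R x|)))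
        x := by fun_prop
    simpa [ContinuousAt] using h6
  have hdiff : Tendsto (fun y => cellOp R t f y - cellOp R (ρ y).toNNReal f x) (𝓝 x) (𝓝 0) :=
    squeeze_zero_norm' hev hzero
  have := hdiff.add hlim
  simpa [ContinuousAt] using this

/-! ### Grid approximation of random times -/

/-- The first multiple of `1 / (n + 1)` after the time `T`. -/
def gridAfter (n : ℕ) (T : ℝ≥0) : ℝ≥0 := (⌊(n + 1 : ℝ≥0) * T⌋₊ + 1) / (n + 1)

theorem lt_gridAfter (n : ℕ) (T : ℝ≥0) : T < gridAfter n T := by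
  rw [gridAfter, lt_div_iff₀ (by positivity), mul_comm]
  exact Nat.lt_floor_add_one _

theorem gridAfter_le (n : ℕ) (T : ℝ≥0) : gridAfter n T ≤ T + 1 / (n + 1) := by
  have h : (T + 1 / (n + 1)) * ((n : ℝ≥0) + 1) = (n + 1) * T + 1 := by field_simp
  rw [gridAfter, div_le_iff₀ (by positivity), h]
  gcongr
  exact Nat.floor_le zero_le

theorem tendsto_gridAfter (T : ℝ≥0) : Tendsto (fun n => gridAfter n T) atTop (𝓝[≥] T) := by
  refine tendsto_nhdsWithin_iff.2 ⟨?_, Eventually.of_forall fun n => (lt_gridAfter n T).le⟩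
  refine tendsto_of_tendsto_of_tendsto_of_le_of_le tendsto_const_nhds ?_
    (fun n => (lt_gridAfter n T).le) (fun n => gridAfter_le n T)
  have : Tendsto (fun n : ℕ => T + 1 / ((n : ℝ≥0) + 1)) atTop (𝓝 (T + 0)) :=
    tendsto_const_nhds.add (tendsto_one_div_add_atTop_nhds_zero_nat (𝕜 := ℝ≥0))
  simpa using this

section RightContinuous
variable {Ω' : Type*} {X : ℝ≥0 → Ω' → ℝ≥0}

theorem measurable_eval_nat {m : MeasurableSpace Ω'} {Z : ℕ → Ω' → ℝ≥0}
    (hZ : ∀ i, Measurable (Z i)) {N : Ω' → ℕ} (hN : Measurable N) :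
    Measurable fun ω => Z (N ω) ω := by
  have h : Measurable fun p : ℕ × Ω' => Z p.1 p.2 := measurable_from_prod_countable_right hZ
  exact h.comp (hN.prodMk measurable_id)

/-- A right-continuous process evaluated at a bounded random time is measurable with respect to the
`σ`-algebra that is generated by the process up to the bound. -/
theorem measurable_eval_min {m : MeasurableSpace Ω'} (s : ℝ≥0)
    (hX : ∀ r ≤ s, Measurable (X r))
    (hc : ∀ ω t, ContinuousWithinAt (fun t => X t ω) (Ici t) t) {T : Ω' → ℝ≥0} (hT : Measurable T)
    (hTs : ∀ ω, T ω ≤ s) : Measurable fun ω => X (T ω) ω := by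
  -- Truncation at `s` keeps the grid times within the observed past and does not change the limit,
  -- since `T ≤ s`.
  refine measurable_of_tendsto_metrizable (f := fun n ω => X (min (gridAfter n (T ω)) s) ω)
    (fun n => ?_) (tendsto_pi_nhds.2 fun ω => ?_)
  · exact measurable_eval_nat (Z := fun i => X (min (((i : ℝ≥0) + 1) / (n + 1)) s))
      (fun i => hX _ (min_le_right _ _)) (Nat.measurable_floor.comp (hT.const_mul (n + 1 : ℝ≥0)))
  · refine (hc ω (T ω)).tendsto.comp (tendsto_nhdsWithin_iff.2 ⟨?_, Eventually.of_forall fun n =>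
      le_min (lt_gridAfter n _).le (hTs ω)⟩)
    have := ((tendsto_nhdsWithin_iff.1 (tendsto_gridAfter (T ω))).1).min
      (tendsto_const_nhds (x := s))
    rwa [min_eq_left (hTs ω)] at this

theorem measurable_eval {m : MeasurableSpace Ω'} (hX : ∀ r, Measurable (X r))
    (hc : ∀ ω t, ContinuousWithinAt (fun t => X t ω) (Ici t) t) {T : Ω' → ℝ≥0}
    (hT : Measurable T) : Measurable fun ω => X (T ω) ω := by
  refine measurable_of_tendsto_metrizable (f := fun n ω => X (gridAfter n (T ω)) ω)
    (fun n => ?_) (tendsto_pi_nhds.2 fun ω => (hc ω (T ω)).tendsto.comp (tendsto_gridAfter _))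
  exact measurable_eval_nat (Z := fun i => X (((i : ℝ≥0) + 1) / (n + 1)))
    (fun i => hX _) (Nat.measurable_floor.comp (hT.const_mul (n + 1 : ℝ≥0)))

end RightContinuous

/-! ### The strong Markov property -/

section StrongMarkov
variable {Ω' : Type*} [mΩ : MeasurableSpace Ω'] {P : Measure Ω'}
  {X : ℝ≥0 → Ω' → ℝ≥0}

/-- The Markov property at a fixed time, for a process with the law of the cell process. -/
theorem IsRate.markov_of_map_eq (hR : IsRate R) {x : ℝ≥0} (hX : ∀ t, StronglyMeasurable (X t))
    (hlaw : P.map (fun ω t => X t ω) = seqLaw.map (cellProcess R x)) (s t : ℝ≥0)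
    {f : ℝ≥0 → ℝ} (hf : IsBoundedBorel f) {A : Set Ω'}
    (hA : MeasurableSet[Filtration.natural X hX s] A) :
    ∫ ω in A, f (X (s + t) ω) ∂P = ∫ ω in A, cellOp R t f (X s ω) ∂P := by
  rw [Filtration.natural_eq_comap] at hA
  obtain ⟨A', hA', rfl⟩ := hA
  have hXm : Measurable fun ω t => X t ω := measurable_pi_iff.2 fun t => (hX t).measurable
  have hres : Measurable fun (w : ℝ≥0 → ℝ≥0) (j : Iic s) => w j := by fun_prop
  have hB : MeasurableSet {w : ℝ≥0 → ℝ≥0 | (fun j : Iic s => w j) ∈ A'} := hres hA'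
  have key : ∀ (r : ℝ≥0) (g : ℝ≥0 → ℝ), Measurable g →
      ∫ ω in (fun ω (j : Iic s) => X j ω) ⁻¹' A', g (X r ω) ∂P
      = ∫ u in {u | cellProcess R x u ∈ {w : ℝ≥0 → ℝ≥0 | (fun j : Iic s => w j) ∈ A'}},
          g (cellProcess R x u r) ∂seqLaw := by
    intro r g hg
    have hgm : Measurable fun w : ℝ≥0 → ℝ≥0 => g (w r) := hg.comp (measurable_pi_apply r)
    have h1 := setIntegral_map (μ := P) hB (f := fun w : ℝ≥0 → ℝ≥0 => g (w r))
      (g := fun ω t => X t ω) hgm.aestronglyMeasurable hXm.aemeasurable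
    have h2 := setIntegral_map (μ := seqLaw) hB (f := fun w : ℝ≥0 → ℝ≥0 => g (w r))
      (g := cellProcess R x) hgm.aestronglyMeasurable (hR.measurable_path x).aemeasurable
    rw [hlaw, h2] at h1
    exact h1.symm
  rw [key _ f hf.1, key _ _ (hR.isBoundedBorel_cellOp t hf).1]
  refine hR.markov x s t hf hB fun w w' hw hm => ?_
  have : (fun j : Iic s => w j) = fun j : Iic s => w' j := funext fun j => hw j j.2
  rwa [mem_ofPred_eq, ← this]

variable {τ : Ω' → WithTop ℝ≥0}

theorem measurable_untopA_of_isStoppingTime {F : Filtration ℝ≥0 mΩ} (hτ : IsStoppingTime F τ) :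
    Measurable fun ω => (τ ω).untopA := by
  refine measurable_of_Iic fun i => ?_
  have h1 : MeasurableSet {ω | τ ω ≤ i} := F.le i _ (hτ i)
  have h2 : MeasurableSet {ω | τ ω = ⊤} := by
    have : {ω | τ ω = ⊤} = (⋃ n : ℕ, {ω | τ ω ≤ (n : ℝ≥0)})ᶜ := by
      ext ω
      simp only [mem_ofPred_eq, mem_compl_iff, mem_iUnion, not_exists, not_le]
      constructor
      · intro h n; rw [h]; exact WithTop.coe_lt_top _
      · intro h
        by_contra hne
        obtain ⟨a, ha⟩ := WithTop.ne_top_iff_exists.1 hne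
        obtain ⟨n, hn⟩ := exists_nat_ge a
        have := h n
        rw [← ha, WithTop.coe_lt_coe] at this
        exact absurd hn (not_le.2 this)
    rw [this]
    exact (MeasurableSet.iUnion fun n : ℕ => F.le (n : ℝ≥0) _ (hτ _)).compl
  -- `untopA` takes one arbitrary value at `⊤`, so the preimage contains all of `{τ = ⊤}` or nothing
  -- of it.
  have : (fun ω => (τ ω).untopA) ⁻¹' Iic i
      = ({ω | τ ω ≤ i} ∩ {ω | τ ω = ⊤}ᶜ)
        ∪ ({ω | τ ω = ⊤} ∩ {_ω | (⊤ : WithTop ℝ≥0).untopA ≤ i}) := by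
    ext ω
    simp only [mem_preimage, mem_Iic, mem_union, mem_inter_iff, mem_ofPred_eq, mem_compl_iff]
    induction h : τ ω using WithTop.recTopCoe with
    | top => simp
    | coe a =>
      exact ⟨fun h => Or.inl ⟨WithTop.coe_le_coe.2 h, WithTop.coe_ne_top⟩, fun h =>
        h.elim (fun h => WithTop.coe_le_coe.1 h.1) fun h => absurd h.1 WithTop.coe_ne_top⟩
  rw [this]
  exact (h1.inter h2.compl).union (h2.inter (MeasurableSet.const _))

theorem measurableSet_lt_top_of_isStoppingTime {F : Filtration ℝ≥0 mΩ} (hτ : IsStoppingTime F τ) :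
    MeasurableSet[hτ.measurableSpace] {ω | τ ω < ⊤} := by
  have : {ω | τ ω < ⊤} = ⋃ n : ℕ, {ω | τ ω ≤ (n : ℝ≥0)} := by
    ext ω
    simp only [mem_ofPred_eq, mem_iUnion]
    constructor
    · intro h
      obtain ⟨a, ha⟩ := WithTop.ne_top_iff_exists.1 h.ne
      obtain ⟨n, hn⟩ := exists_nat_ge a
      exact ⟨n, by rw [← ha]; exact_mod_cast hn⟩
    · rintro ⟨n, hn⟩
      exact hn.trans_lt (WithTop.coe_lt_top _)
  rw [this]
  exact MeasurableSet.iUnion fun n => hτ.measurableSet_le' _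

/-- The value of the process at a finite stopping time is known at that time. -/
theorem measurable_indicator_eval (hX : ∀ t, StronglyMeasurable (X t))
    (hc : ∀ ω t, ContinuousWithinAt (fun t => X t ω) (Ici t) t)
    (hτ : IsStoppingTime (Filtration.natural X hX) τ) {G : ℝ≥0 → ℝ} (hG : Measurable G) :
    Measurable[hτ.measurableSpace]
      ({ω | τ ω < ⊤}.indicator fun ω => G (X (τ ω).untopA ω)) := by
  set g := {ω | τ ω < ⊤}.indicator fun ω => G (X (τ ω).untopA ω) with hg
  have hloc : ∀ (C : Set ℝ) (_ : MeasurableSet C) (s : ℝ≥0),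
      MeasurableSet[Filtration.natural X hX s] (g ⁻¹' C ∩ {ω | τ ω ≤ s}) := by
    intro C hC s
    -- The time `min τ s` is known at time `s` and agrees with `τ` on `{τ ≤ s}`; the default `s` at
    -- `⊤` keeps it bounded by `s`.
    have hT : Measurable[Filtration.natural X hX s] fun ω => min ((τ ω).untopD s) s := by
      refine @measurable_of_Iic ℝ≥0 Ω' _ _ _ (Filtration.natural X hX s) _ _ _ _ fun i => ?_
      rcases le_or_gt s i with hsi | his
      · convert! @MeasurableSet.univ _ (Filtration.natural X hX s) using 1
        ext ω
        simp [hsi]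
      · convert! (Filtration.natural X hX).mono his.le _ (hτ i) using 1
        ext ω
        simp only [mem_preimage, mem_Iic, min_le_iff, not_le.2 his, or_false, mem_ofPred_eq]
        induction h : τ ω using WithTop.recTopCoe with
        | top =>
          exact ⟨fun h => absurd h (not_le.2 his), fun h => absurd h (not_le.2 (WithTop.coe_lt_top i))⟩
        | coe a => exact WithTop.coe_le_coe.symm
    have hXs : ∀ r ≤ s, Measurable[Filtration.natural X hX s] (X r) := fun r hr =>
      ((Filtration.stronglyAdapted_natural hX r).mono
        ((Filtration.natural X hX).mono hr)).measurable
    have hev := @measurable_eval_min Ω' X (Filtration.natural X hX s) s hXs hc _ hT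
      (fun ω => min_le_right _ _)
    have : g ⁻¹' C ∩ {ω | τ ω ≤ s}
        = (fun ω => G (X (min ((τ ω).untopD s) s) ω)) ⁻¹' C ∩ {ω | τ ω ≤ s} := by
      ext ω
      simp only [mem_inter_iff, mem_preimage, mem_ofPred_eq, and_congr_left_iff]
      intro hω
      obtain ⟨a, ha⟩ := WithTop.ne_top_iff_exists.1 (hω.trans_lt (WithTop.coe_lt_top s)).ne
      have has : a ≤ s := by rw [← ha] at hω; exact_mod_cast hω
      rw [hg, indicator_of_mem (s := {ω | τ ω < ⊤}) (hω.trans_lt (WithTop.coe_lt_top s)), ← ha]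
      change G (X a ω) ∈ C ↔ G (X (min a s) ω) ∈ C
      rw [min_eq_left has]
    rw [this]
    exact MeasurableSet.inter (hG.comp hev hC) (hτ s)
  intro C hC
  -- Membership in the `σ`-algebra at `τ` has two clauses: measurability for the supremum of the
  -- filtration, and the localized condition just proved.
  refine ⟨?_, hloc C hC⟩
  have hle : ∀ s, Filtration.natural X hX s ≤ ⨆ t, Filtration.natural X hX t :=
    fun s => le_iSup (fun t => Filtration.natural X hX t) s
  have htop : MeasurableSet[⨆ t, Filtration.natural X hX t] {ω | τ ω < ⊤} :=
    hτ.measurableSpace_le' _ (measurableSet_lt_top_of_isStoppingTime hτ)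
  have : g ⁻¹' C = (⋃ n : ℕ, g ⁻¹' C ∩ {ω | τ ω ≤ (n : ℝ≥0)})
      ∪ ({ω | τ ω < ⊤}ᶜ ∩ {_ω | (0 : ℝ) ∈ C}) := by
    ext ω
    simp only [mem_preimage, mem_union, mem_iUnion, mem_inter_iff, mem_ofPred_eq, mem_compl_iff]
    by_cases h : τ ω < ⊤
    · obtain ⟨a, ha⟩ := WithTop.ne_top_iff_exists.1 h.ne
      obtain ⟨n, hn⟩ := exists_nat_ge a
      have : τ ω ≤ ((n : ℝ≥0) : WithTop ℝ≥0) := by rw [← ha]; exact_mod_cast hn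
      simp only [h, not_true_eq_false, false_and, or_false]
      exact ⟨fun hgC => ⟨n, hgC, this⟩, fun ⟨_, hgC, _⟩ => hgC⟩
    · rw [hg, indicator_of_notMem (s := {ω | τ ω < ⊤}) h]
      simp only [h, not_false_eq_true, true_and]
      exact ⟨Or.inr, fun h' => h'.elim (fun ⟨_, hgC, _⟩ => hgC) id⟩
  rw [this]
  exact (MeasurableSet.iUnion fun n : ℕ => hle _ _ (hloc C hC n)).union
    (htop.compl.inter (MeasurableSet.const _))

/-- The strong Markov property for bounded continuous functions, in integrated form. -/
theorem IsRate.strongMarkov_continuous [IsProbabilityMeasure P] (hR : IsRate R) (hg : ∀ᵐ u ∂seqLaw, GoodSeq u) {x : ℝ≥0}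
    (hX : ∀ t, StronglyMeasurable (X t))
    (hc : ∀ ω t, ContinuousWithinAt (fun t => X t ω) (Ici t) t)
    (hlaw : P.map (fun ω t => X t ω) = seqLaw.map (cellProcess R x))
    (hτ : IsStoppingTime (Filtration.natural X hX) τ) (t : ℝ≥0)
    {f : ℝ≥0 → ℝ} (hf : Continuous f) {C : ℝ} (hC : ∀ x, |f x| ≤ C) {A : Set Ω'}
    (hA : MeasurableSet[hτ.measurableSpace] A) (hAtop : ∀ ω ∈ A, τ ω < ⊤) :
    ∫ ω in A, f (X ((τ ω).untopA + t) ω) ∂P = ∫ ω in A, cellOp R t f (X (τ ω).untopA ω) ∂P := by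
  have hfb : IsBoundedBorel f := ⟨hf.measurable, C, hC⟩
  have hPf := hR.continuous_cellOp hg hf hC t
  have hXm : ∀ r, Measurable (X r) := fun r => (hX r).measurable
  have hT := measurable_untopA_of_isStoppingTime hτ
  have hAm : MeasurableSet A := hτ.measurableSpace_le _ hA
  have hGm : ∀ n, Measurable fun ω => gridAfter n (τ ω).untopA := fun n => by
    have h1 : Measurable fun ω => ⌊(n + 1 : ℝ≥0) * (τ ω).untopA⌋₊ :=
      Nat.measurable_floor.comp (hT.const_mul _)
    have h2 : Measurable fun i : ℕ => ((i : ℝ≥0) + 1) / (n + 1) := measurable_from_nat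
    exact h2.comp h1
  -- Right-continuity of the paths at `τ + r`. It is applied to `f` and to `cellOp R t f`, and for
  -- the latter continuity in the starting point is indispensable.
  have hlim : ∀ (g : ℝ≥0 → ℝ), Continuous g → (∀ y, |g y| ≤ C) → ∀ r : ℝ≥0,
      Tendsto (fun n => ∫ ω in A, g (X (gridAfter n (τ ω).untopA + r) ω) ∂P) atTop
        (𝓝 (∫ ω in A, g (X ((τ ω).untopA + r) ω) ∂P)) := by
    intro g hgc hgC r
    refine tendsto_integral_of_dominated_convergence (fun _ => C) (fun n => ?_)
      (integrable_const C) (fun n => Eventually.of_forall fun ω => hgC _)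
      (Eventually.of_forall fun ω => (hgc.tendsto _).comp ?_)
    · exact (hgc.measurable.comp (measurable_eval hXm hc
        ((hGm n).add_const r))).aestronglyMeasurable
    · refine (hc ω ((τ ω).untopA + r)).tendsto.comp (tendsto_nhdsWithin_iff.2 ⟨?_, ?_⟩)
      · exact (tendsto_nhdsWithin_iff.1 (tendsto_gridAfter (τ ω).untopA)).1.add_const r
      · exact Eventually.of_forall fun n => by
          simp only [mem_Ici]; gcongr; exact (lt_gridAfter n _).le
  -- A grid time has countably many values, so the fixed-time Markov property can be summed over
  -- them. The `+ 0` matches `hlim` at `r = 0`.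
  have heq : ∀ n, ∫ ω in A, f (X (gridAfter n (τ ω).untopA + t) ω) ∂P
      = ∫ ω in A, cellOp R t f (X (gridAfter n (τ ω).untopA + 0) ω) ∂P := by
    intro n
    set q : ℕ → ℝ≥0 := fun m => ((m : ℝ≥0) + 1) / (n + 1) with hq
    set A' : ℕ → Set Ω' := fun m => A ∩ {ω | ⌊(n + 1 : ℝ≥0) * (τ ω).untopA⌋₊ = m} with hA'
    have hA'm : ∀ m, MeasurableSet[Filtration.natural X hX (q m)] (A' m) := by
      intro m
      -- On `A` the floor equals `m` exactly when `m / (n + 1) ≤ τ < q m`. The redundant condition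
      -- `τ ≤ q m` brings in the set that is known to be measurable at time `q m`.
      have : A' m = (A ∩ {ω | τ ω ≤ q m}) ∩ ({ω | τ ω < q m} ∩
          {ω | (((m : ℝ≥0) / (n + 1) : ℝ≥0) : WithTop ℝ≥0) ≤ τ ω}) := by
        ext ω
        simp only [hA', mem_inter_iff, mem_ofPred_eq]
        constructor
        · rintro ⟨hω, hm⟩
          obtain ⟨a, ha⟩ := WithTop.ne_top_iff_exists.1 (hAtop ω hω).ne
          rw [← ha] at hm ⊢
          simp only [WithTop.untopA, WithTop.untopD_coe] at hm
          rw [Nat.floor_eq_iff (zero_le)] at hm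
          have h1 : a < q m := by
            rw [hq]; simp only
            rw [lt_div_iff₀ (by positivity), mul_comm]; exact hm.2
          have h2 : (m : ℝ≥0) / (n + 1) ≤ a := by
            rw [div_le_iff₀ (by positivity), mul_comm]; exact hm.1
          exact ⟨⟨hω, by exact_mod_cast h1.le⟩, by exact_mod_cast h1, by exact_mod_cast h2⟩
        · rintro ⟨⟨hω, -⟩, h1, h2⟩
          refine ⟨hω, ?_⟩
          obtain ⟨a, ha⟩ := WithTop.ne_top_iff_exists.1 (hAtop ω hω).ne
          rw [← ha] at h1 h2 ⊢
          rw [WithTop.coe_lt_coe, hq] at h1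
          rw [WithTop.coe_le_coe, div_le_iff₀ (by positivity), mul_comm] at h2
          simp only at h1
          rw [lt_div_iff₀ (by positivity), mul_comm] at h1
          simp only [WithTop.untopA, WithTop.untopD_coe]
          exact (Nat.floor_eq_iff (zero_le)).2 ⟨h2, h1⟩
      rw [this]
      refine (hA.2 (q m)).inter ((hτ.measurableSet_lt _).inter ?_)
      refine (Filtration.natural X hX).mono ?_ _ (hτ.measurableSet_ge _)
      rw [hq]; simp only; gcongr; exact le_self_add
    have hUn : A = ⋃ m, A' m := by
      ext ω
      simp [hA']
    have hdisj : Pairwise (Function.onFun Disjoint A') := fun i j hij =>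
      Set.disjoint_left.2 fun ω hi hj => hij (hi.2.symm.trans hj.2)
    have hA'm' : ∀ m, MeasurableSet (A' m) := fun m => (Filtration.natural X hX).le _ _ (hA'm m)
    have hIn : ∀ (g : ℝ≥0 → ℝ), IsBoundedBorel g → ∀ r : ℝ≥0,
        IntegrableOn (fun ω => g (X (gridAfter n (τ ω).untopA + r) ω)) (⋃ m, A' m) P := by
      rintro g ⟨hgm, K, hK⟩ r
      exact (Integrable.of_bound (hgm.comp (measurable_eval hXm hc
        ((hGm n).add_const r))).aestronglyMeasurable K
        (Eventually.of_forall fun u => hK _)).integrableOn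
    have hPfb := hR.isBoundedBorel_cellOp t hfb
    rw [hUn, integral_iUnion hA'm' hdisj (hIn f hfb t), integral_iUnion hA'm' hdisj
      (hIn _ hPfb 0)]
    refine tsum_congr fun m => ?_
    have hgr : ∀ ω ∈ A' m, gridAfter n (τ ω).untopA = q m := fun ω hω => by
      rw [gridAfter, hω.2]
    have e1 : ∫ ω in A' m, f (X (gridAfter n (τ ω).untopA + t) ω) ∂P
        = ∫ ω in A' m, f (X (q m + t) ω) ∂P :=
      setIntegral_congr_fun (hA'm' m) fun ω hω => by simp only [hgr ω hω]
    have e2 : ∫ ω in A' m, cellOp R t f (X (gridAfter n (τ ω).untopA + 0) ω) ∂P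
        = ∫ ω in A' m, cellOp R t f (X (q m) ω) ∂P :=
      setIntegral_congr_fun (hA'm' m) fun ω hω => by simp only [hgr ω hω, add_zero]
    rw [e1, e2]
    exact hR.markov_of_map_eq hX hlaw (q m) t hfb (hA'm m)
  have h1 := hlim f hf hC t
  have h2 := hlim _ hPf (abs_cellOp_le t hC) 0
  simp_rw [heq] at h1
  simpa using tendsto_nhds_unique h1 h2

/-- Both sides are integrals of `f` against finite measures on the state space. These agree on
bounded continuous functions, hence they are equal. -/
theorem IsRate.strongMarkov_setIntegral [IsProbabilityMeasure P] (hR : IsRate R) (hg : ∀ᵐ u ∂seqLaw, GoodSeq u) {x : ℝ≥0}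
    (hX : ∀ t, StronglyMeasurable (X t))
    (hc : ∀ ω t, ContinuousWithinAt (fun t => X t ω) (Ici t) t)
    (hlaw : P.map (fun ω t => X t ω) = seqLaw.map (cellProcess R x))
    (hτ : IsStoppingTime (Filtration.natural X hX) τ) (t : ℝ≥0)
    {f : ℝ≥0 → ℝ} (hf : IsBoundedBorel f) {A : Set Ω'}
    (hA : MeasurableSet[hτ.measurableSpace] A) (hAtop : ∀ ω ∈ A, τ ω < ⊤) :
    ∫ ω in A, f (X ((τ ω).untopA + t) ω) ∂P = ∫ ω in A, cellOp R t f (X (τ ω).untopA ω) ∂P := by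
  have hXm : ∀ r, Measurable (X r) := fun r => (hX r).measurable
  have hT := measurable_untopA_of_isStoppingTime hτ
  have hm1 : Measurable fun ω => X ((τ ω).untopA + t) ω := measurable_eval hXm hc (hT.add_const t)
  have hm2 : Measurable fun ω => X (τ ω).untopA ω := measurable_eval hXm hc hT
  have hint : ∀ g : ℝ≥0 → ℝ, IsBoundedBorel g →
      ∫ y, g y ∂((P.restrict A).map fun ω => X ((τ ω).untopA + t) ω)
        = ∫ ω in A, g (X ((τ ω).untopA + t) ω) ∂P ∧
      ∫ y, g y ∂((P.restrict A).map fun ω => X (τ ω).untopA ω).bind (cellKernel hR t)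
        = ∫ ω in A, cellOp R t g (X (τ ω).untopA ω) ∂P := by
    rintro g ⟨hgm, K, hK⟩
    refine ⟨integral_map hm1.aemeasurable hgm.aestronglyMeasurable, ?_⟩
    rw [Measure.comp_eq_comp_const_apply, Kernel.integral_comp, Kernel.const_apply]
    · simp_rw [integral_cellKernel hR t _ hgm]
      exact integral_map hm2.aemeasurable
        (hR.isBoundedBorel_cellOp t ⟨hgm, K, hK⟩).1.aestronglyMeasurable
    · exact Integrable.of_bound hgm.aestronglyMeasurable K (Eventually.of_forall hK)
  have hmeas : (P.restrict A).map (fun ω => X ((τ ω).untopA + t) ω)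
      = ((P.restrict A).map fun ω => X (τ ω).untopA ω).bind (cellKernel hR t) := by
    refine ext_of_forall_integral_eq_of_IsFiniteMeasure fun g => ?_
    have hgC : ∀ y, |g y| ≤ ‖g‖ := fun y => g.norm_coe_le_norm y
    have hgb : IsBoundedBorel g := ⟨g.continuous.measurable, _, hgC⟩
    rw [(hint g hgb).1, (hint g hgb).2]
    exact hR.strongMarkov_continuous hg hX hc hlaw hτ t g.continuous hgC hA hAtop
  rw [← (hint f hf).1, ← (hint f hf).2, hmeas]

/-- The strong Markov property. -/
theorem IsRate.strongMarkov [IsProbabilityMeasure P] (hR : IsRate R) (hg : ∀ᵐ u ∂seqLaw, GoodSeq u) {x : ℝ≥0}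
    (hX : ∀ t, StronglyMeasurable (X t))
    (hc : ∀ ω t, ContinuousWithinAt (fun t => X t ω) (Ici t) t)
    (hlaw : P.map (fun ω t => X t ω) = seqLaw.map (cellProcess R x))
    (hτ : IsStoppingTime (Filtration.natural X hX) τ) (t : ℝ≥0)
    {f : ℝ≥0 → ℝ} (hf : IsBoundedBorel f) :
    P[{ω | τ ω < ⊤}.indicator (fun ω => f (X ((τ ω).untopA + t) ω)) | hτ.measurableSpace]
      =ᵐ[P] {ω | τ ω < ⊤}.indicator (fun ω => cellOp R t f (X (τ ω).untopA ω)) := by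
  have hXm : ∀ r, Measurable (X r) := fun r => (hX r).measurable
  have hT := measurable_untopA_of_isStoppingTime hτ
  have hm1 : Measurable fun ω => X ((τ ω).untopA + t) ω := measurable_eval hXm hc (hT.add_const t)
  have hm2 : Measurable fun ω => X (τ ω).untopA ω := measurable_eval hXm hc hT
  have htop := measurableSet_lt_top_of_isStoppingTime hτ
  have htop' : MeasurableSet {ω | τ ω < ⊤} := hτ.measurableSpace_le _ htop
  have hint : ∀ (g : ℝ≥0 → ℝ), IsBoundedBorel g → ∀ Y : Ω' → ℝ≥0, Measurable Y →
      Integrable ({ω | τ ω < ⊤}.indicator fun ω => g (Y ω)) P := by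
    rintro g ⟨hgm, K, hK⟩ Y hY
    exact (Integrable.of_bound (hgm.comp hY).aestronglyMeasurable K
      (Eventually.of_forall fun u => hK _)).indicator htop'
  have hPfb := hR.isBoundedBorel_cellOp t hf
  symm
  refine ae_eq_condExp_of_forall_setIntegral_eq hτ.measurableSpace_le (hint f hf _ hm1)
    (fun s _ _ => (hint _ hPfb _ hm2).integrableOn) (fun s hs _ => ?_)
    (measurable_indicator_eval hX hc hτ hPfb.1).stronglyMeasurable.aestronglyMeasurable
  rw [setIntegral_indicator htop', setIntegral_indicator htop']
  exact (hR.strongMarkov_setIntegral hg hX hc hlaw hτ t hf (hs.inter htop)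
    fun ω hω => hω.2).symm

end StrongMarkov

end

/-! ### The density of a stationary law -/

section

variable {R : ℝ → ℝ} {π : Measure ℝ≥0}

/-- The tail integral `∫_{z > y} R(z)/z dπ(z)`. -/
def tailRate (R : ℝ → ℝ) (π : Measure ℝ≥0) (y : ℝ) : ℝ≥0∞ :=
  ∫⁻ z in {z : ℝ≥0 | y < z}, ENNReal.ofReal (R z / z) ∂π

theorem tailRate_antitone (R : ℝ → ℝ) (π : Measure ℝ≥0) : Antitone (tailRate R π) :=
  fun _ _ hab => lintegral_mono_set fun _ hz => lt_of_le_of_lt hab hz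

theorem measurable_tailRate (R : ℝ → ℝ) (π : Measure ℝ≥0) : Measurable (tailRate R π) :=
  (tailRate_antitone R π).measurable

/-- The stationary equation at the point `b` with `exp (-t) * b = a`. The substitution `y = exp (s -
t) * b` has `dy = y ds`, which turns the weight `y² ds` into `y dy`. -/
theorem IsStationary.measure_Ioc (hπ : IsStationary R π) {a b : ℝ≥0} (ha : 0 < a) (hab : a ≤ b) :
    π (Ioc a b) = ∫⁻ y in Icc (a : ℝ) b, ENNReal.ofReal y * tailRate R π y := by
  have := hπ.isProbabilityMeasure
  have ha' : (0 : ℝ) < a := ha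
  have hb' : (0 : ℝ) < b := ha.trans_le hab
  have hab' : (a : ℝ) ≤ b := hab
  have ht : 0 ≤ Real.log ((b : ℝ) / a) := Real.log_nonneg ((one_le_div ha').2 hab')
  set t : ℝ≥0 := ⟨Real.log ((b : ℝ) / a), ht⟩ with htdef
  have htc : (t : ℝ) = Real.log ((b : ℝ) / a) := rfl
  have hexp : Real.exp (-t) * b = a := by
    rw [htc, Real.exp_neg, Real.exp_log (by positivity)]; field_simp
  have hst := hπ.stationary t b
  have hx0 : (Real.exp (-(t : ℝ))).toNNReal * b = a := by
    ext; rw [NNReal.coe_mul, Real.coe_toNNReal _ (Real.exp_pos _).le, hexp]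
  rw [growthFragOp, hx0] at hst
  have hsub : π (Iic b) = π (Iic a) + π (Ioc a b) := by
    rw [← Iic_union_Ioc_eq_Iic hab, measure_union (by
      rw [Set.disjoint_left]; intro x hx hx'; exact absurd hx (not_le.2 hx'.1)) measurableSet_Ioc]
  rw [hsub, ENNReal.add_right_inj (measure_ne_top _ _)] at hst
  rw [hst]
  have himg : (fun s : ℝ => Real.exp (s - t) * b) '' Icc 0 t = Icc (a : ℝ) b := by
    ext y
    constructor
    · rintro ⟨s, hs, rfl⟩
      simp only
      constructor
      · rw [← hexp]; gcongr; linarith [hs.1]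
      · calc Real.exp (s - t) * b ≤ 1 * b := by
              gcongr; exact Real.exp_le_one_iff.2 (by linarith [hs.2])
          _ = b := one_mul _
    · intro hy
      have hy0 : 0 < y := ha'.trans_le hy.1
      refine ⟨t + Real.log (y / b), ⟨?_, ?_⟩, ?_⟩
      · rw [htc, ← Real.log_mul (by positivity) (by positivity)]
        refine Real.log_nonneg ?_
        rw [show (b : ℝ) / a * (y / b) = y / a by field_simp]
        exact (one_le_div ha').2 hy.1
      · have : Real.log (y / b) ≤ 0 := Real.log_nonpos (by positivity) ((div_le_one hb').2 hy.2)
        linarith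
      · simp only [add_sub_cancel_left]
        rw [Real.exp_log (by positivity)]; field_simp
  rw [← himg, lintegral_image_eq_lintegral_abs_deriv_mul measurableSet_Icc
    (f' := fun s => Real.exp (s - t) * b)]
  · refine setLIntegral_congr_fun measurableSet_Icc fun s _ => ?_
    have hpos : 0 < Real.exp (s - t) * b := by positivity
    rw [abs_of_pos hpos, ← mul_assoc, ← ENNReal.ofReal_mul hpos.le, ← pow_two, tailRate]
    congr 2
    congr 1
    ext z
    simp only [mem_Ioi, mem_ofPred_eq]
    rw [← NNReal.coe_lt_coe, NNReal.coe_mul, Real.coe_toNNReal _ (Real.exp_pos _).le]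
  · intro s _
    have := ((hasDerivAt_id s).sub_const (t : ℝ)).exp.mul_const (b : ℝ)
    simpa using this.hasDerivWithinAt
  · intro s _ s' _ h
    have := mul_right_cancel₀ hb'.ne' h
    linarith [Real.exp_injective this]

/-- An infinite tail at `y` would by monotonicity be infinite on all of `[y/2, y]`, and `π` would
give this interval infinite mass. -/
theorem IsStationary.tailRate_lt_top (hπ : IsStationary R π) {y : ℝ} (hy : 0 < y) :
    tailRate R π y < ∞ := by
  have := hπ.isProbabilityMeasure
  lift y to ℝ≥0 using hy.le
  have h0 : 0 < y := hy
  have h := hπ.measure_Ioc (a := y / 2) (b := y) (by positivity) (half_le_self zero_le)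
  by_contra htop
  rw [not_lt, top_le_iff] at htop
  have h1 : ∫⁻ _ in Icc ((y / 2 : ℝ≥0) : ℝ) y, (∞ : ℝ≥0∞)
      ≤ ∫⁻ z in Icc ((y / 2 : ℝ≥0) : ℝ) y, ENNReal.ofReal z * tailRate R π z := by
    refine setLIntegral_mono' measurableSet_Icc fun z hz => ?_
    have hz0 : 0 < z := lt_of_lt_of_le (by positivity) hz.1
    have hz1 : tailRate R π z = ∞ := top_le_iff.1 (htop ▸ tailRate_antitone R π hz.2)
    rw [hz1, ENNReal.mul_top (by simpa using hz0)]
  rw [← h, setLIntegral_const, Real.volume_Icc, ENNReal.top_mul] at h1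
  · exact absurd h1 (not_le.2 (measure_lt_top _ _))
  · push_cast
    simp only [ne_eq, ENNReal.ofReal_eq_zero, not_le]
    linarith

/-- A stationary solution has the density `y * tailRate R π y`. -/
theorem IsStationary.map_coe_eq (hπ : IsStationary R π) :
    π.map ((↑) : ℝ≥0 → ℝ) = (volume.restrict (Ioi 0)).withDensity
      fun y => ENNReal.ofReal y * tailRate R π y := by
  have := hπ.isProbabilityMeasure
  have hm : Measurable ((↑) : ℝ≥0 → ℝ) := NNReal.continuous_coe.measurable
  set ν := (volume.restrict (Ioi (0 : ℝ))).withDensity fun y => ENNReal.ofReal y * tailRate R π y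
  have hpos : ∀ a b : ℝ, 0 < a → (π.map ((↑) : ℝ≥0 → ℝ)) (Ioc a b) = ν (Ioc a b) := by
    intro a b ha
    rcases le_or_gt a b with hab | hab
    · lift a to ℝ≥0 using ha.le
      lift b to ℝ≥0 using ha.le.trans hab
      rw [Measure.map_apply hm measurableSet_Ioc]
      have : ((↑) : ℝ≥0 → ℝ) ⁻¹' Ioc (a : ℝ) b = Ioc a b := by ext z; simp
      rw [this, hπ.measure_Ioc (by exact_mod_cast ha) (by exact_mod_cast hab),
        withDensity_apply _ measurableSet_Ioc, Measure.restrict_restrict measurableSet_Ioc,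
        inter_eq_left.2 (show Ioc (a : ℝ) b ⊆ Ioi 0 from fun z hz => ha.trans hz.1), restrict_Ioc_eq_restrict_Icc]
    · simp [Ioc_eq_empty_of_le hab.le]
  have hz1 : (π.map ((↑) : ℝ≥0 → ℝ)) (Iic 0) = 0 := by
    rw [Measure.map_apply hm measurableSet_Iic]
    convert! hπ.zero using 2
    ext z
    simp only [mem_preimage, mem_Iic, mem_singleton_iff]
    exact ⟨fun h => NNReal.eq (le_antisymm h z.2), fun h => by simp [h]⟩
  have hz2 : ν (Iic 0) = 0 := by
    rw [withDensity_apply _ measurableSet_Iic, Measure.restrict_restrict measurableSet_Iic]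
    have : Iic (0 : ℝ) ∩ Ioi 0 = ∅ := by ext z; simp
    rw [this, Measure.restrict_empty, lintegral_zero_measure]
  have hzero : ∀ b : ℝ, (π.map ((↑) : ℝ≥0 → ℝ)) (Iic b) = ν (Iic b) := by
    intro b
    rcases le_or_gt b 0 with hb | hb
    · rw [measure_mono_null (Iic_subset_Iic.2 hb) hz1, measure_mono_null (Iic_subset_Iic.2 hb) hz2]
    -- The density formula is available only away from `0`; as neither measure charges `Iic 0`, it
    -- extends by exhaustion.
    · have hU : ∀ μ : Measure ℝ, μ (Iic 0) = 0 →
          Tendsto (fun n : ℕ => μ (Ioc (1 / ((n : ℝ) + 1)) b)) atTop (𝓝 (μ (Iic b))) := by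
        intro μ hμ
        have h1 : μ (Iic b) = μ (⋃ n : ℕ, Ioc (1 / ((n : ℝ) + 1)) b) := by
          have : ⋃ n : ℕ, Ioc (1 / ((n : ℝ) + 1)) b = Iic b \ Iic 0 := by
            ext z
            simp only [mem_iUnion, mem_Ioc, Set.mem_sdiff, mem_Iic, not_le]
            constructor
            · rintro ⟨n, h1, h2⟩
              exact ⟨h2, lt_trans (by positivity) h1⟩
            · rintro ⟨h1, h2⟩
              obtain ⟨n, hn⟩ := exists_nat_one_div_lt h2
              exact ⟨n, hn, h1⟩
          rw [this, measure_sdiff_null hμ]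
        rw [h1]
        refine tendsto_measure_iUnion_atTop fun n m hnm => Ioc_subset_Ioc_left ?_
        exact one_div_le_one_div_of_le (by positivity) (by gcongr)
      refine tendsto_nhds_unique (hU _ hz1) ((hU _ hz2).congr fun n => ?_)
      exact (hpos _ _ (by positivity)).symm
  have : IsFiniteMeasure (π.map ((↑) : ℝ≥0 → ℝ)) := Measure.isFiniteMeasure_map π _
  exact Measure.ext_of_Iic _ _ hzero

theorem IsStationary.lintegral_eq (hπ : IsStationary R π) {F : ℝ≥0 → ℝ≥0∞} (hF : Measurable F) :
    ∫⁻ x, F x ∂π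
      = ∫⁻ y in Ioi (0 : ℝ), ENNReal.ofReal y * tailRate R π y * F y.toNNReal := by
  have hm : Measurable ((↑) : ℝ≥0 → ℝ) := NNReal.continuous_coe.measurable
  have hF' : Measurable fun y : ℝ => F y.toNNReal := hF.comp measurable_real_toNNReal
  have hd : Measurable fun y : ℝ => ENNReal.ofReal y * tailRate R π y :=
    ENNReal.measurable_ofReal.mul (measurable_tailRate R π)
  have h := lintegral_map (μ := π) hF' hm
  simp only [Real.toNNReal_coe] at h
  rw [← h, hπ.map_coe_eq, lintegral_withDensity_eq_lintegral_mul _ hd hF']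
  rfl

/-- Inserting the density `z * tailRate R π z` in the definition cancels the denominator of `R z /
z`. The result is a linear integral equation for `tailRate` alone. -/
theorem IsStationary.tailRate_eq (hπ : IsStationary R π) (hRm : Measurable R) {y : ℝ}
    (hy : 0 ≤ y) :
    tailRate R π y = ∫⁻ z in Ioi y, ENNReal.ofReal (R z) * tailRate R π z := by
  have hset : MeasurableSet {z : ℝ≥0 | y < z} :=
    measurableSet_lt measurable_const NNReal.continuous_coe.measurable
  have hF : Measurable fun z : ℝ≥0 => ENNReal.ofReal (R z / z) := by fun_prop
  conv_lhs => rw [tailRate]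
  rw [← lintegral_indicator hset, hπ.lintegral_eq (hF.indicator hset),
    ← lintegral_indicator measurableSet_Ioi, ← lintegral_indicator measurableSet_Ioi]
  congr 1
  ext z
  by_cases hz : y < z
  · have hz0 : 0 < z := hy.trans_lt hz
    rw [indicator_of_mem (s := Ioi 0) hz0, indicator_of_mem (s := Ioi y) hz,
      indicator_of_mem (s := {z : ℝ≥0 | y < z}) (by rw [mem_ofPred_eq, Real.coe_toNNReal _ hz0.le]; exact hz), Real.coe_toNNReal _ hz0.le,
      mul_right_comm, ← ENNReal.ofReal_mul hz0.le, mul_div_cancel₀ _ hz0.ne']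
  · rw [indicator_of_notMem (s := Ioi y) hz]
    by_cases hz0 : 0 < z
    · rw [indicator_of_mem (s := Ioi 0) hz0, indicator_of_notMem, mul_zero]
      rw [mem_ofPred_eq, Real.coe_toNNReal _ hz0.le]; exact hz
    · rw [indicator_of_notMem (s := Ioi 0) hz0]

theorem IsStationary.tailRate_eq_add (hπ : IsStationary R π) (hRm : Measurable R) {a b : ℝ}
    (ha : 0 ≤ a) (hab : a ≤ b) :
    tailRate R π a = (∫⁻ z in Ioc a b, ENNReal.ofReal (R z) * tailRate R π z)
      + tailRate R π b := by
  rw [hπ.tailRate_eq hRm ha, hπ.tailRate_eq hRm (ha.trans hab), ← Ioc_union_Ioi_eq_Ioi hab,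
    lintegral_union measurableSet_Ioi]
  rw [Set.disjoint_left]; intro x hx hx'; exact absurd hx.2 (not_le.2 hx')

/-! ### Exponential decay of the tail integral along the flow -/

theorem IsRate.setLIntegral_eq (hR : IsRate R) {a b : ℝ} (ha : 0 < a) (hab : a ≤ b) :
    ∫⁻ z in Ioc a b, ENNReal.ofReal (R z) = ENNReal.ofReal (cumRate R b - cumRate R a) := by
  rw [← hR.integral_eq ha (ha.trans_le hab), intervalIntegral.integral_of_le hab,
    ofReal_integral_eq_lintegral_ofReal ((hR.integrableOn_Icc ha).mono_set Ioc_subset_Icc_self)]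
  filter_upwards [ae_restrict_mem measurableSet_Ioc] with z hz
  exact hR.nonneg z (ha.trans hz.1)

/-- Over a stretch of cumulated rate `n * ε`, the tail integral decays at least by the factor
`(1 + ε)⁻ⁿ` and at most by `(1 - ε)ⁿ`. -/
theorem IsStationary.tailRate_pow_bounds (hπ : IsStationary R π) (hR : IsRate R)
    (hRm : Measurable R) {ε : ℝ} (hε : 0 ≤ ε) (hε1 : ε ≤ 1) (n : ℕ) :
    ∀ {a b : ℝ}, 0 < a → a ≤ b → cumRate R b - cumRate R a = n * ε →
      (tailRate R π b).toReal * (1 + ε) ^ n ≤ (tailRate R π a).toReal ∧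
      (tailRate R π a).toReal * (1 - ε) ^ n ≤ (tailRate R π b).toReal := by
  -- `tailRate` is antitone, so on `(a, b]` it may be replaced by its end values in the increment `∫
  -- R * tailRate`. No differentiability is needed.
  have step : ∀ {a b : ℝ}, 0 < a → a ≤ b →
      (tailRate R π b).toReal * (1 + (cumRate R b - cumRate R a)) ≤ (tailRate R π a).toReal ∧
      (tailRate R π a).toReal * (1 - (cumRate R b - cumRate R a)) ≤ (tailRate R π b).toReal := by
    intro a b ha hab
    have hb := ha.trans_le hab
    have hδ : 0 ≤ cumRate R b - cumRate R a := sub_nonneg.2 (hR.cumRate_mono ha hab)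
    have hI := hR.setLIntegral_eq ha hab
    have hadd := hπ.tailRate_eq_add hRm ha.le hab
    have hma := (hπ.tailRate_lt_top ha).ne
    have hmb := (hπ.tailRate_lt_top hb).ne
    have hRm' : Measurable fun z => ENNReal.ofReal (R z) := by fun_prop
    constructor
    · have h1 : ENNReal.ofReal (cumRate R b - cumRate R a) * tailRate R π b + tailRate R π b
          ≤ tailRate R π a := by
        rw [hadd, ← hI, ← lintegral_mul_const _ hRm']
        gcongr ?_ + _
        refine setLIntegral_mono' measurableSet_Ioc fun z hz => ?_
        gcongr
        exact tailRate_antitone R π hz.2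
      have h2 := ENNReal.toReal_mono hma h1
      rw [ENNReal.toReal_add (ENNReal.mul_ne_top ENNReal.ofReal_ne_top hmb) hmb,
        ENNReal.toReal_mul, ENNReal.toReal_ofReal hδ] at h2
      linarith
    · have h1 : tailRate R π a ≤ ENNReal.ofReal (cumRate R b - cumRate R a) * tailRate R π a
          + tailRate R π b := by
        conv_lhs => rw [hadd]
        rw [← hI, ← lintegral_mul_const _ hRm']
        gcongr ?_ + _
        refine setLIntegral_mono' measurableSet_Ioc fun z hz => ?_
        gcongr
        exact tailRate_antitone R π hz.1.le
      have hne : ENNReal.ofReal (cumRate R b - cumRate R a) * tailRate R π a ≠ ∞ :=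
        ENNReal.mul_ne_top ENNReal.ofReal_ne_top hma
      have h2 := ENNReal.toReal_mono (ENNReal.add_ne_top.2 ⟨hne, hmb⟩) h1
      rw [ENNReal.toReal_add hne hmb, ENNReal.toReal_mul, ENNReal.toReal_ofReal hδ] at h2
      linarith
  induction n with
  | zero =>
    intro a b ha hab h
    have := step ha hab
    rw [h] at this
    simpa using this
  | succ n ih =>
    intro a b ha hab h
    -- The end of the first stretch of cumulated rate `ε`, by the intermediate value theorem for
    -- `cumRate`.
    obtain ⟨c, hc, hcε⟩ : ∃ c ∈ Icc a b, cumRate R c = cumRate R a + ε := by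
      have hcont : ContinuousOn (cumRate R) (Icc a b) :=
        hR.continuousOn_cumRate.mono fun z hz => ha.trans_le hz.1
      refine intermediate_value_Icc hab hcont ⟨by linarith, ?_⟩
      push_cast at h
      nlinarith [mul_nonneg (Nat.cast_nonneg n : (0 : ℝ) ≤ n) hε]
    obtain ⟨s1, s2⟩ := step ha hc.1
    rw [show cumRate R c - cumRate R a = ε by linarith] at s1 s2
    obtain ⟨i1, i2⟩ := ih (ha.trans_le hc.1) hc.2 (by push_cast at h; linarith)
    have hε1' : 0 ≤ 1 - ε := by linarith
    constructor
    · calc (tailRate R π b).toReal * (1 + ε) ^ (n + 1)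
          = (tailRate R π b).toReal * (1 + ε) ^ n * (1 + ε) := by ring
        _ ≤ (tailRate R π c).toReal * (1 + ε) := by gcongr
        _ ≤ _ := s1
    · calc (tailRate R π a).toReal * (1 - ε) ^ (n + 1)
          = (tailRate R π a).toReal * (1 - ε) * (1 - ε) ^ n := by ring
        _ ≤ (tailRate R π c).toReal * (1 - ε) ^ n := by gcongr
        _ ≤ _ := i2

/-- The tail integral is a multiple of `exp (-∫ R)`. -/
theorem IsStationary.tailRate_exp (hπ : IsStationary R π) (hR : IsRate R) (hRm : Measurable R)
    {a b : ℝ} (ha : 0 < a) (hab : a ≤ b) :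
    tailRate R π b
      = tailRate R π a * ENNReal.ofReal (Real.exp (-(cumRate R b - cumRate R a))) := by
  have hb := ha.trans_le hab
  set δ := cumRate R b - cumRate R a with hδdef
  have hδ : 0 ≤ δ := sub_nonneg.2 (hR.cumRate_mono ha hab)
  -- The stretch is cut into `n` pieces of rate `δ / n`; `n ≥ δ` keeps the lower factor `1 - δ / n`
  -- nonnegative. The factors tend to `exp (± δ)`.
  have hbd : ∀ᶠ n : ℕ in atTop, (tailRate R π b).toReal * (1 + δ / n) ^ n
      ≤ (tailRate R π a).toReal ∧
      (tailRate R π a).toReal * (1 + (-δ) / n) ^ n ≤ (tailRate R π b).toReal := by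
    obtain ⟨N, hN⟩ := exists_nat_ge δ
    filter_upwards [eventually_ge_atTop N, eventually_gt_atTop 0] with n hn hn0
    have hn0' : (0 : ℝ) < n := by exact_mod_cast hn0
    have hle : δ / n ≤ 1 := by
      rw [div_le_one hn0']
      exact hN.trans (by exact_mod_cast hn)
    have := hπ.tailRate_pow_bounds hR hRm (by positivity : 0 ≤ δ / n) hle n ha hab
      (by field_simp; rfl)
    rwa [neg_div, ← sub_eq_add_neg]
  have h1 : (tailRate R π b).toReal * Real.exp δ ≤ (tailRate R π a).toReal :=
    le_of_tendsto ((Real.tendsto_one_add_div_pow_exp δ).const_mul _) (hbd.mono fun _ h => h.1)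
  have h2 : (tailRate R π a).toReal * Real.exp (-δ) ≤ (tailRate R π b).toReal :=
    le_of_tendsto ((Real.tendsto_one_add_div_pow_exp (-δ)).const_mul _) (hbd.mono fun _ h => h.2)
  have hma := (hπ.tailRate_lt_top ha).ne
  rw [← ENNReal.toReal_eq_toReal_iff' (hπ.tailRate_lt_top hb).ne
    (ENNReal.mul_ne_top hma ENNReal.ofReal_ne_top), ENNReal.toReal_mul,
    ENNReal.toReal_ofReal (Real.exp_pos _).le]
  refine le_antisymm ?_ h2
  rw [Real.exp_neg, ← div_eq_mul_inv, le_div_iff₀ (Real.exp_pos _)]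
  exact h1

/-- The link between `π` and the process: along the flow `tailRate` decreases by exactly the
survival probability. -/
theorem IsStationary.tailRate_mul_exp (hπ : IsStationary R π) (hR : IsRate R) (hRm : Measurable R)
    {x s : ℝ} (hx : 0 < x) (hs : 0 ≤ s) :
    tailRate R π (x * Real.exp s) = tailRate R π x * ENNReal.ofReal (survivor R x s) := by
  rw [hπ.tailRate_exp hR hRm hx (le_mul_of_one_le_right hx.le (Real.one_le_exp hs)),
    hR.survivor_eq hx, neg_sub]

/-! ### Changes of variables -/

theorem lintegral_image_mul_exp {x : ℝ} (hx : 0 < x) {T : Set ℝ} (hT : MeasurableSet T)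
    (g : ℝ → ℝ≥0∞) :
    ∫⁻ z in (fun s => x * Real.exp s) '' T, g z
      = ∫⁻ s in T, ENNReal.ofReal (x * Real.exp s) * g (x * Real.exp s) := by
  rw [lintegral_image_eq_lintegral_abs_deriv_mul hT (f' := fun s => x * Real.exp s)]
  · refine setLIntegral_congr_fun hT fun s _ => ?_
    rw [abs_of_pos (by positivity)]
  · intro s _
    exact ((Real.hasDerivAt_exp s).const_mul x).hasDerivWithinAt
  · intro s _ s' _ h
    exact Real.exp_injective (mul_left_cancel₀ hx.ne' h)

theorem image_mul_exp_Ioc {x : ℝ} (hx : 0 < x) (a : ℝ) :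
    (fun s => x * Real.exp s) '' Ioc 0 a = Ioc x (x * Real.exp a) := by
  ext y
  constructor
  · rintro ⟨s, hs, rfl⟩
    exact ⟨lt_mul_of_one_lt_right hx (Real.one_lt_exp_iff.2 hs.1),
      mul_le_mul_of_nonneg_left (Real.exp_le_exp.2 hs.2) hx.le⟩
  · rintro ⟨h1, h2⟩
    have hy : 0 < y / x := div_pos (hx.trans h1) hx
    refine ⟨Real.log (y / x), ⟨Real.log_pos ((one_lt_div hx).2 h1), ?_⟩, ?_⟩
    · rw [Real.log_le_iff_le_exp hy, div_le_iff₀ hx, mul_comm]; exact h2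
    · simp only
      rw [Real.exp_log hy]; field_simp

theorem lintegral_comp_mul_left_Ioi {c : ℝ} (hc : 0 < c) (g : ℝ → ℝ≥0∞) :
    ENNReal.ofReal c * ∫⁻ x in Ioi 0, g (c * x) = ∫⁻ z in Ioi 0, g z := by
  have himg : (fun x => c * x) '' Ioi 0 = Ioi 0 := by
    rw [image_mul_left_Ioi hc, mul_zero]
  conv_rhs => rw [← himg]
  rw [lintegral_image_eq_lintegral_abs_deriv_mul measurableSet_Ioi (f' := fun _ => c)
    (fun s _ => by simpa using ((hasDerivAt_id s).const_mul c).hasDerivWithinAt)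
    (fun s _ s' _ h => mul_left_cancel₀ hc.ne' h), abs_of_pos hc,
    lintegral_const_mul' _ _ ENNReal.ofReal_ne_top]

theorem lintegral_comp_mul_left_Ioo {c : ℝ} (hc : 0 < c) (g : ℝ → ℝ≥0∞) :
    ENNReal.ofReal c * ∫⁻ x in Ioo 0 1, g (c * x) = ∫⁻ z in Ioo 0 c, g z := by
  have himg : (fun x => c * x) '' Ioo 0 1 = Ioo 0 c := by
    rw [image_mul_left_Ioo hc, mul_zero, mul_one]
  conv_rhs => rw [← himg]
  rw [lintegral_image_eq_lintegral_abs_deriv_mul measurableSet_Ioo (f' := fun _ => c)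
    (fun s _ => by simpa using ((hasDerivAt_id s).const_mul c).hasDerivWithinAt)
    (fun s _ s' _ h => mul_left_cancel₀ hc.ne' h), abs_of_pos hc,
    lintegral_const_mul' _ _ ENNReal.ofReal_ne_top]

theorem unif_Ici {c : ℝ} (h0 : 0 ≤ c) : unif (Ici c) = ENNReal.ofReal (1 - c) := by
  rw [unif, Measure.restrict_apply measurableSet_Ici]
  refine (measure_congr ?_).trans (Real.volume_Ico (a := c) (b := 1))
  have h : ∀ᵐ y : ℝ, y ≠ 0 := by simp [ae_iff]
  filter_upwards [h] with y hy
  apply propext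
  change (y ∈ Ici c ∩ Ioo 0 1) ↔ y ∈ Ico c 1
  simp only [mem_inter_iff, mem_Ici, mem_Ioo, mem_Ico]
  exact ⟨fun h => ⟨h.1, h.2.2⟩, fun h => ⟨h.1, lt_of_le_of_ne (h0.trans h.1) hy.symm, h.2⟩⟩

/-- The square root of a uniform variable has density `2v` on `(0, 1)`. -/
theorem lintegral_sqrt_unif (g : ℝ → ℝ≥0∞) :
    ∫⁻ b, g √b ∂unif = ∫⁻ v in Ioo (0 : ℝ) 1, ENNReal.ofReal (2 * v) * g v := by
  have himg : (fun v : ℝ => v ^ 2) '' Ioo 0 1 = Ioo 0 1 := by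
    ext y
    constructor
    · rintro ⟨v, hv, rfl⟩
      exact ⟨by have := hv.1; positivity, pow_lt_one₀ hv.1.le hv.2 two_ne_zero⟩
    · intro hy
      refine ⟨√y, ⟨Real.sqrt_pos.2 hy.1, ?_⟩, Real.sq_sqrt hy.1.le⟩
      rw [Real.sqrt_lt' one_pos]; simpa using hy.2
  rw [unif]
  conv_lhs => rw [← himg]
  rw [lintegral_image_eq_lintegral_abs_deriv_mul measurableSet_Ioo (f' := fun v => 2 * v)
    (fun s _ => by simpa using (hasDerivAt_pow 2 s).hasDerivWithinAt)
    (fun s hs s' hs' h => (pow_left_inj₀ hs.1.le hs'.1.le two_ne_zero).1 h)]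
  refine setLIntegral_congr_fun measurableSet_Ioo fun v hv => ?_
  rw [abs_of_pos (by linarith [hv.1]), Real.sqrt_sq hv.1.le]

/-! ### The first jump under a stationary law -/

/-- Up to the factor `tailRate R π x`, the law of the first jump time of the process started at
`x`. -/
theorem IsStationary.map_survivorInv (hπ : IsStationary R π) (hR : IsRate R) (hRm : Measurable R)
    {x : ℝ≥0} (hx : 0 < x) :
    tailRate R π x • (unif.restrict {a | survivorInv R x a < ∞}).map
        (fun a => (survivorInv R x a).toReal)
      = (volume.restrict (Ioi 0)).withDensity fun s => ENNReal.ofReal (x * Real.exp s) *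
          (ENNReal.ofReal (R (x * Real.exp s)) * tailRate R π (x * Real.exp s)) := by
  have hx' : (0 : ℝ) < x := hx
  have hm : Measurable fun a : ℝ => survivorInv R x a :=
    hR.measurable_survivorInv.comp (f := fun a : ℝ => (x, a)) (by fun_prop)
  have hA : MeasurableSet {a : ℝ | survivorInv R x a < ∞} := hm measurableSet_Iio
  have hk := (hπ.tailRate_lt_top hx').ne
  have : IsFiniteMeasure (tailRate R π x • (unif.restrict {a | survivorInv R x a < ∞}).map
        (fun a => (survivorInv R x a).toReal)) := Measure.smul_finite _ hk
  refine Measure.ext_of_Iic _ _ fun a => ?_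
  rw [Measure.smul_apply, smul_eq_mul, Measure.map_apply hm.ennreal_toReal measurableSet_Iic,
    Measure.restrict_apply (hm.ennreal_toReal measurableSet_Iic),
    withDensity_apply _ measurableSet_Iic, Measure.restrict_restrict measurableSet_Iic]
  rcases lt_or_ge a 0 with ha | ha
  · have h1 : (fun a : ℝ => (survivorInv R x a).toReal) ⁻¹' Iic a = ∅ := by
      ext y
      simp only [mem_preimage, mem_Iic, mem_empty_iff_false, iff_false, not_le]
      exact ha.trans_le ENNReal.toReal_nonneg
    have h2 : Iic a ∩ Ioi 0 = ∅ := by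
      ext y
      simp only [mem_inter_iff, mem_Iic, mem_Ioi, mem_empty_iff_false, iff_false]
      intro h; linarith
    simp [h1, h2]
  · lift a to ℝ≥0 using ha
    have h1 : (fun a : ℝ => (survivorInv R x a).toReal) ⁻¹' Iic a
        ∩ {a | survivorInv R x a < ∞} = Ici (survivor R x a) := by
      ext y
      rw [mem_Ici, ← hR.survivorInv_le_iff hx'.le]
      simp only [mem_inter_iff, mem_preimage, mem_Iic, mem_ofPred_eq]
      constructor
      · rintro ⟨h, h'⟩
        exact (ENNReal.toReal_le_toReal h'.ne ENNReal.coe_ne_top).1 (by simpa using h)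
      · intro h
        exact ⟨ENNReal.toReal_le_coe_of_le_coe h, h.trans_lt ENNReal.coe_lt_top⟩
    have h2 : Iic (a : ℝ) ∩ Ioi 0 = Ioc 0 (a : ℝ) := by
      rw [inter_comm]; exact Ioi_inter_Iic
    have hS := hR.survivor_mem_Ioc x a
    rw [h1, h2, unif_Ici hS.1.le, ← lintegral_image_mul_exp hx' measurableSet_Ioc
      (fun z => ENNReal.ofReal (R z) * tailRate R π z), image_mul_exp_Ioc hx']
    -- On `Iic a` the claim reads `k x * (1 - S_x(a)) = ∫ R k` over `(x, x * exp a]`, with `k =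
    -- tailRate R π`. The right side is `k x - k (x * exp a)`, and the last term is `k x * S_x(a)`.
    have h3 := hπ.tailRate_eq_add hRm hx'.le
      (le_mul_of_one_le_right hx'.le (Real.one_le_exp a.coe_nonneg))
    rw [hπ.tailRate_mul_exp hR hRm hx' a.coe_nonneg] at h3
    refine (ENNReal.add_left_inj (ENNReal.mul_ne_top hk ENNReal.ofReal_ne_top)).1
      (Eq.trans ?_ h3)
    rw [← mul_add, ← ENNReal.ofReal_add (sub_nonneg.2 hS.2) hS.1.le, sub_add_cancel,
      ENNReal.ofReal_one, mul_one]

theorem lintegral_seqLaw_two {F : ℝ × ℝ → ℝ≥0∞} (hF : Measurable F) :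
    ∫⁻ u, F (u 0, u 1) ∂seqLaw = ∫⁻ a, ∫⁻ b, F (a, b) ∂unif ∂unif := by
  have e0 := measurable_pi_apply (X := fun _ : ℕ => ℝ) 0
  rw [lintegral_catSeq 1 (G := fun u => F (u 0, u 1)) (by fun_prop), ← map_eval_seqLaw 0,
    lintegral_map (f := fun a => ∫⁻ b, F (a, b) ∂(seqLaw.map fun u : ℕ → ℝ => u 0)) ?_ e0]
  · refine lintegral_congr fun u => ?_
    rw [lintegral_map (f := fun b => F (u 0, b)) (by fun_prop) e0]
    rfl
  · rw [map_eval_seqLaw 0]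
    exact hF.lintegral_prod_right'

/-- Exchange of the order of integration in `∫ R(z) k(z) ∫_0^z g(w) dw dz`, for the tail integral
`k(w) = ∫_w^∞ R(z) k(z) dz`. -/
theorem IsStationary.lintegral_rate_mul (hπ : IsStationary R π) (hRm : Measurable R)
    {g : ℝ → ℝ≥0∞} (hg : Measurable g) :
    ∫⁻ z in Ioi (0 : ℝ), ENNReal.ofReal (R z) * tailRate R π z * ∫⁻ w in Ioo 0 z, g w
      = ∫⁻ w in Ioi (0 : ℝ), tailRate R π w * g w := by
  have hk := measurable_tailRate R π
  have hG : ∀ z ∈ Ioi (0 : ℝ), ENNReal.ofReal (R z) * tailRate R π z * ∫⁻ w in Ioo 0 z, g w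
      = ∫⁻ w in Ioi 0, (Ioi w).indicator
        (fun z => ENNReal.ofReal (R z) * tailRate R π z) z * g w := by
    intro z _
    rw [← lintegral_const_mul _ hg, ← Ioi_inter_Iio,
      inter_comm, ← Measure.restrict_restrict measurableSet_Iio,
      ← lintegral_indicator measurableSet_Iio]
    refine lintegral_congr fun w => ?_
    by_cases hw : w < z
    · rw [indicator_of_mem (s := Iio z) hw, indicator_of_mem (s := Ioi w) hw]
    · rw [indicator_of_notMem (s := Iio z) hw, indicator_of_notMem (s := Ioi w) hw, zero_mul]
  have hind : Measurable fun p : ℝ × ℝ => (Ioi p.2).indicator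
      (fun z => ENNReal.ofReal (R z) * tailRate R π z) p.1 := by
    have hset : MeasurableSet {p : ℝ × ℝ | p.2 < p.1} := measurableSet_lt measurable_snd measurable_fst
    exact (Measurable.indicator (f := fun p : ℝ × ℝ => ENNReal.ofReal (R p.1) * tailRate R π p.1)
      (by fun_prop) hset)
  rw [setLIntegral_congr_fun measurableSet_Ioi hG, lintegral_lintegral_swap
    (Measurable.aemeasurable (hind.mul (by fun_prop)))]
  refine setLIntegral_congr_fun measurableSet_Ioi fun w hw => ?_
  have hw0 : (0 : ℝ) < w := hw
  rw [lintegral_mul_const _ (Measurable.indicator (by fun_prop) measurableSet_Ioi),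
    lintegral_indicator measurableSet_Ioi, Measure.restrict_restrict measurableSet_Ioi,
    inter_eq_left.2 (show Ioi w ⊆ Ioi 0 from fun z hz => hw0.trans hz),
    ← hπ.tailRate_eq hRm hw0.le]

/-- Under a stationary law, the first jump time `τ_1` and the position after it have a product law:
the jump occurs at rate `2 e^{-2s} ds`, and the position after the jump is again stationary. -/
theorem IsStationary.lintegral_first_jump (hπ : IsStationary R π) (hR : IsRate R)
    (hRm : Measurable R) {ψ : ℝ × ℝ≥0 → ℝ≥0∞} (hψ : Measurable ψ) :
    ∫⁻ x, ∫⁻ u, {u | jumpTime R x u 1 < ∞}.indicator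
        (fun u => ψ ((jumpTime R x u 1).toReal, posAfter R x u 1)) u ∂seqLaw ∂π
      = ∫⁻ s in Ioi 0, ENNReal.ofReal (2 * Real.exp (-2 * s)) * ∫⁻ y, ψ (s, y) ∂π := by
  -- The mean of `ψ (s, ·)` after a jump at time `s = p.1` from the position `p.2`; the jump factor
  -- has density `2v`.
  set H : ℝ × ℝ → ℝ≥0∞ := fun p =>
    ∫⁻ v in Ioo (0 : ℝ) 1, ENNReal.ofReal (2 * v) * ψ (p.1, (p.2 * v).toNNReal) with hHdef
  have hH : Measurable H := by
    refine Measurable.lintegral_prod_right' (ν := volume.restrict (Ioo (0 : ℝ) 1))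
      (f := fun q : (ℝ × ℝ) × ℝ => ENNReal.ofReal (2 * q.2) * ψ (q.1.1, (q.1.2 * q.2).toNNReal)) ?_
    fun_prop
  have hk := measurable_tailRate R π
  -- the inner integral
  have hin : ∀ x : ℝ≥0, ∫⁻ u, {u | jumpTime R x u 1 < ∞}.indicator
        (fun u => ψ ((jumpTime R x u 1).toReal, posAfter R x u 1)) u ∂seqLaw
      = ∫⁻ a in {a | survivorInv R x a < ∞}, H ((survivorInv R x a).toReal,
          x * Real.exp (survivorInv R x a).toReal) ∂unif := by
    intro x
    have hm : Measurable fun a : ℝ => survivorInv R x a :=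
      hR.measurable_survivorInv.comp (f := fun a : ℝ => (x, a)) (by fun_prop)
    have hA : MeasurableSet {a : ℝ | survivorInv R x a < ∞} := hm measurableSet_Iio
    have hA' : MeasurableSet {p : ℝ × ℝ | survivorInv R x p.1 < ∞} :=
      (hm.comp measurable_fst) measurableSet_Iio
    have h1 := lintegral_seqLaw_two (F := {p : ℝ × ℝ | survivorInv R x p.1 < ∞}.indicator
      fun p => ψ ((survivorInv R x p.1).toReal,
        (x * Real.exp (survivorInv R x p.1).toReal * √p.2).toNNReal))
      (Measurable.indicator (by fun_prop) hA')
    rw [← lintegral_indicator hA]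
    refine Eq.trans (lintegral_congr fun u => ?_) (h1.trans (lintegral_congr fun a => ?_))
    · simp only [indicator, mem_ofPred_eq, IsRate.jumpTime_one]
      split_ifs
      · congr 2
        refine NNReal.eq ?_
        rw [coe_posAfter, Real.coe_toNNReal _ (by positivity), IsRate.jumpTime_one]
        simp [factorProd]
      · rfl
    · by_cases ha : survivorInv R x a < ∞
      · rw [indicator_of_mem (s := {a : ℝ | survivorInv R x a < ∞}) ha]
        simp only [indicator, mem_ofPred_eq, ha, if_true]
        rw [lintegral_sqrt_unif fun b => ψ ((survivorInv R x a).toReal,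
          (x * Real.exp (survivorInv R x a).toReal * b).toNNReal)]
      · rw [indicator_of_notMem (s := {a : ℝ | survivorInv R x a < ∞}) ha]
        simp [indicator, ha]
  simp only [hin]
  have hmeas : Measurable fun x : ℝ≥0 => ∫⁻ a in {a | survivorInv R x a < ∞},
      H ((survivorInv R x a).toReal, x * Real.exp (survivorInv R x a).toReal) ∂unif := by
    have hs := hR.measurable_survivorInv
    have hB : MeasurableSet {p : ℝ≥0 × ℝ | survivorInv R p.1 p.2 < ∞} := hs measurableSet_Iio
    have : Measurable ({p : ℝ≥0 × ℝ | survivorInv R p.1 p.2 < ∞}.indicator fun p =>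
      H ((survivorInv R p.1 p.2).toReal, p.1 * Real.exp (survivorInv R p.1 p.2).toReal)) :=
      Measurable.indicator (by fun_prop) hB
    convert! this.lintegral_prod_right' (ν := unif) using 2 with x
    have hm : Measurable fun a : ℝ => survivorInv R x a :=
      hR.measurable_survivorInv.comp (f := fun a : ℝ => (x, a)) (by fun_prop)
    have hA : MeasurableSet {a : ℝ | survivorInv R x a < ∞} := hm measurableSet_Iio
    rw [← lintegral_indicator hA]
    rfl
  rw [hπ.lintegral_eq hmeas]
  -- insert the law of the jump time
  have hstep : ∀ x : ℝ, x ∈ Ioi (0 : ℝ) → ENNReal.ofReal x * tailRate R π x *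
      ∫⁻ a in {a | survivorInv R (x.toNNReal : ℝ≥0) a < ∞},
        H ((survivorInv R (x.toNNReal : ℝ≥0) a).toReal,
          (x.toNNReal : ℝ≥0) * Real.exp (survivorInv R (x.toNNReal : ℝ≥0) a).toReal) ∂unif
      = ∫⁻ s in Ioi 0, ENNReal.ofReal x * (ENNReal.ofReal (x * Real.exp s) *
          (ENNReal.ofReal (R (x * Real.exp s)) * tailRate R π (x * Real.exp s))
            * H (s, x * Real.exp s)) := by
    intro x hx
    lift x to ℝ≥0 using (le_of_lt hx)
    have hx0 : 0 < x := hx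
    have hm : Measurable fun a : ℝ => survivorInv R x a :=
      hR.measurable_survivorInv.comp (f := fun a : ℝ => (x, a)) (by fun_prop)
    have h := congrArg (fun μ => ∫⁻ s, H (s, x * Real.exp s) ∂μ)
      (hπ.map_survivorInv hR hRm hx0)
    simp only [lintegral_smul_measure] at h
    rw [lintegral_map (f := fun s => H (s, x * Real.exp s)) (by fun_prop) hm.ennreal_toReal,
      lintegral_withDensity_eq_lintegral_mul _ (by fun_prop)
        (g := fun s => H (s, x * Real.exp s)) (by fun_prop)] at h
    rw [Real.toNNReal_coe, mul_assoc, ← smul_eq_mul (tailRate R π x), h,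
      lintegral_const_mul' _ _ ENNReal.ofReal_ne_top]
    rfl
  rw [setLIntegral_congr_fun measurableSet_Ioi hstep, lintegral_lintegral_swap (by fun_prop)]
  refine setLIntegral_congr_fun measurableSet_Ioi fun s _ => ?_
  -- substitute `z = x * exp s`
  have hes := Real.exp_pos s
  set G : ℝ → ℝ≥0∞ := fun z => ENNReal.ofReal (z ^ 2) *
    ((ENNReal.ofReal (R z) * tailRate R π z) * H (s, z)) with hGdef
  -- The density contributes `x`, the waiting time `x * exp s`; together with `dx` this is `exp
  -- (-2s) z² dz`, whence the exponential law with rate `2`, whatever `R` is.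
  have hsub : ∫⁻ x in Ioi (0 : ℝ), ENNReal.ofReal x * (ENNReal.ofReal (x * Real.exp s) *
          (ENNReal.ofReal (R (x * Real.exp s)) * tailRate R π (x * Real.exp s))
            * H (s, x * Real.exp s))
      = ENNReal.ofReal (Real.exp (-2 * s)) * ∫⁻ z in Ioi 0, G z := by
    rw [← lintegral_comp_mul_left_Ioi hes G, ← mul_assoc, ← ENNReal.ofReal_mul (by positivity),
      ← lintegral_const_mul' _ _ ENNReal.ofReal_ne_top]
    refine setLIntegral_congr_fun measurableSet_Ioi fun x hx => ?_
    have hx0 : (0 : ℝ) < x := hx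
    simp only [hGdef]
    rw [mul_comm (Real.exp s) x]
    have h : ENNReal.ofReal x * ENNReal.ofReal (x * Real.exp s)
        = ENNReal.ofReal (Real.exp (-2 * s) * Real.exp s)
          * ENNReal.ofReal ((x * Real.exp s) ^ 2) := by
      rw [← ENNReal.ofReal_mul hx0.le, ← ENNReal.ofReal_mul (by positivity)]
      congr 1
      rw [show -2 * s = -s + -s by ring, Real.exp_add, Real.exp_neg]
      field_simp
    rw [mul_assoc (ENNReal.ofReal (x * Real.exp s)), ← mul_assoc (ENNReal.ofReal x), h, mul_assoc]
  rw [hsub, ENNReal.ofReal_mul two_pos.le, mul_comm (ENNReal.ofReal 2), mul_assoc]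
  congr 1
  -- Fubini
  have hψs : Measurable fun y : ℝ≥0 => ψ (s, y) := by fun_prop
  rw [hπ.lintegral_eq hψs, ← lintegral_const_mul' _ _ ENNReal.ofReal_ne_top]
  -- One factor `z` of `z²` is the Jacobian of `w = z * v`, the other one turns `2v` into `2w`. The
  -- exchange of integrals then restores the density `w * tailRate R π w`.
  have hG : ∀ z ∈ Ioi (0 : ℝ), G z = ENNReal.ofReal (R z) * tailRate R π z *
      ∫⁻ w in Ioo 0 z, ENNReal.ofReal (2 * w) * ψ (s, w.toNNReal) := by
    intro z hz
    have hz0 : (0 : ℝ) < z := hz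
    rw [hGdef, ← lintegral_comp_mul_left_Ioo hz0]
    simp only
    rw [pow_two, ENNReal.ofReal_mul hz0.le, hHdef, mul_left_comm, mul_assoc (ENNReal.ofReal z)]
    simp only
    rw [← lintegral_const_mul' (ENNReal.ofReal z) _ ENNReal.ofReal_ne_top]
    congr 2
    refine setLIntegral_congr_fun measurableSet_Ioo fun v _ => ?_
    rw [← mul_assoc, ← ENNReal.ofReal_mul hz0.le]
    congr 2; ring
  rw [setLIntegral_congr_fun measurableSet_Ioi hG, hπ.lintegral_rate_mul hRm (by fun_prop)]
  refine setLIntegral_congr_fun measurableSet_Ioi fun w _ => ?_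
  rw [ENNReal.ofReal_mul two_pos.le]
  ring

/-- Under a stationary law, jumps occur at the mean rate `2`. -/
theorem IsStationary.lintegral_rate (hπ : IsStationary R π) (hRm : Measurable R) :
    ∫⁻ x : ℝ≥0, ENNReal.ofReal (x * R x) ∂π = 2 := by
  have := hπ.isProbabilityMeasure
  rw [hπ.lintegral_eq (by fun_prop)]
  -- With `g w = 2w` the inner integral is `z²`, so one side is the integral of `z * R z` against
  -- `π`, and the other is twice the total mass.
  have h := hπ.lintegral_rate_mul hRm (g := fun w => ENNReal.ofReal (2 * w)) (by fun_prop)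
  have h1 : ∫⁻ w in Ioi (0 : ℝ), tailRate R π w * ENNReal.ofReal (2 * w) = 2 := by
    have h2 := hπ.lintegral_eq (F := fun _ => 2) measurable_const
    rw [lintegral_const, measure_univ, mul_one] at h2
    rw [h2]
    refine setLIntegral_congr_fun measurableSet_Ioi fun w _ => ?_
    rw [ENNReal.ofReal_mul two_pos.le, ENNReal.ofReal_ofNat]
    ring
  rw [← h1, ← h]
  refine setLIntegral_congr_fun measurableSet_Ioi fun z hz => ?_
  have hz0 : (0 : ℝ) < z := hz
  have h3 := lintegral_comp_mul_left_Ioo hz0 (fun w => ENNReal.ofReal (2 * w))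
  have h4 : ∫⁻ v in Ioo (0 : ℝ) 1, ENNReal.ofReal (2 * (z * v)) = ENNReal.ofReal z := by
    have h5 := lintegral_sqrt_unif fun _ => ENNReal.ofReal z
    rw [lintegral_const, measure_univ, mul_one] at h5
    rw [h5]
    refine setLIntegral_congr_fun measurableSet_Ioo fun v hv => ?_
    have := hv.1
    rw [← ENNReal.ofReal_mul (by positivity)]
    congr 1; ring
  rw [h4] at h3
  rw [← h3, Real.coe_toNNReal _ hz0.le, ENNReal.ofReal_mul hz0.le]
  ring

/-! ### The renewal structure and invariance -/

theorem IsRate.measurable_jumpTime_left (hR : IsRate R) (x : ℝ≥0) (k : ℕ) :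
    Measurable fun u : ℕ → ℝ => jumpTime R x u k :=
  (hR.measurable_jumpTime k).comp (f := fun u : ℕ → ℝ => (x, u)) (by fun_prop)

theorem IsRate.measurable_posAfter (hR : IsRate R) (k : ℕ) :
    Measurable fun p : ℝ≥0 × (ℕ → ℝ) => posAfter R p.1 p.2 k := by
  have h := hR.measurable_jumpTime k
  have h' := measurable_factorProd k
  unfold posAfter
  fun_prop

theorem IsRate.measurable_posAfter_left (hR : IsRate R) (x : ℝ≥0) (k : ℕ) :
    Measurable fun u : ℕ → ℝ => posAfter R x u k :=
  (hR.measurable_posAfter k).comp (f := fun u : ℕ → ℝ => (x, u)) (by fun_prop)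

/-- The contribution of the paths that have jumped by time `t`: such a path restarts from the
position after its first jump. -/
theorem IsRate.lintegral_jumped (hR : IsRate R) (x t : ℝ≥0) {Φ : ℝ≥0 × ℝ≥0 → ℝ≥0∞}
    (hΦ : Measurable Φ) :
    ∫⁻ u, {u | jumpTime R x u 1 ≤ t}.indicator
        (fun u => Φ (posAfter R x u 1, cellProcess R x u t)) u ∂seqLaw
      = ∫⁻ u, {u | jumpTime R x u 1 < ∞}.indicator (fun u =>
          (Iic (t : ℝ)).indicator (fun s => ∫⁻ v, Φ (posAfter R x u 1,
            cellProcess R (posAfter R x u 1) v (t - s.toNNReal)) ∂seqLaw)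
          (jumpTime R x u 1).toReal) u ∂seqLaw := by
  have hJ := hR.measurable_jumpTime_left x 1
  have hset : MeasurableSet {u : ℕ → ℝ | jumpTime R x u 1 ≤ t} := hJ measurableSet_Iic
  have hY := hR.measurable_posAfter_left x 1
  have hX := hR.measurable_cellProcess x t
  -- The first two entries determine the first jump and the position after it; all later ones are
  -- resampled and drive the restarted path.
  rw [lintegral_catSeq 2 (Measurable.indicator (by fun_prop) hset)]
  refine lintegral_congr fun u => ?_
  have h1 : ∀ v, jumpTime R x (catSeq 2 u v) 1 = jumpTime R x u 1 := fun v =>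
    (jumpTime_catSeq (R := R) x u v 1).1
  have h2 : ∀ v, posAfter R x (catSeq 2 u v) 1 = posAfter R x u 1 := fun v =>
    posAfter_catSeq (R := R) x u v 1
  by_cases h : jumpTime R x u 1 ≤ t
  · have hlt : jumpTime R x u 1 < ∞ := h.trans_lt ENNReal.coe_lt_top
    lift jumpTime R x u 1 to ℝ≥0 using hlt.ne with a ha
    have hat : a ≤ t := by exact_mod_cast h
    have hind : ∀ v, catSeq 2 u v ∈ {u | jumpTime R x u 1 ≤ t} := fun v => by
      rw [mem_ofPred_eq, h1]; exact h
    rw [indicator_of_mem (s := {u | jumpTime R x u 1 < ∞}) (by rw [mem_ofPred_eq, ← ha]; exact hlt),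
      ← ha, ENNReal.coe_toReal, indicator_of_mem (s := Iic (t : ℝ)) (by exact_mod_cast hat),
      Real.toNNReal_coe]
    refine lintegral_congr fun v => ?_
    rw [indicator_of_mem (hind v), h2]
    have := cellProcess_restart (R := R) (x := x) (u := catSeq 2 u v) (k := 1) (a := a)
      (by rw [h1]) (t - a)
    rw [add_tsub_cancel_of_le hat, h2, mul_one, shiftSeq_catSeq] at this
    rw [this]
  · have hL : ∀ v, catSeq 2 u v ∉ {u | jumpTime R x u 1 ≤ t} := fun v => by
      rw [mem_ofPred_eq, h1]; exact h
    rw [lintegral_congr fun v => indicator_of_notMem (hL v) _, lintegral_zero]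
    by_cases hlt : jumpTime R x u 1 < ∞
    · rw [indicator_of_mem (s := {u | jumpTime R x u 1 < ∞}) hlt, indicator_of_notMem]
      rw [mem_Iic, not_le]
      have := ENNReal.toReal_strict_mono hlt.ne (not_le.1 h)
      simpa using this
    · rw [indicator_of_notMem (s := {u | jumpTime R x u 1 < ∞}) hlt]

theorem IsRate.measurable_lintegral_cellProcess (hR : IsRate R) {Φ : ℝ≥0 × ℝ≥0 → ℝ≥0∞}
    (hΦ : Measurable Φ) :
    Measurable fun p : ℝ≥0 × ℝ≥0 => ∫⁻ v, Φ (p.2, cellProcess R p.2 v p.1) ∂seqLaw := by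
  have h : Measurable fun q : (ℝ≥0 × ℝ≥0) × (ℕ → ℝ) => cellProcess R q.1.2 q.2 q.1.1 :=
    hR.measurable_cellProcess_uncurry.comp
      (f := fun q : (ℝ≥0 × ℝ≥0) × (ℕ → ℝ) => (q.1.2, q.2, q.1.1)) (by fun_prop)
  exact Measurable.lintegral_prod_right' (ν := seqLaw)
    (f := fun q : (ℝ≥0 × ℝ≥0) × (ℕ → ℝ) => Φ (q.1.2, cellProcess R q.1.2 q.2 q.1.1))
    (by fun_prop)

/-- The restart at the first jump combined with `lintegral_first_jump`: the jump time is exponential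
with rate `2` and independent of the new starting point, which has law `π`. Keeping that point as an
argument of `Φ` allows a comparison with it in the proof of the generator formula. -/
theorem IsStationary.lintegral_jumped (hπ : IsStationary R π) (hR : IsRate R)
    (hRm : Measurable R) (t : ℝ≥0) {Φ : ℝ≥0 × ℝ≥0 → ℝ≥0∞} (hΦ : Measurable Φ) :
    ∫⁻ x, ∫⁻ u, {u | jumpTime R x u 1 ≤ t}.indicator
        (fun u => Φ (posAfter R x u 1, cellProcess R x u t)) u ∂seqLaw ∂π
      = ∫⁻ s in Ioc (0 : ℝ) t, ENNReal.ofReal (2 * Real.exp (-2 * s)) *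
          ∫⁻ y, ∫⁻ v, Φ (y, cellProcess R y v (t - s.toNNReal)) ∂seqLaw ∂π := by
  simp only [hR.lintegral_jumped _ t hΦ]
  have hm := hR.measurable_lintegral_cellProcess hΦ
  have hψ : Measurable ((Iic (t : ℝ) ×ˢ (univ : Set ℝ≥0)).indicator fun p : ℝ × ℝ≥0 =>
      ∫⁻ v, Φ (p.2, cellProcess R p.2 v (t - p.1.toNNReal)) ∂seqLaw) :=
    Measurable.indicator (hm.comp (f := fun p : ℝ × ℝ≥0 => (t - p.1.toNNReal, p.2))
      (by fun_prop)) (measurableSet_Iic.prod .univ)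
  have hind : ∀ (s : ℝ) (y : ℝ≥0), (Iic (t : ℝ) ×ˢ (univ : Set ℝ≥0)).indicator
      (fun p : ℝ × ℝ≥0 => ∫⁻ v, Φ (p.2, cellProcess R p.2 v (t - p.1.toNNReal)) ∂seqLaw) (s, y)
      = (Iic (t : ℝ)).indicator (fun s => ∫⁻ v, Φ (y, cellProcess R y v (t - s.toNNReal)) ∂seqLaw)
        s := fun s y => by simp [indicator]
  have := hπ.lintegral_first_jump hR hRm hψ
  simp only [hind] at this
  rw [this, ← Ioi_inter_Iic, inter_comm, ← Measure.restrict_restrict measurableSet_Iic,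
    ← lintegral_indicator measurableSet_Iic]
  refine lintegral_congr fun s => ?_
  by_cases hs : s ∈ Iic (t : ℝ)
  · simp only [indicator_of_mem hs]
  · simp only [indicator_of_notMem hs, lintegral_zero, mul_zero]

/-- The contribution of the paths that have not jumped by time `t`. -/
theorem IsStationary.lintegral_not_jumped (hπ : IsStationary R π) (hR : IsRate R)
    (hRm : Measurable R) (t : ℝ≥0) {φ : ℝ≥0 → ℝ≥0∞} (hφ : Measurable φ) :
    ∫⁻ x, ∫⁻ u, {u | jumpTime R x u 1 ≤ t}ᶜ.indicator (fun u => φ (cellProcess R x u t)) u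
        ∂seqLaw ∂π
      = ENNReal.ofReal (Real.exp (-2 * t)) * ∫⁻ x, φ x ∂π := by
  have hin : ∀ x : ℝ≥0, ∫⁻ u, {u | jumpTime R x u 1 ≤ t}ᶜ.indicator
      (fun u => φ (cellProcess R x u t)) u ∂seqLaw
      = ENNReal.ofReal (survivor R x t) * φ (x * (Real.exp t).toNNReal) := by
    intro x
    obtain ⟨hc, hc1⟩ := hR.survivor_mem_Ioc x t
    have hset : {u | jumpTime R x u 1 ≤ t}ᶜ = {u : ℕ → ℝ | u 0 < survivor R x t} := by
      ext u
      rw [mem_compl_iff, mem_ofPred_eq, not_le, mem_ofPred_eq, hR.lt_jumpTime_one_iff]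
    have hms : MeasurableSet {u : ℕ → ℝ | u 0 < survivor R x t} :=
      measurableSet_lt (measurable_pi_apply 0) measurable_const
    rw [hset, lintegral_indicator hms, ← seqLaw_lt hc hc1, mul_comm, ← setLIntegral_const]
    refine setLIntegral_congr_fun hms fun u hu => ?_
    have := hR.cellProcess_of_lt (x := x) (u := u) (k := 0) (a := 0) (r := t)
      (by simp) (by simpa [posAfter, factorProd] using hu)
    rw [zero_add] at this
    rw [this]
    simp [posAfter, factorProd]
  simp only [hin]
  have hk := measurable_tailRate R π
  have hSm : Measurable fun x : ℝ≥0 => survivor R x t :=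
    hR.measurable_survivor.comp (f := fun x : ℝ≥0 => (x, (t : ℝ))) (by fun_prop)
  have het := Real.exp_pos (t : ℝ)
  -- In the variable `y = x * exp t` the survival probability is absorbed by `tailRate_mul_exp`; the
  -- factor `y` of the density and `dy` each contribute `exp t`, which together leave `exp (-2t)`.
  rw [hπ.lintegral_eq (by fun_prop), hπ.lintegral_eq hφ,
    ← lintegral_comp_mul_left_Ioi het (fun y => ENNReal.ofReal y * tailRate R π y * φ y.toNNReal),
    ← mul_assoc, ← ENNReal.ofReal_mul (by positivity),
    ← lintegral_const_mul' _ _ ENNReal.ofReal_ne_top]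
  refine setLIntegral_congr_fun measurableSet_Ioi fun x hx => ?_
  have hx0 : (0 : ℝ) < x := hx
  rw [mul_comm (Real.exp t) x, hπ.tailRate_mul_exp hR hRm hx0 t.coe_nonneg,
    Real.coe_toNNReal _ hx0.le, Real.toNNReal_mul hx0.le]
  have h : ENNReal.ofReal (Real.exp (-2 * t) * Real.exp t) * ENNReal.ofReal (x * Real.exp t)
      = ENNReal.ofReal x := by
    rw [← ENNReal.ofReal_mul (by positivity)]
    congr 1
    rw [show -2 * (t : ℝ) = -t + -t by ring, Real.exp_add, Real.exp_neg]
    field_simp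
  rw [← h]
  ring

theorem lintegral_two_exp (t : ℝ≥0) :
    ∫⁻ s in Ioc (0 : ℝ) t, ENNReal.ofReal (2 * Real.exp (-2 * s))
      = ENNReal.ofReal (1 - Real.exp (-2 * t)) := by
  have hc : Continuous fun s : ℝ => 2 * Real.exp (-2 * s) := by fun_prop
  rw [← ofReal_integral_eq_lintegral_ofReal (hc.integrableOn_Ioc)
    (Eventually.of_forall fun s => by positivity), ← intervalIntegral.integral_of_le t.coe_nonneg]
  congr 1
  have hd : ∀ s ∈ uIcc (0 : ℝ) t,
      HasDerivAt (fun s : ℝ => -Real.exp (-2 * s)) (2 * Real.exp (-2 * s)) s := fun s _ => by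
    have := (((hasDerivAt_id s).const_mul (-2)).exp).neg
    convert! this using 1
    simp; ring
  rw [intervalIntegral.integral_eq_sub_of_hasDerivAt hd (hc.intervalIntegrable _ _)]
  simp; ring

/-- A lower bound for the law of the process at time `t`, from the renewal equation at the first
jump time. -/
theorem IsStationary.le_lintegral_cellProcess_pow (hπ : IsStationary R π) (hR : IsRate R)
    (hRm : Measurable R) (T : ℝ≥0) {φ : ℝ≥0 → ℝ≥0∞} (hφ : Measurable φ) (n : ℕ) :
    ∀ t ≤ T, ENNReal.ofReal (1 - (1 - Real.exp (-2 * T)) ^ n) * ∫⁻ x, φ x ∂π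
      ≤ ∫⁻ x, ∫⁻ u, φ (cellProcess R x u t) ∂seqLaw ∂π := by
  -- The probability of a first jump by time `T`. The bound is uniform in `t ≤ T` because the
  -- induction uses it at the shorter times `t - s`.
  set q : ℝ := 1 - Real.exp (-2 * T) with hq
  have hq0 : 0 ≤ q := sub_nonneg.2 (Real.exp_le_one_iff.2 (by have := T.coe_nonneg; linarith))
  have hq1 : q ≤ 1 := by rw [hq]; linarith [Real.exp_pos (-2 * (T : ℝ))]
  induction n with
  | zero => simp
  | succ n ih =>
    intro t ht
    have hsplit : ∫⁻ x, ∫⁻ u, φ (cellProcess R x u t) ∂seqLaw ∂π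
        = (∫⁻ x, ∫⁻ u, {u | jumpTime R x u 1 ≤ t}.indicator
            (fun u => φ (cellProcess R x u t)) u ∂seqLaw ∂π)
          + ∫⁻ x, ∫⁻ u, {u | jumpTime R x u 1 ≤ t}ᶜ.indicator
            (fun u => φ (cellProcess R x u t)) u ∂seqLaw ∂π := by
      have hX := hR.measurable_cellProcess_prod t
      have hJ : MeasurableSet {p : ℝ≥0 × (ℕ → ℝ) | jumpTime R p.1 p.2 1 ≤ t} :=
        hR.measurable_jumpTime 1 measurableSet_Iic
      have hm1 : Measurable fun x : ℝ≥0 => ∫⁻ u, {u | jumpTime R x u 1 ≤ t}.indicator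
          (fun u => φ (cellProcess R x u t)) u ∂seqLaw :=
        Measurable.lintegral_prod_right' (ν := seqLaw)
          (f := {p : ℝ≥0 × (ℕ → ℝ) | jumpTime R p.1 p.2 1 ≤ t}.indicator
            fun p => φ (cellProcess R p.1 p.2 t)) (Measurable.indicator (by fun_prop) hJ)
      rw [← lintegral_add_left hm1]
      refine lintegral_congr fun x => ?_
      have hset : MeasurableSet {u : ℕ → ℝ | jumpTime R x u 1 ≤ t} :=
        hR.measurable_jumpTime_left x 1 measurableSet_Iic
      rw [lintegral_indicator hset, lintegral_indicator hset.compl, lintegral_add_compl _ hset]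
    rw [hsplit, hπ.lintegral_not_jumped hR hRm t hφ,
      hπ.lintegral_jumped hR hRm t (Φ := fun p => φ p.2) (by fun_prop)]
    set a : ℝ := 1 - Real.exp (-2 * t) with ha
    have haq : a ≤ q := by
      rw [ha, hq]
      have : (t : ℝ) ≤ T := ht
      linarith [Real.exp_le_exp.2 (by linarith : -2 * (T : ℝ) ≤ -2 * t)]
    have ha0 : 0 ≤ a := sub_nonneg.2 (Real.exp_le_one_iff.2 (by have := t.coe_nonneg; linarith))
    have hqn : q ^ n ≤ 1 := pow_le_one₀ hq0 hq1
    -- A jump occurs by time `t` with probability `a ≤ q`; then the induction hypothesis retains the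
    -- share `1 - qⁿ`. Without a jump nothing is lost. In total, `1 - a qⁿ ≥ 1 - q^(n+1)`.
    calc ENNReal.ofReal (1 - q ^ (n + 1)) * ∫⁻ x, φ x ∂π
        ≤ ENNReal.ofReal (a * (1 - q ^ n) + (1 - a)) * ∫⁻ x, φ x ∂π := by
          gcongr
          rw [pow_succ]
          nlinarith [mul_le_mul_of_nonneg_left haq (pow_nonneg hq0 n)]
      _ = ENNReal.ofReal a * (ENNReal.ofReal (1 - q ^ n) * ∫⁻ x, φ x ∂π)
          + ENNReal.ofReal (Real.exp (-2 * t)) * ∫⁻ x, φ x ∂π := by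
          rw [ENNReal.ofReal_add (mul_nonneg ha0 (by linarith)) (by linarith),
            ENNReal.ofReal_mul ha0, add_mul, mul_assoc, ha, sub_sub_cancel]
      _ ≤ _ := by
          gcongr ?_ + _
          have hmeas : Measurable fun s : ℝ => ENNReal.ofReal (2 * Real.exp (-2 * s)) := by
            fun_prop
          rw [ha, ← lintegral_two_exp t, ← lintegral_mul_const _ hmeas]
          refine setLIntegral_mono' measurableSet_Ioc fun s _ => ?_
          gcongr
          exact ih _ (tsub_le_self.trans ht)

theorem IsStationary.le_lintegral_cellProcess (hπ : IsStationary R π) (hR : IsRate R)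
    (hRm : Measurable R) (t : ℝ≥0) {φ : ℝ≥0 → ℝ≥0∞} (hφ : Measurable φ) :
    ∫⁻ x, φ x ∂π ≤ ∫⁻ x, ∫⁻ u, φ (cellProcess R x u t) ∂seqLaw ∂π := by
  have hq0 : 0 ≤ 1 - Real.exp (-2 * (t : ℝ)) :=
    sub_nonneg.2 (Real.exp_le_one_iff.2 (by have := t.coe_nonneg; linarith))
  have hq1 : 1 - Real.exp (-2 * (t : ℝ)) < 1 := by linarith [Real.exp_pos (-2 * (t : ℝ))]
  have hlim : Tendsto (fun n : ℕ => ENNReal.ofReal (1 - (1 - Real.exp (-2 * (t : ℝ))) ^ n)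
      * ∫⁻ x, φ x ∂π) atTop (𝓝 (1 * ∫⁻ x, φ x ∂π)) := by
    refine ENNReal.Tendsto.mul_const ?_ (Or.inl one_ne_zero)
    have := (tendsto_pow_atTop_nhds_zero_of_lt_one hq0 hq1).const_sub 1
    rw [sub_zero] at this
    simpa using ENNReal.tendsto_ofReal this
  rw [one_mul] at hlim
  exact le_of_tendsto' hlim fun n => hπ.le_lintegral_cellProcess_pow hR hRm t hφ n t le_rfl

/-- A probability measure that dominates another one equals it, so the lower bound suffices; in
particular no mass is lost to the absorbing point. -/
theorem IsStationary.map_cellProcess (hπ : IsStationary R π) (hR : IsRate R) (hRm : Measurable R)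
    (t : ℝ≥0) :
    (π.prod seqLaw).map (fun p => cellProcess R p.1 p.2 t) = π := by
  have := hπ.isProbabilityMeasure
  have hX := hR.measurable_cellProcess_prod t
  have : IsProbabilityMeasure ((π.prod seqLaw).map (fun p => cellProcess R p.1 p.2 t)) :=
    Measure.isProbabilityMeasure_map hX.aemeasurable
  refine (Measure.eq_of_le_of_isProbabilityMeasure (Measure.le_iff.2 fun A hA => ?_)).symm
  have h := hπ.le_lintegral_cellProcess hR hRm t (φ := A.indicator 1) (measurable_one.indicator hA)
  rw [lintegral_indicator_one hA] at h
  refine h.trans (le_of_eq ?_)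
  rw [Measure.map_apply hX hA, ← lintegral_indicator_one (hX hA), lintegral_prod _
    (measurable_one.indicator (hX hA)).aemeasurable]
  rfl

/-- A stationary solution is an invariant law of the cell process. -/
theorem IsStationary.integral_cellOp (hπ : IsStationary R π) (hR : IsRate R) (hRm : Measurable R)
    (t : ℝ≥0) {f : ℝ≥0 → ℝ} (hf : IsBoundedBorel f) :
    ∫ x, cellOp R t f x ∂π = ∫ x, f x ∂π := by
  have := hπ.isProbabilityMeasure
  have hX := hR.measurable_cellProcess_prod t
  obtain ⟨hfm, C, hC⟩ := hf
  conv_rhs => rw [← hπ.map_cellProcess hR hRm t]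
  rw [integral_map hX.aemeasurable hfm.aestronglyMeasurable,
    integral_prod (fun p : ℝ≥0 × (ℕ → ℝ) => f (cellProcess R p.1 p.2 t))
      (Integrable.of_bound (hfm.comp hX).aestronglyMeasurable C
        (Eventually.of_forall fun p => hC _))]
  rfl

/-! ### Continuity of translations and dilations in `L¹` -/

/-- Translations are continuous in `L¹`. -/
theorem tendsto_lintegral_translate {V : ℝ → ℝ} (hV : Integrable V) :
    Tendsto (fun s : ℝ => ∫⁻ y, ‖V (y + s) - V y‖ₑ) (𝓝 0) (𝓝 0) := by
  have hVp : MemLp V 1 volume := memLp_one_iff_integrable.2 hV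
  set g : ℝ → C(ℝ, ℝ) := fun s => ⟨fun y => y + s, by fun_prop⟩ with hg
  have hgm : ∀ s, MeasurePreserving (g s) volume volume := fun s =>
    measurePreserving_add_right volume s
  have hgc : Continuous g :=
    (ContinuousMap.curry ⟨fun p : ℝ × ℝ => p.2 + p.1, by fun_prop⟩).continuous
  have h := Filter.Tendsto.compMeasurePreservingLp (l := 𝓝 (0 : ℝ)) (p := 1)
    (tendsto_const_nhds (x := hVp.toLp V)) (hgc.tendsto 0) hgm (hgm 0) ENNReal.one_ne_top
  have h2 := (tendsto_iff_edist_tendsto_0.1 h)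
  refine h2.congr fun s => ?_
  rw [Lp.toLp_compMeasurePreserving hVp, Lp.toLp_compMeasurePreserving hVp, Lp.edist_toLp_toLp,
    eLpNorm_one_eq_lintegral_enorm]
  simp [hg]

/-- Dilations are continuous in `L¹(x dx)`. -/
theorem tendsto_lintegral_dilate {W : ℝ → ℝ} (hW : Measurable W)
    (hint : ∫⁻ x in Ioi (0 : ℝ), ENNReal.ofReal x * ‖W x‖ₑ < ∞) :
    Tendsto (fun s : ℝ => ∫⁻ x in Ioi (0 : ℝ), ENNReal.ofReal x * ‖W (x * Real.exp s) - W x‖ₑ)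
      (𝓝 0) (𝓝 0) := by
  -- In the logarithmic variable dilations become translations; since `x dx = exp (2y) dy`, the
  -- weight goes into `V`.
  set V : ℝ → ℝ := fun y => Real.exp (2 * y) * W (Real.exp y) with hVdef
  have himg : (fun s : ℝ => 1 * Real.exp s) '' univ = Ioi 0 := by
    simp [Real.range_exp]
  have hsub : ∀ G : ℝ → ℝ, ∫⁻ x in Ioi (0 : ℝ), ENNReal.ofReal x * ‖G x‖ₑ
      = ∫⁻ y, ‖Real.exp (2 * y) * G (Real.exp y)‖ₑ := by
    intro G
    rw [← himg, lintegral_image_mul_exp one_pos .univ, setLIntegral_univ]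
    refine lintegral_congr fun y => ?_
    rw [one_mul, ← mul_assoc, ← ENNReal.ofReal_mul (Real.exp_pos y).le, ← Real.exp_add, ← two_mul,
      enorm_mul, Real.enorm_of_nonneg (Real.exp_pos _).le]
  have hVi : Integrable V := by
    refine ⟨(by fun_prop : Measurable V).aestronglyMeasurable, ?_⟩
    rw [HasFiniteIntegral, ← hsub]
    exact hint
  -- Transported in this way, `W (x * exp s)` becomes `exp (-2s) * V (y + s)`; the scalar factor is
  -- split off from the translation.
  have hbound : ∀ s : ℝ, ∫⁻ x in Ioi (0 : ℝ), ENNReal.ofReal x * ‖W (x * Real.exp s) - W x‖ₑ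
      ≤ ‖Real.exp (-2 * s) - 1‖ₑ * (∫⁻ y, ‖V y‖ₑ) + ∫⁻ y, ‖V (y + s) - V y‖ₑ := by
    intro s
    have htr : ∫⁻ y, ‖V y‖ₑ = ∫⁻ y, ‖V (y + s)‖ₑ :=
      (lintegral_add_right_eq_self (fun y => ‖V y‖ₑ) s).symm
    rw [hsub fun x => W (x * Real.exp s) - W x, htr, ← lintegral_const_mul _ (by fun_prop),
      ← lintegral_add_left (by fun_prop)]
    refine lintegral_mono fun y => ?_
    rw [← enorm_mul]
    refine le_trans (le_of_eq ?_) (enorm_add_le _ _)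
    congr 1
    simp only [hVdef]
    rw [Real.exp_add y s, mul_add, Real.exp_add (2 * y), show -2 * s = -(2 * s) by ring,
      Real.exp_neg]
    field_simp
    ring
  refine tendsto_of_tendsto_of_tendsto_of_le_of_le tendsto_const_nhds ?_ (fun _ => zero_le)
    hbound
  have h1 : Tendsto (fun s : ℝ => ‖Real.exp (-2 * s) - 1‖ₑ) (𝓝 0) (𝓝 0) := by
    have : Continuous fun s : ℝ => ‖Real.exp (-2 * s) - 1‖ₑ := by fun_prop
    simpa using this.tendsto 0
  have h2 := (ENNReal.Tendsto.mul_const h1 (Or.inr hVi.2.ne)).add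
    (tendsto_lintegral_translate hVi)
  simpa using h2

/-! ### The flux of first jumps -/

/-- The mean value of `f` after a jump from `x`. -/
def jumpMean (f : ℝ → ℝ) (x : ℝ) : ℝ := ∫ b, f (x * √b) ∂unif

theorem measurable_jumpMean {f : ℝ → ℝ} (hf : Continuous f) : Measurable (jumpMean f) := by
  have h : StronglyMeasurable fun q : ℝ × ℝ => f (q.1 * √q.2) :=
    (by fun_prop : Continuous fun q : ℝ × ℝ => f (q.1 * √q.2)).stronglyMeasurable
  exact h.integral_prod_right.measurable

theorem abs_jumpMean_le {f : ℝ → ℝ} {C : ℝ} (hC : ∀ x, |f x| ≤ C) (x : ℝ) :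
    |jumpMean f x| ≤ C := by
  have := norm_integral_le_of_norm_le_const (μ := unif) (f := fun b => f (x * √b))
    (Eventually.of_forall fun b => hC _)
  simpa [jumpMean] using this

theorem jumpMean_eq {f : ℝ → ℝ} (hf : Continuous f) {x : ℝ} (hx : 0 < x) :
    jumpMean f x = ∫ u in (0 : ℝ)..x, 2 * u / x ^ 2 * f u := by
  have h := intervalIntegral.integral_comp_mul_deriv (a := 0) (b := x)
    (f := fun u => u ^ 2 / x ^ 2) (f' := fun u => 2 * u / x ^ 2) (g := fun b => f (x * √b))
    (fun u _ => by simpa using (hasDerivAt_pow 2 u).div_const (x ^ 2))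
    (by fun_prop) (by fun_prop)
  rw [jumpMean, unif, ← integral_Ioc_eq_integral_Ioo,
    ← intervalIntegral.integral_of_le zero_le_one]
  have h1 : x ^ 2 / x ^ 2 = 1 := div_self (by positivity)
  simp only [h1, ne_eq, OfNat.ofNat_ne_zero, not_false_eq_true, zero_pow, zero_div] at h
  rw [← h]
  refine intervalIntegral.integral_congr fun u hu => ?_
  rw [uIcc_of_le hx.le] at hu
  simp only [Function.comp_apply]
  rw [← div_pow, Real.sqrt_sq (div_nonneg hu.1 hx.le), mul_div_cancel₀ _ hx.ne', mul_comm]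

theorem generator_eq {f : ℝ → ℝ} (hf : Continuous f) {x : ℝ} (hx : 0 < x) :
    generator R f x = x * deriv f x + x * R x * (jumpMean f x - f x) := by
  rw [generator, jumpMean_eq hf hx]

theorem map_seqLaw_two : seqLaw.map (fun u => (u 0, u 1)) = unif.prod unif := by
  have hm : Measurable fun u : ℕ → ℝ => (u 0, u 1) := by fun_prop
  refine Measure.ext_of_lintegral _ fun F hF => ?_
  rw [lintegral_map hF hm, lintegral_prod _ hF.aemeasurable]
  exact lintegral_seqLaw_two hF

theorem IsRate.measurable_survivorInv_right (hR : IsRate R) (x : ℝ≥0) :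
    Measurable fun a : ℝ => survivorInv R x a :=
  hR.measurable_survivorInv.comp (f := fun a : ℝ => (x, a)) (by fun_prop)

/-- The density of the flux of jumps of the stationary process from `y`, weighted with the mean
change of `f` at a jump from `y`. -/
def jumpFlux (R : ℝ → ℝ) (π : Measure ℝ≥0) (f : ℝ → ℝ) (y : ℝ) : ℝ :=
  y * R y * (tailRate R π y).toReal * (jumpMean f y - f y)

theorem measurable_jumpFlux (hRm : Measurable R) {f : ℝ → ℝ} (hf : Continuous f) :
    Measurable (jumpFlux R π f) := by
  have h1 := measurable_tailRate R π
  have h2 := measurable_jumpMean hf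
  have h3 := hf.measurable
  unfold jumpFlux
  fun_prop

/-- The mean change at a jump is at most `2C`, and the remaining weight is `x * R x` integrated
against `π`, which is `2`. -/
theorem IsStationary.lintegral_jumpFlux_lt_top (hπ : IsStationary R π) (hR : IsRate R)
    (hRm : Measurable R) {f : ℝ → ℝ} {C : ℝ} (hC : ∀ x, |f x| ≤ C) :
    ∫⁻ x in Ioi (0 : ℝ), ENNReal.ofReal x * ‖jumpFlux R π f x‖ₑ < ∞ := by
  have h := hπ.lintegral_rate hRm
  rw [hπ.lintegral_eq (by fun_prop)] at h
  have hk := measurable_tailRate R π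
  calc ∫⁻ x in Ioi (0 : ℝ), ENNReal.ofReal x * ‖jumpFlux R π f x‖ₑ
      ≤ ∫⁻ x in Ioi (0 : ℝ), ENNReal.ofReal (2 * C) * (ENNReal.ofReal x * tailRate R π x *
          ENNReal.ofReal (x.toNNReal * R x.toNNReal)) := by
        refine setLIntegral_mono' measurableSet_Ioi fun x hx => ?_
        have hx0 : (0 : ℝ) < x := hx
        have hRx := hR.nonneg x hx0
        rw [Real.coe_toNNReal _ hx0.le, jumpFlux, enorm_mul, enorm_mul,
          Real.enorm_of_nonneg (mul_nonneg hx0.le hRx), Real.enorm_of_nonneg ENNReal.toReal_nonneg,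
          ENNReal.ofReal_toReal (hπ.tailRate_lt_top hx0).ne]
        have hb : ‖jumpMean f x - f x‖ₑ ≤ ENNReal.ofReal (2 * C) := by
          rw [Real.enorm_eq_ofReal_abs]
          refine ENNReal.ofReal_le_ofReal ?_
          linarith [abs_sub (jumpMean f x) (f x), abs_jumpMean_le hC x, hC x]
        calc _ ≤ ENNReal.ofReal x *
              (ENNReal.ofReal (x * R x) * tailRate R π x * ENNReal.ofReal (2 * C)) := by gcongr
          _ = _ := by ring
    _ = ENNReal.ofReal (2 * C) * 2 := by
        rw [lintegral_const_mul' _ _ ENNReal.ofReal_ne_top, h]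
    _ < ∞ := ENNReal.mul_lt_top ENNReal.ofReal_lt_top (by simp)

/-- The mean change of `f` at the first jump, over the paths that jump by time `t`. -/
theorem IsStationary.integral_first_jump (hπ : IsStationary R π) (hR : IsRate R)
    (hRm : Measurable R) {f : ℝ → ℝ} (hf : Continuous f) {C : ℝ} (hC : ∀ x, |f x| ≤ C)
    {x : ℝ≥0} (hx : 0 < x) (t : ℝ≥0) :
    IntegrableOn (fun s => jumpFlux R π f (x * Real.exp s)) (Ioc (0 : ℝ) t) ∧
    (tailRate R π x).toReal * ∫ u, {u | jumpTime R x u 1 ≤ t}.indicator (fun u =>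
        f (posAfter R x u 1) - f (x * Real.exp (jumpTime R x u 1).toReal)) u ∂seqLaw
      = ∫ s in Ioc (0 : ℝ) t, jumpFlux R π f (x * Real.exp s) := by
  have hx' : (0 : ℝ) < x := hx
  have hm := hR.measurable_survivorInv_right x
  have hA : MeasurableSet {a : ℝ | survivorInv R x a < ∞} := hm measurableSet_Iio
  have hfm := hf.measurable
  have hjm := measurable_jumpMean hf
  have hk := measurable_tailRate R π
  set G : ℝ → ℝ := (Iic (t : ℝ)).indicator fun s =>
    jumpMean f (x * Real.exp s) - f (x * Real.exp s) with hG
  have hGm : Measurable G := Measurable.indicator (by fun_prop) measurableSet_Iic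
  have hGb : ∀ s, ‖G s‖ ≤ 2 * C := fun s => by
    have hC0 : 0 ≤ C := (abs_nonneg _).trans (hC 0)
    rw [hG, Real.norm_eq_abs, indicator]
    split_ifs
    · linarith [abs_sub (jumpMean f (x * Real.exp s)) (f (x * Real.exp s)),
        abs_jumpMean_le hC (x * Real.exp s), hC (x * Real.exp s)]
    · simpa using hC0
  -- The density in `map_survivorInv`: `tailRate R π x` times the law of the first jump time. Its
  -- product with `G` is `jumpFlux` along the flow, cut off at `t`.
  set w : ℝ → ℝ≥0∞ := fun s => ENNReal.ofReal (x * Real.exp s) *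
    (ENNReal.ofReal (R (x * Real.exp s)) * tailRate R π (x * Real.exp s)) with hw
  have hwm : Measurable w := by fun_prop
  have hwt : ∀ s, w s < ∞ := fun s => by
    refine ENNReal.mul_lt_top ENNReal.ofReal_lt_top (ENNReal.mul_lt_top ENNReal.ofReal_lt_top ?_)
    exact hπ.tailRate_lt_top (by positivity)
  have hlaw := hπ.map_survivorInv hR hRm hx
  have hfin : IsFiniteMeasure ((volume.restrict (Ioi 0)).withDensity w) := by
    rw [← hlaw]; exact Measure.smul_finite _ (hπ.tailRate_lt_top hx').ne
  have hflux : ∀ s, (w s).toReal • G s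
      = (Iic (t : ℝ)).indicator (fun s => jumpFlux R π f (x * Real.exp s)) s := fun s => by
    have hpos : 0 < x * Real.exp s := by positivity
    rw [hG, hw, smul_eq_mul]
    simp only [ENNReal.toReal_mul]
    rw [ENNReal.toReal_ofReal hpos.le, ENNReal.toReal_ofReal (hR.nonneg _ hpos), indicator,
      indicator]
    split_ifs
    · rw [jumpFlux]; ring
    · ring
  have hinter : Iic (t : ℝ) ∩ Ioi 0 = Ioc 0 (t : ℝ) := by
    rw [inter_comm]; exact Ioi_inter_Iic
  have hGi : Integrable G ((volume.restrict (Ioi 0)).withDensity w) :=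
    Integrable.of_bound hGm.aestronglyMeasurable (2 * C) (Eventually.of_forall hGb)
  rw [integrable_withDensity_iff_integrable_smul' hwm (Eventually.of_forall hwt)] at hGi
  simp only [hflux] at hGi
  rw [integrable_indicator_iff measurableSet_Iic, IntegrableOn,
    Measure.restrict_restrict measurableSet_Iic, hinter] at hGi
  refine ⟨hGi, ?_⟩
  have h1 : ∫ u, {u | jumpTime R x u 1 ≤ t}.indicator (fun u =>
        f (posAfter R x u 1) - f (x * Real.exp (jumpTime R x u 1).toReal)) u ∂seqLaw
      = ∫ a in {a | survivorInv R x a < ∞}, G (survivorInv R x a).toReal ∂unif := by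
    have hm' : Measurable fun p : ℝ × ℝ => survivorInv R x p.1 := hm.comp measurable_fst
    have hset : MeasurableSet {p : ℝ × ℝ | survivorInv R x p.1 ≤ t} := hm' measurableSet_Iic
    set F : ℝ × ℝ → ℝ := {p : ℝ × ℝ | survivorInv R x p.1 ≤ t}.indicator fun p =>
      f (x * Real.exp (survivorInv R x p.1).toReal * √p.2)
        - f (x * Real.exp (survivorInv R x p.1).toReal) with hF
    have hFm : Measurable F := Measurable.indicator (by fun_prop) hset
    have hFi : Integrable F (unif.prod unif) := by
      refine Integrable.of_bound hFm.aestronglyMeasurable (2 * C) (Eventually.of_forall fun p => ?_)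
      have hC0 : 0 ≤ C := (abs_nonneg _).trans (hC 0)
      rw [hF, Real.norm_eq_abs, indicator]
      split_ifs
      · linarith [abs_sub (f (x * Real.exp (survivorInv R x p.1).toReal * √p.2))
          (f (x * Real.exp (survivorInv R x p.1).toReal)),
          hC (x * Real.exp (survivorInv R x p.1).toReal * √p.2),
          hC (x * Real.exp (survivorInv R x p.1).toReal)]
      · simpa using hC0
    have e1 : ∫ u, F (u 0, u 1) ∂seqLaw = ∫ a, ∫ b, F (a, b) ∂unif ∂unif := by
      rw [← integral_prod _ hFi, ← map_seqLaw_two,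
        integral_map (by fun_prop) hFm.aestronglyMeasurable]
    rw [← integral_indicator hA]
    refine Eq.trans (integral_congr_ae (Eventually.of_forall fun u => ?_))
      (e1.trans (integral_congr_ae (Eventually.of_forall fun a => ?_)))
    · simp only [hF, indicator, mem_ofPred_eq, coe_posAfter, IsRate.jumpTime_one]
      simp [factorProd]
    · simp only [hF, hG]
      by_cases ha : survivorInv R x a ≤ t
      · have hlt : survivorInv R x a < ∞ := ha.trans_lt ENNReal.coe_lt_top
        simp only [indicator, mem_ofPred_eq, ha, hlt, if_true, mem_Iic,
          ENNReal.toReal_le_coe_of_le_coe ha]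
        rw [integral_sub, integral_const]
        · simp [jumpMean]
        · exact Integrable.of_bound (by fun_prop) C (Eventually.of_forall fun b => hC _)
        · exact integrable_const _
      -- An infinite jump time has `toReal` equal to `0`, which does lie in `Iic t`; only the
      -- restriction to finite times removes this case.
      · have hind : (Iic (t : ℝ)).indicator (fun s =>
            jumpMean f (x * Real.exp s) - f (x * Real.exp s)) (survivorInv R x a).toReal = 0 ∨
            ¬ survivorInv R x a < ∞ := by
          by_cases hlt : survivorInv R x a < ∞
          · left
            refine indicator_of_notMem (fun h => ha ?_) _
            exact (ENNReal.toReal_le_toReal hlt.ne ENNReal.coe_ne_top).1 (by simpa using h)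
          · exact Or.inr hlt
        have h0 : {a | survivorInv R x a < ∞}.indicator (fun a => (Iic (t : ℝ)).indicator (fun s =>
            jumpMean f (x * Real.exp s) - f (x * Real.exp s)) (survivorInv R x a).toReal) a = 0 := by
          rw [indicator_apply_eq_zero]
          intro h
          exact hind.resolve_right (not_not.2 h)
        rw [h0]
        simp [indicator, ha]
  have h2 := congrArg (fun μ => ∫ s, G s ∂μ) hlaw
  simp only [integral_smul_measure] at h2
  rw [integral_map (hm.ennreal_toReal).aemeasurable hGm.aestronglyMeasurable,
    integral_withDensity_eq_integral_toReal_smul hwm (Eventually.of_forall hwt)] at h2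
  simp only [hflux] at h2
  rw [integral_indicator measurableSet_Iic, Measure.restrict_restrict measurableSet_Iic, hinter]
    at h2
  rw [h1, ← smul_eq_mul, h2]

/-! ### Short-time asymptotics and the generator -/

theorem tendsto_coe_nnreal_nhdsGT : Tendsto ((↑) : ℝ≥0 → ℝ) (𝓝[>] 0) (𝓝[>] 0) := by
  refine tendsto_nhdsWithin_iff.2 ⟨?_, ?_⟩
  · exact (NNReal.continuous_coe.tendsto 0).mono_left nhdsWithin_le_nhds
  · filter_upwards [self_mem_nhdsWithin] with t ht
    exact ht

theorem tendsto_inv_mul_setLIntegral {G : ℝ≥0 → ℝ → ℝ≥0∞}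
    (hG : ∀ ε : ℝ≥0∞, 0 < ε → ∀ᶠ t : ℝ≥0 in 𝓝[>] 0, ∀ s ∈ Ioc (0 : ℝ) t, G t s ≤ ε) :
    Tendsto (fun t : ℝ≥0 => (t : ℝ≥0∞)⁻¹ * ∫⁻ s in Ioc (0 : ℝ) t, G t s) (𝓝[>] 0) (𝓝 0) := by
  refine ENNReal.tendsto_nhds_zero.2 fun ε hε => ?_
  filter_upwards [hG ε hε, self_mem_nhdsWithin] with t ht ht0
  have ht0' : (t : ℝ≥0∞) ≠ 0 := by
    have : (0 : ℝ≥0) < t := ht0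
    exact_mod_cast this.ne'
  calc (t : ℝ≥0∞)⁻¹ * ∫⁻ s in Ioc (0 : ℝ) t, G t s
      ≤ (t : ℝ≥0∞)⁻¹ * ∫⁻ _ in Ioc (0 : ℝ) t, ε := by
        gcongr ?_ * ?_
        · exact le_rfl
        · exact setLIntegral_mono' measurableSet_Ioc ht
    _ = ε := by
        rw [setLIntegral_const, Real.volume_Ioc, sub_zero, ENNReal.ofReal_coe_nnreal,
          mul_comm ε, ← mul_assoc, ENNReal.inv_mul_cancel ht0' ENNReal.coe_ne_top, one_mul]

/-- The process moves little in a short time, in the mean under a probability law. -/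
theorem IsRate.tendsto_lintegral_sub (hR : IsRate R) (hg : ∀ᵐ u ∂seqLaw, GoodSeq u)
    (π : Measure ℝ≥0) [IsProbabilityMeasure π] {f : ℝ → ℝ} (hf : Continuous f) {C : ℝ}
    (hC : ∀ x, |f x| ≤ C) :
    Tendsto (fun r : ℝ≥0 => ∫⁻ y : ℝ≥0, ∫⁻ v, ‖f (cellProcess R y v r) - f y‖ₑ ∂seqLaw ∂π)
      (𝓝 0) (𝓝 0) := by
  have hfm := hf.measurable
  have hm : ∀ r, Measurable fun p : ℝ≥0 × (ℕ → ℝ) => ‖f (cellProcess R p.1 p.2 r) - f p.1‖ₑ := by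
    intro r
    have := hR.measurable_cellProcess_prod r
    fun_prop
  have hprod : ∀ r : ℝ≥0, ∫⁻ y : ℝ≥0, ∫⁻ v, ‖f (cellProcess R y v r) - f y‖ₑ ∂seqLaw ∂π
      = ∫⁻ p, ‖f (cellProcess R p.1 p.2 r) - f p.1‖ₑ ∂(π.prod seqLaw) := fun r =>
    (lintegral_prod _ (hm r).aemeasurable).symm
  simp only [hprod]
  rw [show (0 : ℝ≥0∞) = ∫⁻ _, 0 ∂(π.prod seqLaw) by simp]
  refine tendsto_lintegral_filter_of_dominated_convergence (fun _ => ENNReal.ofReal (2 * C))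
    (Eventually.of_forall hm) (Eventually.of_forall fun r => Eventually.of_forall fun p => ?_)
    (by simpa using ENNReal.mul_ne_top ENNReal.ofNat_ne_top ENNReal.ofReal_ne_top) ?_
  · rw [Real.enorm_eq_ofReal_abs]
    refine ENNReal.ofReal_le_ofReal ?_
    linarith [abs_sub (f (cellProcess R p.1 p.2 r)) (f p.1), hC (cellProcess R p.1 p.2 r), hC p.1]
  · have hg' : ∀ᵐ p ∂(π.prod seqLaw), GoodSeq p.2 :=
      Measure.quasiMeasurePreserving_snd.ae hg
    filter_upwards [hg'] with p hp
    have h1 : Tendsto (fun r => cellProcess R p.1 p.2 r) (𝓝 0) (𝓝 p.1) := by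
      have := continuousWithinAt_cellProcess R p.1 p.2 0
      rw [show Ici (0 : ℝ≥0) = univ from Set.eq_univ_of_forall fun z => mem_Ici.2 zero_le,
        continuousWithinAt_univ] at this
      simpa [ContinuousAt, hR.cellProcess_zero p.1 (hp.1 0).2] using this
    have h2 : Tendsto (fun z : ℝ≥0 => ‖f z - f p.1‖ₑ) (𝓝 p.1) (𝓝 0) := by
      have : Continuous fun z : ℝ≥0 => ‖f z - f p.1‖ₑ := by fun_prop
      simpa using this.tendsto p.1
    exact h2.comp h1

/-- A continuously differentiable function is Lipschitz along the flow `x * exp s`, if `x f'(x)` is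
bounded. -/
theorem abs_sub_mul_exp_le {f : ℝ → ℝ} (hf : Differentiable ℝ f) {L : ℝ}
    (hL : ∀ x, |x * deriv f x| ≤ L) (x s r : ℝ) :
    |f (x * Real.exp s) - f (x * Real.exp r)| ≤ L * |s - r| := by
  have hd : ∀ s, HasDerivAt (fun s => f (x * Real.exp s))
      (x * Real.exp s * deriv f (x * Real.exp s)) s := fun s => by
    have := (hf (x * Real.exp s)).hasDerivAt.comp s ((Real.hasDerivAt_exp s).const_mul x)
    rw [mul_comm]; exact this
  have := Convex.norm_image_sub_le_of_norm_hasDerivWithin_le (s := univ) (x := r) (y := s)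
    (fun s _ => (hd s).hasDerivWithinAt) (fun s _ => hL _) convex_univ trivial trivial
  simpa using this

/-- The contribution of the flow to the generator. -/
theorem tendsto_lintegral_flow (π : Measure ℝ≥0) [IsProbabilityMeasure π] {f : ℝ → ℝ}
    (hf : ContDiff ℝ 1 f) {L : ℝ} (hL : ∀ x, |x * deriv f x| ≤ L) :
    Tendsto (fun t : ℝ≥0 => ∫⁻ x : ℝ≥0,
        ‖(t : ℝ)⁻¹ * (f (x * Real.exp t) - f x) - x * deriv f x‖ₑ ∂π) (𝓝[>] 0) (𝓝 0) := by
  have hfm := hf.continuous.measurable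
  have hdm := (hf.continuous_deriv le_rfl).measurable
  have hdiff : Differentiable ℝ f := hf.differentiable one_ne_zero
  rw [show (0 : ℝ≥0∞) = ∫⁻ _, 0 ∂π by simp]
  refine tendsto_lintegral_filter_of_dominated_convergence (fun _ => ENNReal.ofReal (2 * L))
    (Eventually.of_forall fun t => by fun_prop) ?_
    (by simpa using ENNReal.mul_ne_top ENNReal.ofNat_ne_top ENNReal.ofReal_ne_top) (Eventually.of_forall fun x => ?_)
  · filter_upwards [self_mem_nhdsWithin] with t ht
    have ht0 : (0 : ℝ) < t := ht
    refine Eventually.of_forall fun x => ?_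
    rw [Real.enorm_eq_ofReal_abs]
    refine ENNReal.ofReal_le_ofReal ?_
    have h1 := abs_sub_mul_exp_le hdiff hL x t 0
    rw [Real.exp_zero, mul_one, sub_zero, abs_of_pos ht0] at h1
    have h2 : |(t : ℝ)⁻¹ * (f (x * Real.exp t) - f x)| ≤ L := by
      rw [abs_mul, abs_of_pos (inv_pos.2 ht0), inv_mul_le_iff₀ ht0]
      linarith
    linarith [abs_sub ((t : ℝ)⁻¹ * (f (x * Real.exp t) - f x)) (x * deriv f x), hL x]
  · have hd : HasDerivAt (fun s : ℝ => f (x * Real.exp s)) (x * deriv f x) 0 := by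
      have := (hdiff (x * Real.exp 0)).hasDerivAt.comp 0 ((Real.hasDerivAt_exp 0).const_mul (x : ℝ))
      simp only [Real.exp_zero, mul_one] at this
      rw [mul_comm]; exact this
    have h1 := (hasDerivAt_iff_tendsto_slope_zero.1 hd).comp
      (tendsto_coe_nnreal_nhdsGT.mono_right (nhdsWithin_mono _ fun z (hz : 0 < z) => hz.ne'))
    have h2 : Tendsto (fun z : ℝ => ‖z - x * deriv f x‖ₑ) (𝓝 (x * deriv f x)) (𝓝 0) := by
      have : Continuous fun z : ℝ => ‖z - x * deriv f x‖ₑ := by fun_prop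
      simpa using this.tendsto (x * deriv f x)
    refine (h2.comp h1).congr fun t => ?_
    simp

/-- The paths that jump by time `t` move little, apart from their first jump. -/
theorem IsStationary.tendsto_lintegral_jumped (hπ : IsStationary R π) (hR : IsRate R)
    (hRm : Measurable R) (hg : ∀ᵐ u ∂seqLaw, GoodSeq u) {f : ℝ → ℝ} (hf : Continuous f) {C : ℝ}
    (hC : ∀ x, |f x| ≤ C) (L : ℝ) :
    Tendsto (fun t : ℝ≥0 => (t : ℝ≥0∞)⁻¹ * ∫⁻ x, ∫⁻ u, {u | jumpTime R x u 1 ≤ t}.indicator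
      (fun u => ‖f (cellProcess R x u t) - f (posAfter R x u 1)‖ₑ + ENNReal.ofReal (L * t)) u
      ∂seqLaw ∂π) (𝓝[>] 0) (𝓝 0) := by
  have := hπ.isProbabilityMeasure
  have hfm := hf.measurable
  have heq : ∀ t : ℝ≥0, ∫⁻ x, ∫⁻ u, {u | jumpTime R x u 1 ≤ t}.indicator
      (fun u => ‖f (cellProcess R x u t) - f (posAfter R x u 1)‖ₑ + ENNReal.ofReal (L * t)) u
      -- The renewal formula with `Φ` comparing the restarted path with its starting point, which
      -- again has law `π`.
      ∂seqLaw ∂π = ∫⁻ s in Ioc (0 : ℝ) t, ENNReal.ofReal (2 * Real.exp (-2 * s)) *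
        ((∫⁻ y : ℝ≥0, ∫⁻ v, ‖f (cellProcess R y v (t - s.toNNReal)) - f y‖ₑ ∂seqLaw ∂π)
          + ENNReal.ofReal (L * t)) := by
    intro t
    rw [hπ.lintegral_jumped hR hRm t
      (Φ := fun p => ‖f p.2 - f p.1‖ₑ + ENNReal.ofReal (L * t)) (by fun_prop)]
    refine setLIntegral_congr_fun measurableSet_Ioc fun s _ => ?_
    simp only [lintegral_add_right _ measurable_const, lintegral_const, measure_univ, mul_one]
  simp only [heq]
  refine tendsto_inv_mul_setLIntegral fun ε hε => ?_
  -- Two error terms of size `ε / 4`, multiplied by the bound `2` for the exponential density.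
  have h4 : 0 < ε / 4 := ENNReal.div_pos hε.ne' (by simp)
  have hsm := ENNReal.tendsto_nhds_zero.1 (hR.tendsto_lintegral_sub hg π hf hC) (ε / 4) h4
  obtain ⟨δ, hδ, hball⟩ := (nhds_bot_basis (α := ℝ≥0)).eventually_iff.1 hsm
  have hLt : ∀ᶠ t : ℝ≥0 in 𝓝[>] 0, ENNReal.ofReal (L * t) ≤ ε / 4 := by
    have hc : Continuous fun t : ℝ≥0 => ENNReal.ofReal (L * t) :=
      ENNReal.continuous_ofReal.comp (by fun_prop)
    have := hc.tendsto 0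
    simp only [NNReal.coe_zero, mul_zero, ENNReal.ofReal_zero] at this
    exact (ENNReal.tendsto_nhds_zero.1 this _ h4).filter_mono nhdsWithin_le_nhds
  have hδ' : ∀ᶠ t : ℝ≥0 in 𝓝[>] 0, t < δ := nhdsWithin_le_nhds (gt_mem_nhds hδ)
  filter_upwards [hLt, hδ'] with t h1 h2 s hs
  calc _ ≤ ENNReal.ofReal 2 * (ε / 4 + ε / 4) := by
        gcongr
        · have : Real.exp (-2 * s) ≤ 1 := Real.exp_le_one_iff.2 (by linarith [hs.1])
          linarith
        · exact hball (tsub_le_self.trans_lt h2)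
    _ = ε := by
        rw [ENNReal.ofReal_ofNat, ← two_mul, ← mul_assoc, show (2 : ℝ≥0∞) * 2 = 4 by norm_num,
          ENNReal.mul_div_cancel (by simp) (by simp)]

/-- With the density `x * tailRate R π x` included, the first term is the integral over `s ≤ t` of
`jumpFlux` at `x * exp s`, and the second is the same with `jumpFlux` at `x`. Their distance is a
time average of a dilation modulus in `L¹(x dx)`, which vanishes as `t` tends to `0`. -/
theorem IsStationary.tendsto_lintegral_first_jump (hπ : IsStationary R π) (hR : IsRate R)
    (hRm : Measurable R) {f : ℝ → ℝ} (hf : Continuous f) {C : ℝ} (hC : ∀ x, |f x| ≤ C) :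
    Tendsto (fun t : ℝ≥0 => (t : ℝ≥0∞)⁻¹ * ∫⁻ x : ℝ≥0,
      ‖∫ u, {u | jumpTime R x u 1 ≤ t}.indicator (fun u => f (posAfter R x u 1)
          - f (x * Real.exp (jumpTime R x u 1).toReal)) u ∂seqLaw
        - t * (x * R x * (jumpMean f x - f x))‖ₑ ∂π) (𝓝[>] 0) (𝓝 0) := by
  have hfm := hf.measurable
  have hW := measurable_jumpFlux (π := π) hRm hf
  have hle : ∀ t : ℝ≥0, ∫⁻ x : ℝ≥0,
      ‖∫ u, {u | jumpTime R x u 1 ≤ t}.indicator (fun u => f (posAfter R x u 1)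
          - f (x * Real.exp (jumpTime R x u 1).toReal)) u ∂seqLaw
        - t * (x * R x * (jumpMean f x - f x))‖ₑ ∂π
      ≤ ∫⁻ s in Ioc (0 : ℝ) t, ∫⁻ x in Ioi (0 : ℝ),
        ENNReal.ofReal x * ‖jumpFlux R π f (x * Real.exp s) - jumpFlux R π f x‖ₑ := by
    intro t
    have hBm : Measurable fun x : ℝ≥0 => ∫ u, {u | jumpTime R x u 1 ≤ t}.indicator
        (fun u => f (posAfter R x u 1) - f (x * Real.exp (jumpTime R x u 1).toReal)) u ∂seqLaw := by
      have hJ := hR.measurable_jumpTime 1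
      have hY := hR.measurable_posAfter 1
      have hset : MeasurableSet {p : ℝ≥0 × (ℕ → ℝ) | jumpTime R p.1 p.2 1 ≤ t} :=
        hJ measurableSet_Iic
      have h : StronglyMeasurable ({p : ℝ≥0 × (ℕ → ℝ) | jumpTime R p.1 p.2 1 ≤ t}.indicator
          fun p => f (posAfter R p.1 p.2 1)
            - f (p.1 * Real.exp (jumpTime R p.1 p.2 1).toReal)) :=
        (Measurable.indicator (by fun_prop) hset).stronglyMeasurable
      exact h.integral_prod_right'.measurable
    have hjm := measurable_jumpMean hf
    rw [hπ.lintegral_eq (by fun_prop), lintegral_lintegral_swap (by fun_prop)]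
    refine setLIntegral_mono' measurableSet_Ioi fun x hx => ?_
    lift x to ℝ≥0 using (le_of_lt hx)
    have hx0 : 0 < x := hx
    have hx0' : (0 : ℝ) < x := hx
    obtain ⟨hi, he⟩ := hπ.integral_first_jump hR hRm hf hC hx0 t
    rw [Real.toNNReal_coe, lintegral_const_mul' _ _ ENNReal.ofReal_ne_top, mul_assoc]
    gcongr
    have hk : tailRate R π x = ‖(tailRate R π x).toReal‖ₑ := by
      rw [Real.enorm_of_nonneg ENNReal.toReal_nonneg,
        ENNReal.ofReal_toReal (hπ.tailRate_lt_top hx0').ne]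
    rw [hk, ← enorm_mul, mul_sub, he]
    have hconst : (tailRate R π x).toReal * (t * (x * R x * (jumpMean f x - f x)))
        = ∫ _ in Ioc (0 : ℝ) t, jumpFlux R π f x := by
      rw [setIntegral_const, jumpFlux]
      simp only [Real.volume_real_Ioc_of_le t.coe_nonneg, sub_zero, smul_eq_mul]
      ring
    rw [hconst, ← integral_sub hi (integrable_const _)]
    exact enorm_integral_le_lintegral_enorm _
  have hlim : Tendsto (fun t : ℝ≥0 => (t : ℝ≥0∞)⁻¹ * ∫⁻ s in Ioc (0 : ℝ) t,
      ∫⁻ x in Ioi (0 : ℝ),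
        ENNReal.ofReal x * ‖jumpFlux R π f (x * Real.exp s) - jumpFlux R π f x‖ₑ)
      (𝓝[>] 0) (𝓝 0) := by
    refine tendsto_inv_mul_setLIntegral fun ε hε => ?_
    have h := ENNReal.tendsto_nhds_zero.1
      (tendsto_lintegral_dilate hW (hπ.lintegral_jumpFlux_lt_top hR hRm hC)) ε hε
    obtain ⟨δ, hδ, hball⟩ := Metric.eventually_nhds_iff.1 h
    have hδ' : ∀ᶠ t : ℝ≥0 in 𝓝[>] 0, (t : ℝ) < δ :=
      tendsto_coe_nnreal_nhdsGT.eventually (nhdsWithin_le_nhds (gt_mem_nhds hδ))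
    filter_upwards [hδ'] with t ht s hs
    refine hball ?_
    rw [Real.dist_eq, sub_zero, abs_of_pos hs.1]
    exact hs.2.trans_lt ht
  refine tendsto_of_tendsto_of_tendsto_of_le_of_le tendsto_const_nhds hlim (fun _ => zero_le)
    fun t => ?_
  have := hle t
  simp only
  gcongr

/-- The increment of the semigroup, decomposed at the first jump. -/
theorem IsRate.enorm_cellOp_sub_generator_le (hR : IsRate R) {f : ℝ → ℝ}
    (hf : Differentiable ℝ f) {C L : ℝ} (hC : ∀ x, |f x| ≤ C)
    (hL : ∀ x, |x * deriv f x| ≤ L) {x t : ℝ≥0} (hx : 0 < x) (ht : 0 < t) :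
    ‖(t : ℝ)⁻¹ * (cellOp R t (fun y => f y) x - f x) - generator R f x‖ₑ
      ≤ ‖(t : ℝ)⁻¹ * (f (x * Real.exp t) - f x) - x * deriv f x‖ₑ
        + (t : ℝ≥0∞)⁻¹ * (∫⁻ u, {u | jumpTime R x u 1 ≤ t}.indicator
          (fun u => ‖f (cellProcess R x u t) - f (posAfter R x u 1)‖ₑ + ENNReal.ofReal (L * t)) u
          ∂seqLaw)
        + (t : ℝ≥0∞)⁻¹ * ‖∫ u, {u | jumpTime R x u 1 ≤ t}.indicator (fun u =>
            f (posAfter R x u 1) - f (x * Real.exp (jumpTime R x u 1).toReal)) u ∂seqLaw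
          - t * (x * R x * (jumpMean f x - f x))‖ₑ := by
  have hfm := hf.continuous.measurable
  have ht0 : (0 : ℝ) < t := ht
  have hJ := hR.measurable_jumpTime_left x 1
  have hY := hR.measurable_posAfter_left x 1
  have hX := hR.measurable_cellProcess x t
  have hset : MeasurableSet {u : ℕ → ℝ | jumpTime R x u 1 ≤ t} := hJ measurableSet_Iic
  have hb : ∀ (g : (ℕ → ℝ) → ℝ), Measurable g → Integrable (fun u => f (g u)) seqLaw :=
    fun g hg => Integrable.of_bound (hfm.comp hg).aestronglyMeasurable C
      (Eventually.of_forall fun u => hC _)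
  have iX := hb (fun u => cellProcess R x u t) (by fun_prop)
  have iY := hb (fun u => posAfter R x u 1) (by fun_prop)
  have iZ := hb (fun u => x * Real.exp (jumpTime R x u 1).toReal) (by fun_prop)
  -- On a jump by time `t`, `f (X_t) - f (x * exp t)` telescopes through the position after the
  -- first jump and the one before it. `B` is the jump itself; `A` collects the small rest, the
  -- motion after the jump and the flow from the jump time to `t`.
  set A : (ℕ → ℝ) → ℝ := {u | jumpTime R x u 1 ≤ t}.indicator fun u =>
    (f (cellProcess R x u t) - f (posAfter R x u 1))
      + (f (x * Real.exp (jumpTime R x u 1).toReal) - f (x * Real.exp t)) with hA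
  set B : (ℕ → ℝ) → ℝ := {u | jumpTime R x u 1 ≤ t}.indicator fun u =>
    f (posAfter R x u 1) - f (x * Real.exp (jumpTime R x u 1).toReal) with hB
  have iA : Integrable A seqLaw :=
    ((iX.sub iY).add (iZ.sub (integrable_const _))).indicator hset
  have iB : Integrable B seqLaw := (iY.sub iZ).indicator hset
  have hsum : cellOp R t (fun y => f y) x
      = f (x * Real.exp t) + (∫ u, A u ∂seqLaw) + ∫ u, B u ∂seqLaw := by
    have h : ∀ u, f (cellProcess R x u t) = f (x * Real.exp t) + A u + B u := by
      intro u
      by_cases hu : jumpTime R x u 1 ≤ t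
      · rw [hA, hB, indicator_of_mem (s := {u | jumpTime R x u 1 ≤ t}) hu,
          indicator_of_mem (s := {u | jumpTime R x u 1 ≤ t}) hu]
        ring
      · rw [hA, hB, indicator_of_notMem (s := {u | jumpTime R x u 1 ≤ t}) hu,
          indicator_of_notMem (s := {u | jumpTime R x u 1 ≤ t}) hu, add_zero, add_zero]
        rw [not_le, hR.lt_jumpTime_one_iff] at hu
        have := hR.cellProcess_of_lt (x := x) (u := u) (k := 0) (a := 0) (r := t)
          (by simp) (by simpa [posAfter, factorProd] using hu)
        rw [zero_add] at this
        rw [this]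
        simp [posAfter, factorProd, Real.coe_toNNReal _ (Real.exp_pos (t : ℝ)).le]
    rw [cellOp]
    simp only [h]
    have i1 : Integrable (fun u => f (x * Real.exp t) + A u) seqLaw := (integrable_const _).add iA
    rw [integral_add i1 iB, integral_add (integrable_const _) iA,
      integral_const]
    simp
  have hsplit : (t : ℝ)⁻¹ * (cellOp R t (fun y => f y) x - f x) - generator R f x
      = ((t : ℝ)⁻¹ * (f (x * Real.exp t) - f x) - x * deriv f x) + (t : ℝ)⁻¹ * (∫ u, A u ∂seqLaw)
        + (t : ℝ)⁻¹ * ((∫ u, B u ∂seqLaw) - t * (x * R x * (jumpMean f x - f x))) := by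
    rw [hsum, generator_eq hf.continuous (show (0 : ℝ) < x from hx)]
    field_simp
    ring
  have hinv : ‖(t : ℝ)⁻¹‖ₑ = (t : ℝ≥0∞)⁻¹ := by
    rw [Real.enorm_of_nonneg (inv_nonneg.2 ht0.le), ENNReal.ofReal_inv_of_pos ht0,
      ENNReal.ofReal_coe_nnreal]
  rw [hsplit]
  refine (enorm_add_le _ _).trans (add_le_add ((enorm_add_le _ _).trans (add_le_add le_rfl ?_)) ?_)
  · rw [enorm_mul, hinv]
    gcongr
    refine (enorm_integral_le_lintegral_enorm _).trans (lintegral_mono fun u => ?_)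
    by_cases hu : jumpTime R x u 1 ≤ t
    · rw [hA, indicator_of_mem (s := {u | jumpTime R x u 1 ≤ t}) hu,
        indicator_of_mem (s := {u | jumpTime R x u 1 ≤ t}) hu]
      refine (enorm_add_le _ _).trans (add_le_add le_rfl ?_)
      rw [Real.enorm_eq_ofReal_abs]
      refine ENNReal.ofReal_le_ofReal ((abs_sub_mul_exp_le hf hL _ _ _).trans ?_)
      have h1 : (jumpTime R x u 1).toReal ≤ t := ENNReal.toReal_le_coe_of_le_coe hu
      have h2 : 0 ≤ (jumpTime R x u 1).toReal := ENNReal.toReal_nonneg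
      have hL0 : 0 ≤ L := (abs_nonneg _).trans (hL 0)
      rw [abs_sub_comm, abs_of_nonneg (sub_nonneg.2 h1)]
      gcongr
      linarith
    · rw [hA, indicator_of_notMem (s := {u | jumpTime R x u 1 ≤ t}) hu]
      simp
  · rw [enorm_mul, hinv]

/-- Convergence to the generator in the mean under a stationary law. -/
theorem IsStationary.tendsto_generator (hπ : IsStationary R π) (hR : IsRate R)
    (hRm : Measurable R) (hg : ∀ᵐ u ∂seqLaw, GoodSeq u) {f : ℝ → ℝ} (hf : ContDiff ℝ 1 f)
    (hs : HasCompactSupport f) :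
    MemLp (fun x : ℝ≥0 => generator R f x) 1 π ∧
    Tendsto (fun t : ℝ≥0 => eLpNorm (fun x : ℝ≥0 =>
        (t : ℝ)⁻¹ * (cellOp R t (fun y => f y) x - f x) - generator R f x) 1 π)
      (𝓝[>] 0) (𝓝 0) := by
  have := hπ.isProbabilityMeasure
  have hdiff : Differentiable ℝ f := hf.differentiable one_ne_zero
  have hdc := hf.continuous_deriv le_rfl
  have hfm := hf.continuous.measurable
  have hdm := hdc.measurable
  obtain ⟨C, hC⟩ := hs.exists_bound_of_continuous hf.continuous
  obtain ⟨L, hL⟩ : ∃ L, ∀ x, ‖x * deriv f x‖ ≤ L :=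
    HasCompactSupport.exists_bound_of_continuous (f := fun x => x * deriv f x)
      (hs.deriv.mul_left (f := fun x => x)) (by fun_prop)
  simp only [Real.norm_eq_abs] at hC hL
  have hpos : ∀ᵐ x ∂π, 0 < x := by
    have : ∀ᵐ x ∂π, x ≠ 0 := by simpa [ae_iff] using hπ.zero
    filter_upwards [this] with x hx using pos_iff_ne_zero.2 hx
  have hjm := measurable_jumpMean hf.continuous
  constructor
  · have hae : (fun x : ℝ≥0 => generator R f x)
        =ᵐ[π] fun x : ℝ≥0 => x * deriv f x + x * R x * (jumpMean f x - f x) := by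
      filter_upwards [hpos] with x hx
      exact generator_eq hf.continuous (show (0 : ℝ) < x from hx)
    rw [memLp_congr_ae hae, memLp_one_iff_integrable]
    refine Integrable.add ?_ ?_
    · exact Integrable.of_bound (by fun_prop) L (Eventually.of_forall fun x => hL x)
    -- The rate `x * R x` is integrable against `π` with integral `2`; the mean change of `f` at a
    -- jump is bounded.
    · refine Integrable.mul_bdd (c := 2 * C) ?_ (by fun_prop) (Eventually.of_forall fun x => ?_)
      · refine ⟨by fun_prop, ?_⟩
        rw [HasFiniteIntegral]
        have h : ∫⁻ x : ℝ≥0, ‖(x : ℝ) * R x‖ₑ ∂π = 2 := by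
          rw [← hπ.lintegral_rate hRm]
          refine lintegral_congr_ae ?_
          filter_upwards [hpos] with x hx
          exact Real.enorm_of_nonneg (mul_nonneg x.coe_nonneg (hR.nonneg _ hx))
        rw [h]; simp
      · rw [Real.norm_eq_abs]
        linarith [abs_sub (jumpMean f x) (f x), abs_jumpMean_le hC x, hC x]
  · have h1 := tendsto_lintegral_flow π hf hL
    have h2 := hπ.tendsto_lintegral_jumped hR hRm hg hf.continuous hC L
    have h3 := hπ.tendsto_lintegral_first_jump hR hRm hf.continuous hC
    have h := (h1.add h2).add h3
    simp only [add_zero] at h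
    refine tendsto_of_tendsto_of_tendsto_of_le_of_le' tendsto_const_nhds h
      (Eventually.of_forall fun _ => zero_le) ?_
    filter_upwards [self_mem_nhdsWithin] with t ht
    have ht0 : (t : ℝ≥0∞) ≠ 0 := by
      have : (0 : ℝ≥0) < t := ht
      exact_mod_cast this.ne'
    have hinv : (t : ℝ≥0∞)⁻¹ ≠ ∞ := ENNReal.inv_ne_top.2 ht0
    have hJm : Measurable fun x : ℝ≥0 => ∫⁻ u, {u | jumpTime R x u 1 ≤ t}.indicator
          (fun u => ‖f (cellProcess R x u t) - f (posAfter R x u 1)‖ₑ + ENNReal.ofReal (L * t)) u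
          ∂seqLaw := by
      have hJ := hR.measurable_jumpTime 1
      have hY := hR.measurable_posAfter 1
      have hX := hR.measurable_cellProcess_prod t
      have hset : MeasurableSet {p : ℝ≥0 × (ℕ → ℝ) | jumpTime R p.1 p.2 1 ≤ t} :=
        hJ measurableSet_Iic
      exact Measurable.lintegral_prod_right' (ν := seqLaw)
        (f := {p : ℝ≥0 × (ℕ → ℝ) | jumpTime R p.1 p.2 1 ≤ t}.indicator fun p =>
          ‖f (cellProcess R p.1 p.2 t) - f (posAfter R p.1 p.2 1)‖ₑ + ENNReal.ofReal (L * t))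
        (Measurable.indicator (by fun_prop) hset)
    rw [eLpNorm_one_eq_lintegral_enorm, ← lintegral_const_mul' _ _ hinv,
      ← lintegral_const_mul' _ _ hinv, ← lintegral_add_left (by fun_prop),
      ← lintegral_add_left (by fun_prop)]
    refine lintegral_mono_ae ?_
    filter_upwards [hpos] with x hx
    exact hR.enorm_cellOp_sub_generator_le hdiff hC hL hx ht

end

/-! ### Changing the rate on a null set -/

section

variable {R R' : ℝ → ℝ} {π : Measure ℝ≥0}

theorem survivor_congr_ae (h : R =ᵐ[volume.restrict (Ioi 0)] R') {z : ℝ} (hz : 0 ≤ z) (t : ℝ) :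
    survivor R z t = survivor R' z t := by
  rw [survivor, survivor, intervalIntegral.integral_congr_ae]
  filter_upwards [(ae_restrict_iff' measurableSet_Ioi).1 h] with x hx hx'
  exact hx (lt_of_le_of_lt (le_min hz (mul_nonneg hz (Real.exp_pos t).le)) hx'.1)

theorem jumpTime_congr_ae (h : R =ᵐ[volume.restrict (Ioi 0)] R') (x : ℝ≥0) (u : ℕ → ℝ) (k : ℕ) :
    jumpTime R x u k = jumpTime R' x u k := by
  induction k with
  | zero => rfl
  | succ k ih =>
    have hp : posAfter R x u k = posAfter R' x u k := by rw [posAfter, posAfter, ih]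
    rw [jumpTime_succ, jumpTime_succ, ih, hp, survivorInv, survivorInv]
    simp only [survivor_congr_ae h (NNReal.coe_nonneg _)]

/-- The rate enters only through its integrals in `survivor`, so the paths themselves are unchanged.
-/
theorem cellProcess_congr_ae (h : R =ᵐ[volume.restrict (Ioi 0)] R') :
    cellProcess R = cellProcess R' := by
  ext x u t
  rcases exists_jumpTime_le_lt_or R x u t with ⟨k, h1, h2⟩ | h0
  · rw [cellProcess_eq h1 h2]
    rw [jumpTime_congr_ae h] at h1 h2
    rw [cellProcess_eq h1 h2]
  · rw [cellProcess_eq_zero h0]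
    simp only [jumpTime_congr_ae h] at h0
    rw [cellProcess_eq_zero h0]

theorem IsStationary.ae_eq (hπ : IsStationary R π) (h : R =ᵐ[volume.restrict (Ioi 0)] R') :
    ∀ᵐ z : ℝ≥0 ∂π, R z = R' z := by
  have h1 := hπ.absolutelyContinuous.ae_le ((ae_restrict_iff' measurableSet_Ioi).1 h)
  have h2 := ae_of_ae_map NNReal.continuous_coe.measurable.aemeasurable h1
  have h3 : ∀ᵐ x ∂π, x ≠ 0 := by simpa [ae_iff] using hπ.zero
  filter_upwards [h2, h3] with z hz hz0
  exact hz (pos_iff_ne_zero.2 hz0)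

theorem IsStationary.congr_ae (hπ : IsStationary R π) (h : R =ᵐ[volume.restrict (Ioi 0)] R') :
    IsStationary R' π where
  isProbabilityMeasure := hπ.isProbabilityMeasure
  absolutelyContinuous := hπ.absolutelyContinuous
  zero := hπ.zero
  stationary t x := by
    rw [hπ.stationary t x, growthFragOp, growthFragOp]
    congr 1
    refine lintegral_congr fun s => ?_
    congr 1
    refine lintegral_congr_ae (ae_restrict_of_ae ?_)
    filter_upwards [hπ.ae_eq h] with z hz
    rw [hz]

/-- A rate function can be modified on a null set to become measurable. -/
theorem IsRate.exists_measurable (hR : IsRate R) :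
    ∃ R', IsRate R' ∧ Measurable R' ∧ R =ᵐ[volume.restrict (Ioi 0)] R' := by
  have hm := hR.locallyIntegrableOn.aestronglyMeasurable
  have hae : R =ᵐ[volume.restrict (Ioi 0)] fun x => max (hm.mk R x) 0 := by
    filter_upwards [hm.ae_eq_mk, ae_restrict_mem measurableSet_Ioi] with x hx hx0
    rw [← hx, max_eq_left (hR.nonneg x hx0)]
  refine ⟨fun x => max (hm.mk R x) 0, ⟨fun x _ => le_max_right _ _, ?_⟩,
    hm.measurable_mk.max measurable_const, hae⟩
  intro x hx
  obtain ⟨s, hs, hi⟩ := hR.locallyIntegrableOn x hx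
  -- The two rates are known to agree almost everywhere only on the half-line, hence the
  -- intersection.
  refine ⟨s ∩ Ioi 0, inter_mem hs self_mem_nhdsWithin, ?_⟩
  exact (hi.mono_set inter_subset_left).congr
    (hae.filter_mono (ae_mono (Measure.restrict_mono inter_subset_right le_rfl)))

theorem IsRate.measurable_map_path {Ω : Type*} [MeasurableSpace Ω] {Pr : Measure Ω}
    [IsProbabilityMeasure Pr] {U : ℕ → Ω → ℝ} (hU : IsUniformSequence Pr U) (hR : IsRate R) :
    Measurable (fun x : ℝ≥0 => Pr.map (fun ω t => cellProcess R x (fun n => U n ω) t)) := by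
  have hpath : Measurable fun p : ℝ≥0 × Ω => fun t => cellProcess R p.1 (fun n => U n p.2) t :=
    measurable_pi_iff.2 fun t => (hR.measurable_cellProcess_prod t).comp
      (f := fun p : ℝ≥0 × Ω => (p.1, fun n => U n p.2))
      (measurable_fst.prodMk (hU.measurable_seq.comp measurable_snd))
  refine Measure.measurable_of_measurable_coe _ fun A hA => ?_
  have h : ∀ x : ℝ≥0, Pr.map (fun ω t => cellProcess R x (fun n => U n ω) t) A
      = Pr (Prod.mk x ⁻¹' ((fun p : ℝ≥0 × Ω => fun t =>
        cellProcess R p.1 (fun n => U n p.2) t) ⁻¹' A)) := fun x =>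
    Measure.map_apply (hpath.comp measurable_prodMk_left) hA
  simp only [h]
  exact measurable_measure_prodMk_left (hpath hA)

end

end CellProcess

end

/-! ### Assembly on the given probability space -/

theorem proposition3p5 {Ω : Type*} [MeasurableSpace Ω] (Pr : Measure Ω)
    [IsProbabilityMeasure Pr] (U : ℕ → Ω → ℝ) (hU : CellProcess.IsUniformSequence Pr U)
    (R : ℝ → ℝ) (hR_nonneg : ∀ x, 0 < x → 0 ≤ R x)
    (hR_loc : LocallyIntegrableOn R (Set.Ioi 0) volume) :
    -- all paths are càdlàg, and the laws of the paths form a probability kernel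
    ((∀ x ω, CellProcess.IsCadlag (CellProcess.cellProcess R x (fun n => U n ω))) ∧
      (∀ x t, Measurable (fun ω => CellProcess.cellProcess R x (fun n => U n ω) t)) ∧
      Measurable (fun x : ℝ≥0 =>
        Pr.map (fun ω t => CellProcess.cellProcess R x (fun n => U n ω) t))) ∧
    -- `P_t` is a semigroup of operators on bounded Borel functions
    (∀ f, CellProcess.IsBoundedBorel f →
      (∀ t, CellProcess.IsBoundedBorel (CellProcess.transitionOp Pr U R t f)) ∧
      CellProcess.transitionOp Pr U R 0 f = f ∧
      ∀ s t, CellProcess.transitionOp Pr U R (s + t) f =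
        CellProcess.transitionOp Pr U R s (CellProcess.transitionOp Pr U R t f)) ∧
    -- the strong Markov property, for the natural filtration
    (∀ (x : ℝ≥0) (Ω' : Type*) [MeasurableSpace Ω'] (P : Measure Ω') [IsProbabilityMeasure P]
      (X : ℝ≥0 → Ω' → ℝ≥0) (hX : CellProcess.IsRealization Pr U R x P X)
      (τ : Ω' → WithTop ℝ≥0)
      (hτ : IsStoppingTime (Filtration.natural X hX.stronglyMeasurable) τ)
      (t : ℝ≥0) (f : ℝ≥0 → ℝ), CellProcess.IsBoundedBorel f →
      P[{ω | τ ω < ⊤}.indicator (fun ω => f (X ((τ ω).untopA + t) ω)) | hτ.measurableSpace]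
        =ᵐ[P] {ω | τ ω < ⊤}.indicator
          (fun ω => CellProcess.transitionOp Pr U R t f (X (τ ω).untopA ω))) ∧
    ∀ π : Measure ℝ≥0, CellProcess.IsStationary R π →
      -- `π` is invariant
      (∀ (t : ℝ≥0) (f : ℝ≥0 → ℝ), CellProcess.IsBoundedBorel f →
        ∫ x, CellProcess.transitionOp Pr U R t f x ∂π = ∫ x, f x ∂π) ∧
      -- convergence to the generator in `L¹(π)`
      (∀ f : ℝ → ℝ, ContDiff ℝ 1 f → HasCompactSupport f → tsupport f ⊆ Set.Ioi 0 →
        MemLp (fun x : ℝ≥0 => CellProcess.generator R f x) 1 π ∧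
        Tendsto (fun t : ℝ≥0 => eLpNorm (fun x : ℝ≥0 =>
            (t : ℝ)⁻¹ * (CellProcess.transitionOp Pr U R t (fun y => f y) x - f x)
              - CellProcess.generator R f x) 1 π)
          (𝓝[>] 0) (𝓝 0)) := by
  have hR : CellProcess.IsRate R := ⟨hR_nonneg, hR_loc⟩
  refine ⟨⟨fun x ω => ?_, fun x t => ?_, hR.measurable_map_path hU⟩, fun f hf => ?_, ?_,
    fun π hπ => ?_⟩
  · exact CellProcess.isCadlag_cellProcess (hU.goodSeq ω).1 (hU.goodSeq ω).2 R x
  · exact (hR.measurable_cellProcess x t).comp hU.measurable_seq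
  · refine ⟨fun t => ?_, ?_, fun s t => ?_⟩
    · rw [hU.transitionOp_eq hR t hf.1]
      exact hR.isBoundedBorel_cellOp t hf
    · rw [hU.transitionOp_eq hR 0 hf.1]
      exact hR.cellOp_zero hU.ae_goodSeq f
    · rw [hU.transitionOp_eq hR (s + t) hf.1, hU.transitionOp_eq hR t hf.1,
        hU.transitionOp_eq hR s (hR.isBoundedBorel_cellOp t hf).1]
      exact hR.cellOp_add s t hf
  · intro x Ω' _ P _ X hX τ hτ t f hf
    rw [hU.transitionOp_eq hR t hf.1]
    refine hR.strongMarkov (x := x) hU.ae_goodSeq hX.stronglyMeasurable (fun ω t => (hX.cadlag ω t).1)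
      ?_ hτ t hf
    rw [hX.law, ← hU.map_seq, Measure.map_map (hR.measurable_path x) hU.measurable_seq]
    rfl
  -- The integrals against the density of `π` are computed for a Borel version of the rate. The
  -- paths do not see the change, and by absolute continuity of `π` neither do the stationary
  -- equation and, `π`-almost everywhere, the generator.
  · obtain ⟨R', hR', hRm, hRR⟩ := hR.exists_measurable
    have hπ' := hπ.congr_ae hRR
    have hop : ∀ (t : ℝ≥0) (f : ℝ≥0 → ℝ), Measurable f →
        CellProcess.transitionOp Pr U R t f = CellProcess.cellOp R' t f := fun t f hf => by
      rw [hU.transitionOp_eq hR t hf]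
      ext x
      rw [CellProcess.cellOp, CellProcess.cellOp, CellProcess.cellProcess_congr_ae hRR]
    refine ⟨fun t f hf => ?_, fun f hf hs _ => ?_⟩
    · rw [hop t f hf.1]
      exact hπ'.integral_cellOp hR' hRm t hf
    · have hgen : ∀ᵐ x : ℝ≥0 ∂π, CellProcess.generator R' f x = CellProcess.generator R f x := by
        filter_upwards [hπ.ae_eq hRR] with x hx
        rw [CellProcess.generator, CellProcess.generator, hx]
      have hfm : Measurable fun y : ℝ≥0 => f y := by
        have := hf.continuous.measurable
        fun_prop
      obtain ⟨h1, h2⟩ := hπ'.tendsto_generator hR' hRm hU.ae_goodSeq hf hs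
      refine ⟨(memLp_congr_ae hgen).1 h1, h2.congr fun t => eLpNorm_congr_ae ?_⟩
      filter_upwards [hgen] with x hx
      rw [hop t _ hfm, hx]
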